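/- Let $P=\langle x\mid x=xx\rangle$ and $w=xxx$. Diagrams over $P$ have two kinds of cells, $C(x,xx)$ and $C(xx,x)$. Let $K(P,w)$ be the cube complex whose vertices are the reduced diagrams $U$ with top label $w$, and whose $k$-cubes are $C(U,\Phi)$, with vertices $UV$ ($V$ a prefix of $\Phi$), where $\Phi$ is a thin diagram (all of its cells are attached to its top path) with $k$ cells and with top label the bottom label of $U$; here $UV$ is the reduced form of the concatenation $U\circ V$. Each $k$-cube carries the metric of $[0,1]^k$ and $d$ is the induced length metric. Write $H<W$ if $H$ is a prefix of $W$. For vertices $U,V$, let $K_{U,V}$ be the full subcomplex spanned by the vertices $UH$ with $H<U^{-1}V$. Let $g$ be the diagram with top and bottom label $xxx$ obtained as follows: split the first edge of $xxx$, then split the second edge of $xxxx$, then merge the third and fourth edges of $xxxxx$, then merge the third and fourth edges of $xxxx$ (splitting an edge means attaching a cell $C(x,xx)$, merging two edges means attaching a cell $C(xx,x)$). It acts on $K(P,w)$ by left multiplication on vertices, extended affinely to cubes. For a cube $Q=C(U,\Phi)$ with cells $E_1,\dots,E_k$ of $\Phi$ from left to right, and $J\subset\{1,\dots,k\}$, let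 $\Phi_J$ be the prefix of $\Phi$ with cells $E_j$, $j\in J$, and $J'$ the complement of $J$. Let $W_0=U^{-1}gU$, $\Phi_T=\mathrm{glb}(W_0,\Phi)$, $W_1=\Phi_{T'}^{-1}\circ W_0$, $\Phi_L=\mathrm{glb}(W_1^{-1},\Phi)$ (greatest lower bounds in the prefix order), $U_0=U\Phi_{T'}$, $V_0=gU\Phi_{L'}$, and let $W=U_0^{-1}V_0$ (reduced). Proposition. 1. For every $n\ge1$ there are a reduced diagram $U$ with top label $xxx$ and a thin diagram $\Phi$ with $2n$ cells such that, for the $2n$-dimensional cube $Q=C(U,\Phi)$, the associated diagram $W$ is thin with $2n+4$ cells, and $K_{U_0,V_0}$ is the full cube $C(U_0,W)$; with the metric $d$ of $K(P,w)$ it is isometric to the Euclidean cube $[0,1]^{2n+4}$. Let $y\in Q$ be the point whose coordinates in the directions of $E_j$ and of $E_{n+j}$ are both equal to $\frac{j}{n+1}$ for $j=1,\dots,n$ (coordinate $0$: cell not attached to $U$; coordinate $1$: cell attached). Then $$d(y,gy)=\sqrt{2+\frac{2}{n+1}}.$$ 2. Hence $d(y,gy)$ can be arbitrarily close to $\sqrt2$: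 for every $\varepsilon>0$ there is a point $y\in K(P,w)$ with $|d(y,gy)-\sqrt2|<\varepsilon$. In particular $\inf_{y\in K(P,w)}d(y,gy)\le\sqrt2$. -/

import Mathlib

open scoped ENNReal

namespace DiagramGroup

/-! ### Semigroup presentations, derivations, diagrams -/

/-- A finite presentation `⟨A | R⟩` of a semigroup.  Words are lists of letters; the relators are
pairs of distinct nonempty words, and `R` is closed under swapping the two sides. -/
structure Presentation (A : Type) where
  rel : Set (List A × List A)
  letters_finite : Finite A
  rel_finite : rel.Finite
  ne : ∀ u v, (u, v) ∈ rel → u ≠ v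
  nonempty : ∀ u v, (u, v) ∈ rel → u ≠ []
  symm : ∀ u v, (u, v) ∈ rel → (v, u) ∈ rel

variable {A : Type} {P : Presentation A}

/-- A cell `C(src, tgt)` attached from below to the word `left ++ src ++ right` along `src`
(that is, an atomic diagram). -/
@[ext] structure Atomic (P : Presentation A) where
  left : List A
  src : List A
  tgt : List A
  right : List A
  mem : (src, tgt) ∈ P.rel

/-- The label of the top path. -/
def Atomic.top (a : Atomic P) : List A := a.left ++ a.src ++ a.right

/-- The label of the bottom path. -/
def Atomic.bot (a : Atomic P) : List A := a.left ++ a.tgt ++ a.right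

/-- Reflection in a horizontal line. -/
def Atomic.inv (a : Atomic P) : Atomic P :=
  ⟨a.left, a.tgt, a.src, a.right, P.symm _ _ a.mem⟩

/-- `l` is a sequence of attachments of cells leading from the word `u` to the word `v`. -/
def IsDerivation : List (Atomic P) → List A → List A → Prop
  | [], u, v => u = v
  | a :: l, u, v => a.top = u ∧ IsDerivation l a.bot v

theorem IsDerivation.append {l₁ l₂ : List (Atomic P)} {u v z : List A}
    (h₁ : IsDerivation l₁ u v) (h₂ : IsDerivation l₂ v z) : IsDerivation (l₁ ++ l₂) u z := by
  induction l₁ generalizing u with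
  | nil => cases h₁; exact h₂
  | cons a l ih => exact ⟨h₁.1, ih h₁.2⟩

theorem IsDerivation.inv {l : List (Atomic P)} {u v : List A} (h : IsDerivation l u v) :
    IsDerivation (l.map Atomic.inv).reverse v u := by
  induction l generalizing u with
  | nil => exact Eq.symm h
  | cons a l ih =>
    rw [List.map_cons, List.reverse_cons]
    exact (ih h.2).append ⟨rfl, h.1⟩

/-- Sequences of attachments of cells from the word `u` to the word `v`. -/
structure Derivation (P : Presentation A) (u v : List A) where
  steps : List (Atomic P)
  valid : IsDerivation steps u v

def Derivation.comp {u v z : List A} (d : Derivation P u v) (e : Derivation P v z) :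
    Derivation P u z := ⟨d.steps ++ e.steps, d.valid.append e.valid⟩

def Derivation.inv {u v : List A} (d : Derivation P u v) : Derivation P v u :=
  ⟨(d.steps.map Atomic.inv).reverse, d.valid.inv⟩

/-- Two consecutive attachments along disjoint arcs (the arcs labelled `u` and `u'` in the word
`p ++ u ++ q ++ u' ++ r`) may be performed in either order. -/
inductive Exchange : List (Atomic P) → List (Atomic P) → Prop
  | swap (l₁ l₂ : List (Atomic P)) (p u v q u' v' r : List A)
      (h : (u, v) ∈ P.rel) (h' : (u', v') ∈ P.rel) :
      Exchange
        (l₁ ++ ⟨p, u, v, q ++ u' ++ r, h⟩ :: ⟨p ++ v ++ q, u', v', r, h'⟩ :: l₂)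
        (l₁ ++ ⟨p ++ u ++ q, u', v', r, h'⟩ :: ⟨p, u, v, q ++ v' ++ r, h⟩ :: l₂)

/-- Cancellation of a pair of cells `C(u, v)`, `C(v, u)`, where the bottom path of the first is the
top path of the second. -/
inductive Cancel : List (Atomic P) → List (Atomic P) → Prop
  | dipole (l₁ l₂ : List (Atomic P)) (a : Atomic P) : Cancel (l₁ ++ a :: a.inv :: l₂) (l₁ ++ l₂)

theorem Exchange.append_left {l l' : List (Atomic P)} (m : List (Atomic P)) (h : Exchange l l') :
    Exchange (m ++ l) (m ++ l') := by
  cases h with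
  | swap l₁ l₂ p u v q u' v' r h h' =>
    simpa only [List.append_assoc] using Exchange.swap (m ++ l₁) l₂ p u v q u' v' r h h'

theorem Exchange.append_right {l l' : List (Atomic P)} (m : List (Atomic P)) (h : Exchange l l') :
    Exchange (l ++ m) (l' ++ m) := by
  cases h with
  | swap l₁ l₂ p u v q u' v' r h h' =>
    simpa only [List.append_assoc, List.cons_append] using
      Exchange.swap l₁ (l₂ ++ m) p u v q u' v' r h h'

theorem Exchange.inv {l l' : List (Atomic P)} (h : Exchange l l') :
    Exchange (l'.map Atomic.inv).reverse (l.map Atomic.inv).reverse := by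
  cases h with
  | swap l₁ l₂ p u v q u' v' r h h' =>
    have := Exchange.swap (l₂.map Atomic.inv).reverse (l₁.map Atomic.inv).reverse p v u q v' u' r
      (P.symm _ _ h) (P.symm _ _ h')
    simpa [Atomic.inv] using this

theorem Cancel.append_left {l l' : List (Atomic P)} (m : List (Atomic P)) (h : Cancel l l') :
    Cancel (m ++ l) (m ++ l') := by
  cases h with
  | dipole l₁ l₂ a => simpa only [List.append_assoc] using Cancel.dipole (m ++ l₁) l₂ a

theorem Cancel.append_right {l l' : List (Atomic P)} (m : List (Atomic P)) (h : Cancel l l') :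
    Cancel (l ++ m) (l' ++ m) := by
  cases h with
  | dipole l₁ l₂ a =>
    simpa only [List.append_assoc, List.cons_append] using Cancel.dipole l₁ (l₂ ++ m) a

/-- Diagrams with top label `u` and bottom label `v`, up to isotopy: sequences of attachments of
cells, modulo the order of independent attachments. -/
def Diagram (P : Presentation A) (u v : List A) : Type :=
  Quot fun d e : Derivation P u v => Exchange d.steps e.steps

/-- Diagrams from `u` to `v` modulo cancellation of cells.  Each class contains exactly one reduced
diagram, so that a class stands for that reduced diagram, and composition of classes for
composition of diagrams followed by reduction. -/
def DiagClass (P : Presentation A) (u v : List A) : Type :=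
  Quot fun d e : Derivation P u v => Exchange d.steps e.steps ∨ Cancel d.steps e.steps

namespace Diagram

/-- Concatenation `U ∘ V`, without reduction. -/
def comp {u v z : List A} : Diagram P u v → Diagram P v z → Diagram P u z :=
  Quot.map₂ Derivation.comp (fun a _ _ h => h.append_left a.steps)
    (fun _ _ b h => h.append_right b.steps)

/-- The inverse (reflected) diagram. -/
def inv {u v : List A} : Diagram P u v → Diagram P v u :=
  Quot.lift (fun d => Quot.mk _ d.inv) fun d e h =>
    (Quot.sound (r := fun d e : Derivation P v u => Exchange d.steps e.steps)
      (a := e.inv) (b := d.inv) h.inv).symm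

/-- The class of a diagram modulo cancellations. -/
def toClass {u v : List A} : Diagram P u v → DiagClass P u v :=
  Quot.lift (fun d => Quot.mk _ d) fun _ _ h => Quot.sound (Or.inl h)

/-- No cancellation is possible. -/
def Reduced {u v : List A} (D : Diagram P u v) : Prop :=
  ∀ d : Derivation P u v, Quot.mk _ d = D →
    ¬ ∃ (l₁ l₂ : List (Atomic P)) (a : Atomic P), d.steps = l₁ ++ a :: a.inv :: l₂

/-- `H < W`: the diagram `H` is a prefix of `W` (possibly `H = W`). -/
def IsPrefix {u v z : List A} (H : Diagram P u v) (W : Diagram P u z) : Prop :=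
  ∃ F : Diagram P v z, H.comp F = W

/-- `D` is the greatest lower bound of `X` and `Y` in the prefix order. -/
def IsGlb {u d x y : List A} (D : Diagram P u d) (X : Diagram P u x) (Y : Diagram P u y) : Prop :=
  D.IsPrefix X ∧ D.IsPrefix Y ∧
    ∀ (z : List A) (H : Diagram P u z), H.IsPrefix X → H.IsPrefix Y → H.IsPrefix D

end Diagram

/-- The product `UV`. -/
def DiagClass.comp {u v z : List A} : DiagClass P u v → DiagClass P v z → DiagClass P u z :=
  Quot.map₂ Derivation.comp
    (fun a _ _ h => h.imp (fun h => h.append_left a.steps) fun h => h.append_left a.steps)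
    (fun _ _ b h => h.imp (fun h => h.append_right b.steps) fun h => h.append_right b.steps)

theorem DiagClass.comp_assoc {u v z y : List A} (a : DiagClass P u v) (b : DiagClass P v z)
    (c : DiagClass P z y) : (a.comp b).comp c = a.comp (b.comp c) := by
  induction a using Quot.ind
  induction b using Quot.ind
  induction c using Quot.ind
  exact congrArg (Quot.mk _) (by simp [Derivation.comp])

/-! ### Thin diagrams -/

/-- Thin diagrams with `k` cells: all cells are attached to the top path.  Such a diagram is read
from left to right as a sequence of edges of the top path to which nothing is attached, and of cells
`C(u, v)` attached to the top path along an arc labelled `u`. -/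
inductive Thin (P : Presentation A) : ℕ → Type
  | nil : Thin P 0
  | edge {k : ℕ} (a : A) (Φ : Thin P k) : Thin P k
  | cell {k : ℕ} (u v : List A) (h : (u, v) ∈ P.rel) (Φ : Thin P k) : Thin P (k + 1)

namespace Thin

/-- The bottom label of the subdiagram `Φ_J` of `Φ` that consists of the top path and the cells
`E i` with `J i = true`, where `E 0, …, E (k - 1)` are the cells of `Φ` from left to right. -/
def word : {k : ℕ} → Thin P k → (Fin k → Bool) → List A
  | _, nil, _ => []
  | _, edge a Φ, J => a :: Φ.word J
  | _, cell u v _ Φ, J => (if J 0 then v else u) ++ Φ.word fun i => J i.succ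

/-- The top label. -/
def top {k : ℕ} (Φ : Thin P k) : List A := Φ.word fun _ => false

/-- Attach the cells chosen by `J` one after the other, from left to right; `p` is the label of the
part of the bottom path to the left of `Φ`. -/
def steps : {k : ℕ} → (p : List A) → Thin P k → (Fin k → Bool) → List (Atomic P)
  | _, _, nil, _ => []
  | _, p, edge a Φ, J => Φ.steps (p ++ [a]) J
  | _, p, cell u v h Φ, J =>
    (if J 0 then [⟨p, u, v, Φ.top, h⟩] else []) ++
      Φ.steps (p ++ if J 0 then v else u) fun i => J i.succ

theorem steps_valid {k : ℕ} (Φ : Thin P k) (p : List A) (J : Fin k → Bool) :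
    IsDerivation (Φ.steps p J) (p ++ Φ.top) (p ++ Φ.word J) := by
  induction Φ generalizing p with
  | nil => rfl
  | edge a Φ ih => simpa [steps, top, word] using ih (p ++ [a]) J
  | cell u v h Φ ih =>
    cases hJ : J 0
    · simpa [steps, top, word, hJ] using ih (p ++ u) fun i => J i.succ
    · refine IsDerivation.append (v := p ++ v ++ Φ.top) ?_ ?_
      · rw [if_pos hJ]
        exact ⟨by simp [Atomic.top, top, word], rfl⟩
      · simpa [word, hJ] using ih (p ++ v) fun i => J i.succ

/-- The diagram `Φ_J`; these are the prefixes of `Φ`. -/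
def part {k : ℕ} (Φ : Thin P k) (J : Fin k → Bool) : Diagram P Φ.top (Φ.word J) :=
  Quot.mk _ ⟨Φ.steps [] J, Φ.steps_valid [] J⟩

/-- The thin diagram itself, all cells being attached. -/
def full {k : ℕ} (Φ : Thin P k) : Diagram P Φ.top (Φ.word fun _ => true) := Φ.part fun _ => true

end Thin

/-! ### The cube complex `K(P, w)` and its length metric -/

/-- The vertices of `K(P, w)`: reduced diagrams with top label `w` and an arbitrary bottom label. -/
def Vertex (P : Presentation A) (w : List A) : Type := Σ v : List A, DiagClass P w v

/-- The vertex `U Φ_J` of the cube `C(U, Φ)`. -/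
def cubeVertex {w : List A} {k : ℕ} (Φ : Thin P k) (U : DiagClass P w Φ.top) (J : Fin k → Bool) :
    Vertex P w := ⟨Φ.word J, U.comp (Φ.part J).toClass⟩

/-- The point with coordinates `t` of the cube `C(U, Φ)`, where `t i` is the coordinate in the
direction of the cell `E i` (`0`: not attached, `1`: attached).  It is recorded by its weights on
the vertices of the cube: the vertex `U Φ_J` has the weight `∏_{i ∈ J} t i * ∏_{i ∉ J} (1 - t i)`.
The vertices of positive weight are those of the smallest face containing the point, and the weights
determine the position in that face, so this is the gluing of cubes along common faces. -/
noncomputable def cubeWeight {w : List A} {k : ℕ} (Φ : Thin P k) (U : DiagClass P w Φ.top)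
    (t : Fin k → Set.Icc (0 : ℝ) 1) : Vertex P w →₀ ℝ :=
  ∑ J : Fin k → Bool,
    Finsupp.single (cubeVertex Φ U J) (∏ i, if J i then (t i : ℝ) else 1 - (t i : ℝ))

/-- The geometric realization `K(P, w)`. -/
def Realization (P : Presentation A) (w : List A) : Type :=
  {p : Vertex P w →₀ ℝ // ∃ (k : ℕ) (Φ : Thin P k) (U : DiagClass P w Φ.top)
    (t : Fin k → Set.Icc (0 : ℝ) 1), p = cubeWeight Φ U t}

/-- The characteristic map of the cube `C(U, Φ)`. -/
noncomputable def cubePoint {w : List A} {k : ℕ} (Φ : Thin P k) (U : DiagClass P w Φ.top)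
    (t : Fin k → Set.Icc (0 : ℝ) 1) : Realization P w := ⟨cubeWeight Φ U t, k, Φ, U, t, rfl⟩

/-- The Euclidean distance in the cube `[0,1]^k`. -/
noncomputable def cubeDist {k : ℕ} (s t : Fin k → Set.Icc (0 : ℝ) 1) : ℝ :=
  Real.sqrt (∑ i, ((s i : ℝ) - (t i : ℝ)) ^ 2)

/-- `StringLength p q ℓ`: there is a finite sequence of points from `p` to `q` in which any two
consecutive points lie in a common cube, with `ℓ` the sum of the distances of consecutive points
measured in these cubes. -/
inductive StringLength {w : List A} : Realization P w → Realization P w → ℝ → Prop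
  | nil (p : Realization P w) : StringLength p p 0
  | cons {k : ℕ} (Φ : Thin P k) (U : DiagClass P w Φ.top) (s t : Fin k → Set.Icc (0 : ℝ) 1)
      (q : Realization P w) (ℓ : ℝ) (h : StringLength (cubePoint Φ U t) q ℓ) :
      StringLength (cubePoint Φ U s) q (cubeDist s t + ℓ)

/-- The intrinsic length metric of `K(P, w)` (with value `∞` if there is no path). -/
noncomputable def pathDist {w : List A} (p q : Realization P w) : ℝ≥0∞ :=
  ⨅ (ℓ : ℝ) (_ : StringLength p q ℓ), ENNReal.ofReal ℓ

/-- The points of the full subcomplex of `K(P, w)` spanned by a set of vertices. -/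
def fullSubcomplex {w : List A} (S : Set (Vertex P w)) : Set (Realization P w) :=
  {p | ∀ X, p.1 X ≠ 0 → X ∈ S}

/-- The subcomplex `K_{U,V}`, the full subcomplex spanned by the vertices `UH` with `H < W`, where
`W` is the reduced diagram with `V = UW`. -/
def prefixComplex {w u v : List A} (U : DiagClass P w u) (W : Diagram P u v) :
    Set (Realization P w) :=
  fullSubcomplex
    {X | ∃ (z : List A) (H : Diagram P u z), H.IsPrefix W ∧ X = ⟨z, U.comp H.toClass⟩}

/-- Left multiplication of vertices by an element of the diagram group `D(P, w)`. -/
def actVertex {w : List A} (g : DiagClass P w w) (X : Vertex P w) : Vertex P w :=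
  ⟨X.1, g.comp X.2⟩

theorem mapDomain_cubeWeight {w : List A} {k : ℕ} (g : DiagClass P w w) (Φ : Thin P k)
    (U : DiagClass P w Φ.top) (t : Fin k → Set.Icc (0 : ℝ) 1) :
    Finsupp.mapDomain (actVertex g) (cubeWeight Φ U t) = cubeWeight Φ (g.comp U) t := by
  rw [cubeWeight, Finsupp.mapDomain_finsetSum]
  refine Finset.sum_congr rfl fun J _ => ?_
  rw [Finsupp.mapDomain_single]
  have h : actVertex g (cubeVertex Φ U J) = cubeVertex Φ (g.comp U) J :=
    congrArg (Sigma.mk (Φ.word J)) (DiagClass.comp_assoc g U (Φ.part J).toClass).symm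
  rw [h]

/-- The action of the diagram group on `K(P, w)`: left multiplication of vertices, extended to
an affine map on each cube. -/
noncomputable def act {w : List A} (g : DiagClass P w w) (p : Realization P w) :
    Realization P w :=
  ⟨Finsupp.mapDomain (actVertex g) p.1, by
    obtain ⟨_, k, Φ, U, t, rfl⟩ := p
    exact ⟨k, Φ, g.comp U, t, mapDomain_cubeWeight g Φ U t⟩⟩

/-! ### Thompson's group -/

/-- The word `x ⋯ x` with `m` letters. -/
def xs (m : ℕ) : List Unit := List.replicate m ()

/-- The presentation `⟨x | x = xx⟩`. -/
def thompson : Presentation Unit where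
  rel := {(xs 1, xs 2), (xs 2, xs 1)}
  letters_finite := inferInstance
  rel_finite := (Set.finite_singleton _).insert _
  ne := by
    intro u v h
    rcases h with h | h <;> cases h <;> decide
  nonempty := by
    intro u v h
    rcases h with h | h <;> cases h <;> decide
  symm := by
    intro u v h
    rcases h with h | h <;> cases h
    · exact Or.inr rfl
    · exact Or.inl rfl

/-- The upper cell `C(x, xx)` attached along the edge number `i + 1` of a path of `i + 1 + j`
edges. -/
def upper (i j : ℕ) : Atomic thompson := ⟨xs i, xs 1, xs 2, xs j, Or.inl rfl⟩

/-- The lower cell `C(xx, x)` attached along the edges number `i + 1`, `i + 2` of a path of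
`i + 2 + j` edges. -/
def lower (i j : ℕ) : Atomic thompson := ⟨xs i, xs 2, xs 1, xs j, Or.inr rfl⟩

/-- A diagram for the element `g` of `D(⟨x | x = xx⟩, xxx)`: the first edge of `xxx` is split, then the
second edge of `xxxx` is split; then the third and fourth edges of `xxxxx` are merged, and finally
the third and fourth edges of `xxxx` are merged. -/
def gDerivation : Derivation thompson (xs 3) (xs 3) :=
  ⟨[upper 0 2, upper 1 2, lower 2 1, lower 2 0], by
    refine ⟨?_, ?_, ?_, ?_, ?_⟩ <;> rfl⟩

/-- The element `g` of the diagram group. -/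
def gElt : DiagClass thompson (xs 3) (xs 3) := Quot.mk _ gDerivation

end DiagramGroup

open DiagramGroup

namespace DiagramGroup

/-! Write `N = n - 1`. The proof has a geometric half, which bounds the length metric from below,
and a computational half, which places `y` and `g y` in one cube.

Lower bound. A diagram over `⟨x | x = xx⟩` acts on `ℕ × ℕ`: the points `(i, ·)` belong to the edge
`i`, and splitting an edge separates its even and odd points. This is invariant under exchange and
cancellation. The nodes of the binary forest growing below a diagram are then subsets of `ℕ × ℕ`,
given with an enumeration, and attaching a cell adds or removes exactly one node
(`mem_nodeSet_cellPerm`). Each node is thus a wall: a vertex lies on one side or the other according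
to whether it has the node. In a cube `C(U, Φ)` the cells of `Φ` have distinct nodes, so each wall
is crossed by at most one direction of the cube, and distinct walls by distinct directions
(`isWallFamily_cubeWalls`). Extending the indicators of `d` walls affinely gives a map from the
complex to `ℝ^d` that does not increase length (`norm_wallCoord_sub_le`). Taking for walls the nodes
of the cells of `W`, this map restricts to the coordinates on `C(U₀, W)`, so that cube is
isometrically embedded (`pathDist_cubePoint`). Since the prefixes of a thin diagram are its parts
(`exists_part_of_prefix`), and a point supported on vertices of the cube lies in the cube
(`exists_cubePoint_eq`), the cube is all of `K_{U₀,V₀}`.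

The example. `U` is a left comb, a plain edge and a right tree (`tree`). Both trees are
self-similar: splitting the first leaf of the comb makes a longer comb, and merging the last two
pairs of leaves of the right tree makes a shorter one. Hence `U⁻¹ g U` is the thin diagram `exTheta`
with four cells, and `g` acts as a shift: in each half, the cell number `j + 1` of `Φ` at `g U`
crosses the same wall as the cell number `j` at `U`. All vertices of `Q` and `g Q` are vertices of
`C(U₀, W)` (`exPhi_comp_exW`, `exTheta_comp_exPhi`). Up to flips `x ↦ 1 - x`, each half compares the
coordinates `0, 1/(n+1), …, n/(n+1)` of `y` with `1/(n+1), …, n/(n+1), 1` of `g y`. Two further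
directions contribute `1` each, so the squared distance is `2 + (2n+2)/(n+1)²`.

Diagrams are computed as products of columns in a monoid `Mor P c` with a partial vertical
composition. The parameter `c` decides whether cells may cancel: `c = True` yields statements about
vertices, `c = False` statements about diagrams, prefixes and greatest lower bounds. -/

/-! ### The permutation of `ℕ × ℕ` defined by a diagram over `⟨x | x = xx⟩` -/

/-- Splitting the edge `i`: the edges `i`, `i + 1` below are sent to the even and the odd points of
the edge `i` above. -/
def splitPerm (i : ℕ) : Equiv.Perm (ℕ × ℕ) where
  toFun p := if p.1 < i then p else if p.1 = i then (i, 2 * p.2)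
    else if p.1 = i + 1 then (i, 2 * p.2 + 1) else (p.1 - 1, p.2)
  invFun p := if p.1 < i then p else if p.1 = i then (i + p.2 % 2, p.2 / 2) else (p.1 + 1, p.2)
  left_inv := by
    rintro ⟨a, b⟩
    grind
  right_inv := by
    rintro ⟨a, b⟩
    grind

theorem splitPerm_apply (i a b : ℕ) : splitPerm i (a, b) =
    if a < i then (a, b) else if a = i then (i, 2 * b)
      else if a = i + 1 then (i, 2 * b + 1) else (a - 1, b) := rfl

theorem splitPerm_inv_apply (i a b : ℕ) : (splitPerm i)⁻¹ (a, b) =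
    if a < i then (a, b) else if a = i then (i + b % 2, b / 2) else (a + 1, b) := rfl

/-- A cell sends the points below it to the points above it. -/
def cellPerm (u : List Unit) (i : ℕ) : Equiv.Perm (ℕ × ℕ) :=
  if u.length = 1 then splitPerm i else (splitPerm i)⁻¹

theorem thompson_rel {u v : List Unit} (h : (u, v) ∈ thompson.rel) :
    u = xs 1 ∧ v = xs 2 ∨ u = xs 2 ∧ v = xs 1 := by
  rcases h with h | h <;> cases h <;> simp

theorem thompson_length {u v : List Unit} (h : (u, v) ∈ thompson.rel) :
    u.length = 1 ∧ v.length = 2 ∨ u.length = 2 ∧ v.length = 1 := by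
  rcases thompson_rel h with ⟨rfl, rfl⟩ | ⟨rfl, rfl⟩ <;> simp [xs]

/-- Left factors lie above right factors. Once the edge `i` is split, the edge formerly numbered `j
+ 1` has the number `j + 2`. -/
theorem splitPerm_comm (i j : ℕ) (h : i ≤ j) :
    splitPerm i * splitPerm (j + 2) = splitPerm (j + 1) * splitPerm i := by
  ext1 ⟨a, b⟩
  simp only [Equiv.Perm.mul_apply]
  rcases lt_trichotomy a i with h1 | rfl | h1
  · simp [splitPerm_apply, h1, show a < j + 2 by omega, show a < j + 1 by omega]
  · simp [splitPerm_apply, show a < j + 2 by omega, show a < j + 1 by omega]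
  obtain ⟨c, rfl⟩ : ∃ c, a = c + 1 := ⟨a - 1, by omega⟩
  by_cases h2 : c = i
  · subst h2
    simp [splitPerm_apply, show c < j + 1 by omega]
  · have h3 : ¬ c + 1 < i := by omega
    have h4 : c + 1 ≠ i := by omega
    rcases lt_or_ge c (j + 1) with h6 | h6
    · simp [splitPerm_apply, h2, h3, h4, h6]
    have h7 : ∀ m n : ℕ, i + 1 < m → splitPerm i (m, n) = (m - 1, n) := fun m n hm => by
      rw [splitPerm_apply, if_neg (by omega), if_neg (by omega), if_neg (by omega)]
    rw [h7 (c + 1) b (by omega)]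
    rcases h6.eq_or_lt with rfl | h6
    · simp [splitPerm_apply (j + 2), splitPerm_apply (j + 1), h7, h]
    rcases (Nat.succ_le_of_lt h6).eq_or_lt with rfl | h6
    · simp [splitPerm_apply (j + 2), splitPerm_apply (j + 1), h7, h]
    · rw [splitPerm_apply (j + 2), if_neg (by omega), if_neg (by omega), if_neg (by omega),
        h7 _ _ (by omega), Nat.add_sub_cancel, splitPerm_apply (j + 1), if_neg (by omega),
        if_neg (by omega), if_neg (by omega)]

/-- Merges are inverse to splits, so the four combinations of cells all follow from `splitPerm_comm`
by moving factors across the equation. -/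
theorem cellPerm_comm {u v u' v' : List Unit} (h : (u, v) ∈ thompson.rel)
    (h' : (u', v') ∈ thompson.rel) (i j : ℕ) :
    cellPerm u i * cellPerm u' (i + v.length + j) = cellPerm u' (i + u.length + j) * cellPerm u i := by
  have := splitPerm_comm i (i + j) (by omega)
  rcases thompson_length h with ⟨h1, h2⟩ | ⟨h1, h2⟩ <;>
    rcases thompson_length h' with ⟨h3, h4⟩ | ⟨h3, h4⟩ <;>
    simp only [cellPerm, h1, h2, h3, OfNat.ofNat_ne_one, if_true, if_false, Nat.add_right_comm i _ j]
  · exact this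
  · rw [eq_inv_mul_iff_mul_eq, ← mul_assoc, mul_inv_eq_iff_eq_mul, this]
  · rw [inv_mul_eq_iff_eq_mul, ← mul_assoc, this, mul_assoc, mul_inv_cancel, mul_one]
  · rw [← mul_inv_rev, ← mul_inv_rev, this]

/-- The permutation defined by a cell attached to a word. -/
def Atomic.perm (a : Atomic thompson) : Equiv.Perm (ℕ × ℕ) := cellPerm a.src a.left.length

theorem Atomic.perm_mul_perm_inv (a : Atomic thompson) : a.perm * a.inv.perm = 1 := by
  rcases thompson_length a.mem with ⟨h1, h2⟩ | ⟨h1, h2⟩ <;>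
    simp [Atomic.perm, Atomic.inv, cellPerm, h1, h2]

/-- The permutation defined by a sequence of attachments of cells. -/
def stepsPerm (l : List (Atomic thompson)) : Equiv.Perm (ℕ × ℕ) := (l.map Atomic.perm).prod

theorem stepsPerm_append (l m : List (Atomic thompson)) :
    stepsPerm (l ++ m) = stepsPerm l * stepsPerm m := by simp [stepsPerm]

theorem stepsPerm_cons (a : Atomic thompson) (m : List (Atomic thompson)) :
    stepsPerm (a :: m) = a.perm * stepsPerm m := by simp [stepsPerm]

theorem Exchange.stepsPerm_eq {l m : List (Atomic thompson)} (h : Exchange l m) :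
    stepsPerm l = stepsPerm m := by
  cases h with
  | swap l₁ l₂ p u v q u' v' r h h' =>
    rw [stepsPerm_append, stepsPerm_append]
    simp only [stepsPerm_cons, Atomic.perm, List.length_append, ← mul_assoc]
    rw [mul_assoc (stepsPerm l₁), cellPerm_comm h h', mul_assoc]
    simp only [mul_assoc]

theorem Cancel.stepsPerm_eq {l m : List (Atomic thompson)} (h : Cancel l m) :
    stepsPerm l = stepsPerm m := by
  cases h with
  | dipole l₁ l₂ a =>
    rw [stepsPerm_append, stepsPerm_append, stepsPerm_cons, stepsPerm_cons,
      ← mul_assoc a.perm, a.perm_mul_perm_inv, one_mul]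

/-- The permutation defined by a class of diagrams. -/
def DiagClass.perm {u v : List Unit} : DiagClass thompson u v → Equiv.Perm (ℕ × ℕ) :=
  Quot.lift (fun d => stepsPerm d.steps) fun _ _ h =>
    h.elim Exchange.stepsPerm_eq Cancel.stepsPerm_eq

theorem DiagClass.perm_comp {u v z : List Unit} (a : DiagClass thompson u v)
    (b : DiagClass thompson v z) : (a.comp b).perm = a.perm * b.perm := by
  induction a using Quot.ind
  induction b using Quot.ind
  exact stepsPerm_append _ _

/-! ### The nodes below a diagram -/

/-- The nodes of the binary trees growing from the edges of the bottom path of a diagram, seen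
through the permutation defined by the diagram. -/
def nodeSet (φ : Equiv.Perm (ℕ × ℕ)) : Set (ℕ → ℕ × ℕ) :=
  {τ | ∃ i k v : ℕ, v < 2 ^ k ∧ ∀ s, τ s = φ (i, 2 ^ k * s + v)}

/-- The node removed or added by a cell attached at position `i`. -/
def cellNode (u : List Unit) (i : ℕ) : ℕ → ℕ × ℕ := fun s =>
  if u.length = 1 then (i, s) else (splitPerm i)⁻¹ (i, s)

theorem mem_nodeSet_mul (φ ψ : Equiv.Perm (ℕ × ℕ)) (τ : ℕ → ℕ × ℕ) :
    τ ∈ nodeSet (φ * ψ) ↔ (fun s => φ⁻¹ (τ s)) ∈ nodeSet ψ := by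
  simp only [nodeSet, Set.mem_ofPred_eq, Equiv.Perm.inv_eq_iff_eq, Equiv.Perm.mul_apply]

/-- The forest below a split edge is the old forest without the root of the tree number `i`: the
nodes under that root are those of the two new trees, with one level fewer. -/
theorem mem_nodeSet_splitPerm (i : ℕ) (τ : ℕ → ℕ × ℕ) :
    τ ∈ nodeSet (splitPerm i) ↔ τ ∈ nodeSet 1 ∧ τ ≠ fun s => (i, s) := by
  constructor
  · rintro ⟨j, k, v, hv, h⟩
    simp only [splitPerm, Equiv.coe_fn_mk] at h
    rcases lt_trichotomy j i with hj | rfl | hj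
    · simp only [hj, if_true] at h
      refine ⟨⟨j, k, v, hv, h⟩, fun h0 => ?_⟩
      have := (h 0).symm.trans (congrFun h0 0)
      simp only [Prod.mk.injEq] at this
      omega
    · simp only [lt_irrefl, if_true, if_false] at h
      refine ⟨⟨j, k + 1, 2 * v, by rw [pow_succ]; omega, fun s => ?_⟩, fun h0 => ?_⟩
      · rw [h, Equiv.Perm.one_apply, pow_succ]
        ring_nf
      · have := (h 1).symm.trans (congrFun h0 1)
        simp only [Prod.mk.injEq] at this
        omega
    · by_cases hj' : j = i + 1
      · subst hj'
        simp only [show ¬ (i + 1 < i) by omega, show ¬ (i + 1 = i) by omega, if_true, if_false] at h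
        refine ⟨⟨i, k + 1, 2 * v + 1, by rw [pow_succ]; omega, fun s => ?_⟩, fun h0 => ?_⟩
        · rw [h, Equiv.Perm.one_apply, pow_succ]
          ring_nf
        · have := (h 0).symm.trans (congrFun h0 0)
          simp only [Prod.mk.injEq] at this
          omega
      · simp only [show ¬ (j < i) by omega, show ¬ (j = i) by omega, hj', if_false] at h
        refine ⟨⟨j - 1, k, v, hv, h⟩, fun h0 => ?_⟩
        have := (h 0).symm.trans (congrFun h0 0)
        simp only [Prod.mk.injEq] at this
        omega
  · rintro ⟨⟨j, k, v, hv, h⟩, h0⟩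
    simp only [Equiv.Perm.one_apply] at h
    rcases lt_trichotomy j i with hj | rfl | hj
    · exact ⟨j, k, v, hv, fun s => by simp [h, splitPerm, hj]⟩
    · cases k with
      | zero =>
        refine absurd ?_ h0
        funext s
        rw [h, pow_zero, one_mul]
        simp only [pow_zero, Nat.lt_one_iff] at hv
        rw [hv, add_zero]
      | succ k =>
        have e : ∀ s, 2 ^ (k + 1) * s + v = 2 * (2 ^ k * s + v / 2) + v % 2 := fun s => by
          rw [pow_succ, mul_comm _ 2, mul_assoc]
          omega
        rcases Nat.mod_two_eq_zero_or_one v with hm | hm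
        · refine ⟨j, k, v / 2, by rw [pow_succ] at hv; omega, fun s => ?_⟩
          simp [h, splitPerm, e, hm]
        · refine ⟨j + 1, k, v / 2, by rw [pow_succ] at hv; omega, fun s => ?_⟩
          simp [h, splitPerm, e, hm]
    · refine ⟨j + 1, k, v, hv, fun s => ?_⟩
      simp [h, splitPerm, show ¬ (j + 1 < i) by omega, show ¬ (j + 1 = i) by omega,
        show j ≠ i by omega]

theorem cellNode_mem_nodeSet_one (i : ℕ) : (fun s => (i, s)) ∈ nodeSet 1 :=
  ⟨i, 0, 0, by simp, fun s => by simp⟩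

/-- One cell changes the node set by exactly one element: a split removes a root and a merge adds
one. This makes a node a wall. -/
theorem mem_nodeSet_cellPerm (φ : Equiv.Perm (ℕ × ℕ)) {u v : List Unit}
    (h : (u, v) ∈ thompson.rel) (i : ℕ) (τ : ℕ → ℕ × ℕ) :
    τ ∈ nodeSet (φ * cellPerm u i) ↔ Xor (τ ∈ nodeSet φ) (τ = fun s => φ (cellNode u i s)) := by
  have h0 : τ ∈ nodeSet φ ↔ (fun s => φ⁻¹ (τ s)) ∈ nodeSet 1 := by
    rw [← mem_nodeSet_mul, mul_one]
  rw [mem_nodeSet_mul, h0]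
  have h1 : (τ = fun s => φ (cellNode u i s)) ↔ (fun s => φ⁻¹ (τ s)) = cellNode u i := by
    simp only [funext_iff, Equiv.Perm.inv_eq_iff_eq]
  rw [h1]
  generalize (fun s => φ⁻¹ (τ s)) = σ
  rcases thompson_length h with ⟨h2, -⟩ | ⟨h2, -⟩
  · have e : cellNode u i = fun s => (i, s) := by funext s; simp [cellNode, h2]
    rw [e, cellPerm, if_pos h2, mem_nodeSet_splitPerm]
    have := cellNode_mem_nodeSet_one i
    unfold Xor
    constructor
    · rintro ⟨a, b⟩; exact Or.inl ⟨a, b⟩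
    · rintro (⟨a, b⟩ | ⟨a, b⟩)
      · exact ⟨a, b⟩
      · exact absurd (a ▸ this) b
  · have e : cellNode u i = fun s => (splitPerm i)⁻¹ (i, s) := by funext s; simp [cellNode, h2]
    rw [e, cellPerm, if_neg (by omega)]
    -- Applying `splitPerm i` to everything turns a merge into a split read backwards, so the
    -- previous description of `nodeSet (splitPerm i)` applies.
    have h3 : σ ∈ nodeSet 1 ↔ (fun s => splitPerm i (σ s)) ∈ nodeSet (splitPerm i) := by
      have := mem_nodeSet_mul (splitPerm i)⁻¹ (splitPerm i) σ
      rwa [inv_mul_cancel, inv_inv] at this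
    have h4 : σ ∈ nodeSet (splitPerm i)⁻¹ ↔ (fun s => splitPerm i (σ s)) ∈ nodeSet 1 := by
      have := mem_nodeSet_mul (splitPerm i)⁻¹ 1 σ
      rwa [mul_one, inv_inv] at this
    have h5 : (σ = fun s => (splitPerm i)⁻¹ (i, s)) ↔
        (fun s => splitPerm i (σ s)) = fun s => (i, s) := by
      simp only [funext_iff, Equiv.Perm.eq_inv_iff_eq]
    rw [h3, h4, h5, mem_nodeSet_splitPerm]
    generalize (fun s => splitPerm i (σ s)) = ρ
    have := cellNode_mem_nodeSet_one i
    unfold Xor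
    constructor
    · intro a
      by_cases hb : ρ = fun s => (i, s)
      · exact Or.inr ⟨hb, fun h => h.2 hb⟩
      · exact Or.inl ⟨⟨a, hb⟩, hb⟩
    · rintro (⟨a, b⟩ | ⟨a, b⟩)
      · exact a.1
      · exact a ▸ this

/-- The nodes belonging to the cells of a thin diagram whose top path starts at position `o`. -/
def Thin.node : {k : ℕ} → Thin thompson k → ℕ → Fin k → ℕ → ℕ × ℕ
  | _, nil, _ => fun i => i.elim0
  | _, edge _ Φ, o => Φ.node (o + 1)
  | _, cell u _ _ Φ, o => Fin.cons (cellNode u o) (Φ.node (o + u.length))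

theorem cellNode_zero_fst (u : List Unit) (o : ℕ) : (cellNode u o 0).1 = o := by
  unfold cellNode
  split_ifs
  · rfl
  · simp [splitPerm_inv_apply]

theorem le_cellNode_fst (u : List Unit) (o s : ℕ) : o ≤ (cellNode u o s).1 := by
  unfold cellNode
  split_ifs
  · rfl
  · simp [splitPerm_inv_apply]

theorem Thin.le_node_fst {k : ℕ} (Φ : Thin thompson k) (o : ℕ) (i : Fin k) (s : ℕ) :
    o ≤ (Φ.node o i s).1 := by
  induction Φ generalizing o with
  | nil => exact i.elim0
  | edge a Φ ih => exact (Nat.le_succ o).trans (ih (o + 1) i)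
  | cell u v h Φ ih =>
    refine Fin.cases ?_ (fun i => ?_) i
    · exact le_cellNode_fst u o s
    · exact (Nat.le_add_right o _).trans (ih (o + u.length) i)

theorem Thin.node_injective {k : ℕ} (Φ : Thin thompson k) (o : ℕ) :
    Function.Injective (Φ.node o) := by
  induction Φ generalizing o with
  | nil => exact fun i => i.elim0
  | edge a Φ ih => exact ih (o + 1)
  | cell u v h Φ ih =>
    refine Fin.cons_injective_iff.2 ⟨?_, ih _⟩
    rintro ⟨i, hi⟩
    have h1 := Φ.le_node_fst (o + u.length) i 0
    rw [hi, cellNode_zero_fst] at h1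
    rcases thompson_length h with h2 | h2 <;> omega

theorem cellPerm_shift {u v : List Unit} (h : (u, v) ∈ thompson.rel) (o j s : ℕ) :
    cellPerm u o (o + v.length + j, s) = (o + u.length + j, s) := by
  rcases thompson_length h with ⟨h1, h2⟩ | ⟨h1, h2⟩ <;> rw [h1, h2, cellPerm]
  · rw [if_pos h1]
    simp only [splitPerm_apply]
    grind
  · rw [if_neg (by omega)]
    simp only [splitPerm_inv_apply]
    grind

theorem cellNode_add (u : List Unit) (o j s : ℕ) :
    cellNode u (o + j) s = ((cellNode u j s).1 + o, (cellNode u j s).2) := by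
  unfold cellNode
  split_ifs
  · simp [add_comm]
  · simp [splitPerm_inv_apply]
    omega

theorem Thin.node_add {k : ℕ} (Φ : Thin thompson k) (o j : ℕ) (i : Fin k) (s : ℕ) :
    Φ.node (o + j) i s = ((Φ.node j i s).1 + o, (Φ.node j i s).2) := by
  induction Φ generalizing j with
  | nil => exact i.elim0
  | edge a Φ ih => exact ih (j + 1) i
  | cell u v h Φ ih =>
    refine Fin.cases ?_ (fun i => ?_) i
    · exact cellNode_add u o j s
    · simpa [Thin.node, add_assoc] using ih (j + u.length) i

/-- The nodes attributed to the cells are read on the top path, so they do not depend on which other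
cells are attached. Being distinct, they are toggled independently. -/
theorem mem_nodeSet_steps {k : ℕ} (Φ : Thin thompson k) (φ : Equiv.Perm (ℕ × ℕ)) (p : List Unit)
    (J : Fin k → Bool) (τ : ℕ → ℕ × ℕ) :
    τ ∈ nodeSet (φ * stepsPerm (Φ.steps p J)) ↔
      Xor (τ ∈ nodeSet φ) (∃ i, J i = true ∧ τ = fun s => φ (Φ.node p.length i s)) := by
  induction Φ generalizing φ p with
  | nil => simp [Thin.steps, stepsPerm, Xor]
  | edge a Φ ih => simpa [Thin.steps, Thin.node] using ih φ (p ++ [a]) J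
  | cell u v h Φ ih =>
    rw [Thin.steps, stepsPerm_append, ← mul_assoc, ih, Fin.exists_fin_succ]
    cases hJ : J 0
    · simp [stepsPerm, Thin.node]
    · simp only [Thin.node, Fin.cons_zero, Fin.cons_succ, if_true, stepsPerm, List.map_cons,
        List.map_nil, List.prod_singleton, Atomic.perm, List.length_append, true_and]
      rw [mem_nodeSet_cellPerm φ h]
      -- Attaching a cell renumbers the edges to its right, and its permutation undoes this. The
      -- later cells therefore keep the nodes they have on the top path.
      have e : ∀ i s, cellPerm u p.length (Φ.node (p.length + v.length) i s) =
          Φ.node (p.length + u.length) i s := fun i s => by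
        have := cellPerm_shift h p.length (Φ.node 0 i s).1 (Φ.node 0 i s).2
        rw [← add_zero (p.length + v.length), ← add_zero (p.length + u.length), Φ.node_add,
          Φ.node_add]
        rw [add_comm, this, add_comm]
      simp only [Equiv.Perm.mul_apply, e]
      -- Two cells never toggle the same node, as their positions differ; hence the two exclusive
      -- alternatives combine into one existential.
      have ne : (τ = fun s => φ (cellNode u p.length s)) →
          ¬ ∃ i, J (Fin.succ i) = true ∧ τ = fun s => φ (Φ.node (p.length + u.length) i s) := by
        rintro h0 ⟨i, -, hi⟩
        have h1 := φ.injective (congrFun (h0.symm.trans hi) 0)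
        have h2 := Φ.le_node_fst (p.length + u.length) i 0
        rw [← h1, cellNode_zero_fst] at h2
        rcases thompson_length h with h3 | h3 <;> omega
      unfold Xor
      generalize (τ = fun s => φ (cellNode u p.length s)) = A at ne ⊢
      generalize (∃ i, J (Fin.succ i) = true ∧ _) = B at ne ⊢
      tauto

/-- The nodes of a vertex. -/
def Vertex.nodes {w : List Unit} (X : Vertex thompson w) : Set (ℕ → ℕ × ℕ) := nodeSet X.2.perm

theorem mem_nodes_cubeVertex {w : List Unit} {k : ℕ} (Φ : Thin thompson k)
    (U : DiagClass thompson w Φ.top) (J : Fin k → Bool) (τ : ℕ → ℕ × ℕ) :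
    τ ∈ (cubeVertex Φ U J).nodes ↔
      Xor (τ ∈ nodeSet U.perm) (∃ i, J i = true ∧ τ = fun s => U.perm (Φ.node 0 i s)) := by
  have : (cubeVertex Φ U J).nodes = nodeSet (U.perm * stepsPerm (Φ.steps [] J)) := by
    rw [Vertex.nodes, cubeVertex, DiagClass.perm_comp]
    rfl
  rw [this]
  exact mem_nodeSet_steps Φ U.perm [] J τ

variable {A : Type} {P : Presentation A}

/-! ### Juxtaposition of diagrams -/

/-- Attach a cell inside a wider word. -/
def Atomic.widen (p q : List A) (a : Atomic P) : Atomic P :=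
  ⟨p ++ a.left, a.src, a.tgt, a.right ++ q, a.mem⟩

theorem Atomic.widen_widen (p q p' q' : List A) (a : Atomic P) :
    (a.widen p q).widen p' q' = a.widen (p' ++ p) (q ++ q') := by
  simp [Atomic.widen]

theorem Atomic.widen_nil (a : Atomic P) : a.widen [] [] = a := by
  simp [Atomic.widen]

theorem Atomic.inv_inv (a : Atomic P) : a.inv.inv = a := rfl

theorem IsDerivation.widen {l : List (Atomic P)} {u v : List A} (p q : List A)
    (h : IsDerivation l u v) :
    IsDerivation (l.map (Atomic.widen p q)) (p ++ u ++ q) (p ++ v ++ q) := by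
  induction l generalizing u with
  | nil => cases h; rfl
  | cons a l ih =>
    obtain ⟨rfl, h⟩ := h
    refine ⟨by simp [Atomic.top, Atomic.widen], ?_⟩
    have := ih h
    simpa [Atomic.bot, Atomic.widen] using this

theorem isDerivation_append_iff {l m : List (Atomic P)} {u v : List A} :
    IsDerivation (l ++ m) u v ↔ ∃ z, IsDerivation l u z ∧ IsDerivation m z v := by
  induction l generalizing u with
  | nil => simp [IsDerivation]
  | cons a l ih => simp [IsDerivation, ih, and_assoc]

theorem IsDerivation.target_unique {l : List (Atomic P)} {u v z : List A}
    (h : IsDerivation l u v) (h' : IsDerivation l u z) : v = z := by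
  induction l generalizing u with
  | nil => exact Eq.trans (Eq.symm h) h'
  | cons a l ih => exact ih h.2 h'.2

theorem Exchange.isDerivation_iff {l m : List (Atomic P)} (h : Exchange l m) (u v : List A) :
    IsDerivation l u v ↔ IsDerivation m u v := by
  cases h with
  | swap l₁ l₂ p u v q u' v' r h h' =>
    simp only [isDerivation_append_iff, IsDerivation, Atomic.top, Atomic.bot, List.append_assoc]

theorem Exchange.widen {l m : List (Atomic P)} (p q : List A) (h : Exchange l m) :
    Exchange (l.map (Atomic.widen p q)) (m.map (Atomic.widen p q)) := by
  cases h with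
  | swap l₁ l₂ p' u v q' u' v' r h h' =>
    simpa [Atomic.widen] using Exchange.swap (l₁.map (Atomic.widen p q))
      (l₂.map (Atomic.widen p q)) (p ++ p') u v q' u' v' (r ++ q) h h'

theorem Cancel.widen {l m : List (Atomic P)} (p q : List A) (h : Cancel l m) :
    Cancel (l.map (Atomic.widen p q)) (m.map (Atomic.widen p q)) := by
  cases h with
  | dipole l₁ l₂ a =>
    simpa [Atomic.widen, Atomic.inv] using Cancel.dipole (l₁.map (Atomic.widen p q))
      (l₂.map (Atomic.widen p q)) (a.widen p q)

theorem Cancel.inv {l m : List (Atomic P)} (h : Cancel l m) :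
    Cancel (l.map Atomic.inv).reverse (m.map Atomic.inv).reverse := by
  cases h with
  | dipole l₁ l₂ a =>
    simpa [Atomic.inv_inv] using Cancel.dipole (l₂.map Atomic.inv).reverse (l₁.map Atomic.inv).reverse a

theorem eqvGen_exchange_append {l l' m m' : List (Atomic P)}
    (h : Relation.EqvGen Exchange l l') (h' : Relation.EqvGen Exchange m m') :
    Relation.EqvGen Exchange (l ++ m) (l' ++ m') := by
  refine Relation.EqvGen.trans _ (l' ++ m) _ ?_ ?_
  · induction h with
    | rel _ _ h => exact .rel _ _ (h.append_right m)
    | refl => exact .refl _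
    | symm _ _ _ ih => exact .symm _ _ ih
    | trans _ _ _ _ _ ih₁ ih₂ => exact .trans _ _ _ ih₁ ih₂
  · induction h' with
    | rel _ _ h => exact .rel _ _ (h.append_left l')
    | refl => exact .refl _
    | symm _ _ _ ih => exact .symm _ _ ih
    | trans _ _ _ _ _ ih₁ ih₂ => exact .trans _ _ _ ih₁ ih₂

theorem exchange_widen_single (b c : Atomic P) :
    Exchange [c.widen [] b.top, b.widen c.bot []] [b.widen c.top [], c.widen [] b.bot] := by
  simpa [Atomic.widen, Atomic.top, Atomic.bot] using
    Exchange.swap [] [] c.left c.src c.tgt (c.right ++ b.left) b.src b.tgt b.right c.mem b.mem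

theorem eqvGen_exchange_slide_single (b : Atomic P) {m : List (Atomic P)} {u' v' : List A}
    (h' : IsDerivation m u' v') :
    Relation.EqvGen Exchange (b.widen u' [] :: m.map (Atomic.widen [] b.bot))
      (m.map (Atomic.widen [] b.top) ++ [b.widen v' []]) := by
  induction m generalizing u' with
  | nil => cases h'; exact .refl _
  | cons c m ih =>
    obtain ⟨rfl, h'⟩ := h'
    have h1 := eqvGen_exchange_append (.symm _ _ (.rel _ _ (exchange_widen_single b c)))
      (.refl (m.map (Atomic.widen [] b.bot)))
    have h2 := eqvGen_exchange_append (.refl [c.widen [] b.top]) (ih h')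
    exact .trans _ _ _ h1 h2

/-- Diagrams attached to disjoint parts of a word may be attached in either order. -/
theorem eqvGen_exchange_slide {l m : List (Atomic P)} {u v u' v' : List A}
    (h : IsDerivation l u v) (h' : IsDerivation m u' v') :
    Relation.EqvGen Exchange (l.map (Atomic.widen u' []) ++ m.map (Atomic.widen [] v))
      (m.map (Atomic.widen [] u) ++ l.map (Atomic.widen v' [])) := by
  induction l generalizing u with
  | nil => cases h; simpa using .refl _
  | cons b l ih =>
    obtain ⟨rfl, h⟩ := h
    have h1 := eqvGen_exchange_append (.refl [b.widen u' []]) (ih h)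
    have h2 := eqvGen_exchange_append (eqvGen_exchange_slide_single b h')
      (.refl (l.map (Atomic.widen v' [])))
    refine .trans _ _ _ h1 ?_
    simpa using h2

/-! ### Diagrams with labels as data: juxtaposition, vertical composition and the interchange law -/

/-- Diagrams with arbitrary top and bottom labels, presented by sequences of attachments. -/
@[ext] structure Arr (P : Presentation A) where
  src : List A
  tgt : List A
  steps : List (Atomic P)
  valid : IsDerivation steps src tgt

namespace Arr

/-- The diagram without cells. -/
def id (u : List A) : Arr P := ⟨u, u, [], rfl⟩

/-- The diagram with one cell. -/
def cell (u v : List A) (h : (u, v) ∈ P.rel) : Arr P :=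
  ⟨u, v, [⟨[], u, v, [], h⟩], by simp [Atomic.top], by simp [Atomic.bot, IsDerivation]⟩

instance : Monoid (Arr P) where
  mul a b := ⟨a.src ++ b.src, a.tgt ++ b.tgt,
    a.steps.map (Atomic.widen [] b.src) ++ b.steps.map (Atomic.widen a.tgt []),
    IsDerivation.append (by simpa using a.valid.widen [] b.src)
      (by simpa using b.valid.widen a.tgt [])⟩
  one := id []
  mul_assoc a b c := by
    apply Arr.ext
    · exact List.append_assoc ..
    · exact List.append_assoc ..
    · change List.map _ (_ ++ _) ++ List.map (Atomic.widen (a.tgt ++ b.tgt) []) c.steps =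
        List.map (Atomic.widen [] (b.src ++ c.src)) a.steps ++ List.map _ (_ ++ _)
      simp [Function.comp_def, Atomic.widen_widen]
  one_mul a := by
    apply Arr.ext
    · rfl
    · rfl
    · change _ ++ List.map (Atomic.widen [] []) a.steps = _
      rw [funext Atomic.widen_nil, List.map_id']
      rfl
  mul_one a := by
    apply Arr.ext
    · exact List.append_nil _
    · exact List.append_nil _
    · change List.map (Atomic.widen [] []) a.steps ++ [] = _
      simp [funext Atomic.widen_nil]

theorem mul_steps (a b : Arr P) : (a * b).steps =
    a.steps.map (Atomic.widen [] b.src) ++ b.steps.map (Atomic.widen a.tgt []) := rfl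

open Classical in
/-- Vertical composition; a junk value if the labels do not match. -/
noncomputable def comp (a b : Arr P) : Arr P :=
  if h : a.tgt = b.src then ⟨a.src, b.tgt, a.steps ++ b.steps, a.valid.append (h ▸ b.valid)⟩ else a

theorem comp_eq {a b : Arr P} (h : a.tgt = b.src) :
    a.comp b = ⟨a.src, b.tgt, a.steps ++ b.steps, a.valid.append (h ▸ b.valid)⟩ := dif_pos h

/-- The reflected diagram. -/
def inv (a : Arr P) : Arr P := ⟨a.tgt, a.src, (a.steps.map Atomic.inv).reverse, a.valid.inv⟩

/-- Isotopy of diagrams, and also cancellation of a pair of cells if `c` holds. -/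
def Rel (c : Prop) (a b : Arr P) : Prop :=
  a.src = b.src ∧ a.tgt = b.tgt ∧ (Exchange a.steps b.steps ∨ c ∧ Cancel a.steps b.steps)

end Arr

/-- Diagrams with arbitrary labels, up to isotopy, and also modulo cancellation if `c` holds. -/
def Mor (P : Presentation A) (c : Prop) : Type := Quot (Arr.Rel (P := P) c)

namespace Mor

variable {c : Prop}

/-- The class of a diagram. -/
def mk (c : Prop) (a : Arr P) : Mor P c := Quot.mk _ a

/-- A chain of exchanges passes through lists that are not known in advance to be derivations.
Exchanges preserve the labels in both directions, so validity is carried along the chain together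
with the equality. -/
theorem mk_eq_of_eqvGen {a b : Arr P} (h₁ : a.src = b.src) (h₂ : a.tgt = b.tgt)
    (h : Relation.EqvGen Exchange a.steps b.steps) : mk c a = mk c b := by
  obtain ⟨u, v, l, hl⟩ := a
  obtain ⟨u', v', l', hl'⟩ := b
  obtain rfl : u = u' := h₁
  obtain rfl : v = v' := h₂
  change Relation.EqvGen Exchange l l' at h
  have key : (IsDerivation l u v ↔ IsDerivation l' u v) ∧
      ∀ hl hl', mk c ⟨u, v, l, hl⟩ = mk c ⟨u, v, l', hl'⟩ := by
    clear hl hl'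
    induction h with
    | rel _ _ h =>
      exact ⟨h.isDerivation_iff u v, fun hl hl' => Quot.sound ⟨rfl, rfl, Or.inl h⟩⟩
    | refl => exact ⟨Iff.rfl, fun _ _ => rfl⟩
    | symm _ _ _ ih => exact ⟨ih.1.symm, fun hl hl' => (ih.2 hl' hl).symm⟩
    | trans _ _ _ _ _ ih₁ ih₂ =>
      exact ⟨ih₁.1.trans ih₂.1, fun hl hl' =>
        (ih₁.2 hl (ih₁.1.1 hl)).trans (ih₂.2 (ih₁.1.1 hl) hl')⟩
  exact key.2 hl hl'

def src : Mor P c → List A := Quot.lift Arr.src fun _ _ h => h.1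

def tgt : Mor P c → List A := Quot.lift Arr.tgt fun _ _ h => h.2.1

theorem rel_mul_left (a : Arr P) {b b' : Arr P} (h : Arr.Rel c b b') :
    Arr.Rel c (a * b) (a * b') := by
  obtain ⟨h₁, h₂, h⟩ := h
  refine ⟨congrArg (a.src ++ ·) h₁, congrArg (a.tgt ++ ·) h₂, ?_⟩
  rw [Arr.mul_steps, Arr.mul_steps, h₁]
  exact h.imp (fun h => (h.widen _ _).append_left _)
    fun h => ⟨h.1, (h.2.widen _ _).append_left _⟩

theorem rel_mul_right {a a' : Arr P} (b : Arr P) (h : Arr.Rel c a a') :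
    Arr.Rel c (a * b) (a' * b) := by
  obtain ⟨h₁, h₂, h⟩ := h
  refine ⟨congrArg (· ++ b.src) h₁, congrArg (· ++ b.tgt) h₂, ?_⟩
  rw [Arr.mul_steps, Arr.mul_steps, h₂]
  exact h.imp (fun h => (h.widen _ _).append_right _)
    fun h => ⟨h.1, (h.2.widen _ _).append_right _⟩

instance : Monoid (Mor P c) where
  mul := Quot.map₂ (· * ·) (fun a _ _ h => rel_mul_left a h) (fun _ _ b h => rel_mul_right b h)
  one := mk c 1
  mul_assoc := by
    rintro ⟨a⟩ ⟨b⟩ ⟨d⟩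
    exact congrArg (mk c) (mul_assoc a b d)
  one_mul := by
    rintro ⟨a⟩
    exact congrArg (mk c) (one_mul a)
  mul_one := by
    rintro ⟨a⟩
    exact congrArg (mk c) (mul_one a)

theorem mk_mul (a b : Arr P) : mk c (a * b) = mk c a * mk c b := rfl

theorem rel_comp_left (a : Arr P) {b b' : Arr P} (h : Arr.Rel c b b') :
    Arr.Rel c (a.comp b) (a.comp b') ∨ a.comp b = a.comp b' := by
  obtain ⟨h₁, h₂, h⟩ := h
  by_cases h₃ : a.tgt = b.src
  · rw [Arr.comp_eq h₃, Arr.comp_eq (h₃.trans h₁)]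
    exact Or.inl ⟨rfl, h₂, h.imp (fun h => h.append_left _) fun h => ⟨h.1, h.2.append_left _⟩⟩
  · rw [Arr.comp, dif_neg h₃, Arr.comp, dif_neg (h₁ ▸ h₃)]
    exact Or.inr rfl

theorem rel_comp_right {a a' : Arr P} (b : Arr P) (h : Arr.Rel c a a') :
    Arr.Rel c (a.comp b) (a'.comp b) := by
  by_cases h₃ : a.tgt = b.src
  · rw [Arr.comp_eq h₃, Arr.comp_eq (h.2.1.symm.trans h₃)]
    exact ⟨h.1, rfl, h.2.2.imp (fun h => h.append_right _) fun h => ⟨h.1, h.2.append_right _⟩⟩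
  · rw [Arr.comp, dif_neg h₃, Arr.comp, dif_neg (h.2.1 ▸ h₃)]
    exact h

/-- Vertical composition; a junk value if the labels do not match. -/
noncomputable def comp : Mor P c → Mor P c → Mor P c :=
  Quot.lift₂ (fun a b => mk c (a.comp b))
    (fun a _ _ h => (rel_comp_left a h).elim (fun h => Quot.sound h) (congrArg _))
    (fun _ _ b h => Quot.sound (rel_comp_right b h))

theorem mk_comp (a b : Arr P) : mk c (a.comp b) = (mk c a).comp (mk c b) := rfl

theorem src_mk (a : Arr P) : (mk c a).src = a.src := rfl

theorem tgt_mk (a : Arr P) : (mk c a).tgt = a.tgt := rfl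

theorem src_mul (a b : Mor P c) : (a * b).src = a.src ++ b.src := by
  induction a using Quot.ind
  induction b using Quot.ind
  rfl

theorem tgt_mul (a b : Mor P c) : (a * b).tgt = a.tgt ++ b.tgt := by
  induction a using Quot.ind
  induction b using Quot.ind
  rfl

theorem src_comp (a b : Mor P c) : (a.comp b).src = a.src := by
  induction a using Quot.ind
  induction b using Quot.ind
  change (Arr.comp _ _).src = _
  unfold Arr.comp
  split_ifs <;> rfl

theorem tgt_comp {a b : Mor P c} (h : a.tgt = b.src) : (a.comp b).tgt = b.tgt := by
  induction a using Quot.ind with | _ a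
  induction b using Quot.ind with | _ b
  change a.tgt = b.src at h
  change (a.comp b).tgt = b.tgt
  rw [Arr.comp_eq h]

theorem comp_assoc {a b d : Mor P c} (h : a.tgt = b.src) (h' : b.tgt = d.src) :
    (a.comp b).comp d = a.comp (b.comp d) := by
  induction a using Quot.ind with | _ a
  induction b using Quot.ind with | _ b
  induction d using Quot.ind with | _ d
  refine congrArg (mk c) (?_ : (a.comp b).comp d = a.comp (b.comp d))
  change a.tgt = b.src at h
  change b.tgt = d.src at h'
  rw [Arr.comp_eq h, Arr.comp_eq h', Arr.comp_eq (by exact h'), Arr.comp_eq (by exact h)]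
  simp

/-- The interchange law. -/
theorem mul_comp_mul {a b a' b' : Mor P c} (h : a.tgt = a'.src) (h' : b.tgt = b'.src) :
    (a * b).comp (a' * b') = a.comp a' * b.comp b' := by
  induction a using Quot.ind with | _ a
  induction b using Quot.ind with | _ b
  induction a' using Quot.ind with | _ a'
  induction b' using Quot.ind with | _ b'
  change a.tgt = a'.src at h
  change b.tgt = b'.src at h'
  change mk c ((a * b).comp (a' * b')) = mk c (a.comp a' * b.comp b')
  have h₃ : (a * b).tgt = (a' * b').src := congrArg₂ (· ++ ·) h h'
  rw [Arr.comp_eq h, Arr.comp_eq h', Arr.comp_eq h₃]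
  refine mk_eq_of_eqvGen rfl rfl ?_
  simp only [Arr.mul_steps, List.map_append, List.append_assoc]
  refine eqvGen_exchange_append (.refl _) ?_
  simp only [← List.append_assoc]
  refine eqvGen_exchange_append ?_ (.refl _)
  -- Only the two middle factors are in the wrong order. They act on disjoint parts of the word and
  -- slide past each other.
  rw [h, ← h']
  exact eqvGen_exchange_slide b.valid a'.valid

theorem id_comp {a : Mor P c} {u : List A} (h : a.src = u) : (mk c (Arr.id u)).comp a = a := by
  induction a using Quot.ind with | _ a
  change a.src = u at h
  subst h
  refine congrArg (mk c) (?_ : (Arr.id a.src).comp a = a)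
  rw [Arr.comp_eq (by rfl)]
  rfl

theorem comp_id {a : Mor P c} {u : List A} (h : a.tgt = u) : a.comp (mk c (Arr.id u)) = a := by
  induction a using Quot.ind with | _ a
  change a.tgt = u at h
  subst h
  refine congrArg (mk c) (?_ : a.comp (Arr.id a.tgt) = a)
  rw [Arr.comp_eq (by rfl)]
  exact Arr.ext rfl rfl (List.append_nil _)

theorem id_mul_id (u v : List A) :
    mk (P := P) c (Arr.id u) * mk c (Arr.id v) = mk c (Arr.id (u ++ v)) := rfl

/-- The reflected diagram. -/
def inv : Mor P c → Mor P c :=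
  Quot.lift (fun a => mk c a.inv) fun a b h => by
    obtain ⟨h₁, h₂, h | h⟩ := h
    · exact (Quot.sound (r := Arr.Rel c) (a := b.inv) (b := a.inv)
        ⟨h₂.symm, h₁.symm, Or.inl h.inv⟩).symm
    · exact Quot.sound (r := Arr.Rel c) ⟨h₂, h₁, Or.inr ⟨h.1, h.2.inv⟩⟩

/-- Reflection also reverses the order of attachment, so the right factor comes first; sliding the
two disjoint factors restores the order. -/
theorem inv_mul (a b : Mor P c) : (a * b).inv = a.inv * b.inv := by
  induction a using Quot.ind with | _ a
  induction b using Quot.ind with | _ b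
  change mk c (a * b).inv = mk c (a.inv * b.inv)
  refine mk_eq_of_eqvGen rfl rfl ?_
  have h := eqvGen_exchange_slide b.inv.valid a.inv.valid
  change Relation.EqvGen Exchange (List.reverse _) _
  simp only [Arr.mul_steps, List.map_append, List.reverse_append, List.map_map,
    ← List.map_reverse]
  convert h using 2 <;> simp [Arr.inv, Function.comp_def, Atomic.inv, Atomic.widen]

theorem inv_one : (1 : Mor P c).inv = 1 := rfl

theorem src_inv (a : Mor P c) : a.inv.src = a.tgt := by
  induction a using Quot.ind
  rfl

theorem tgt_inv (a : Mor P c) : a.inv.tgt = a.src := by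
  induction a using Quot.ind
  rfl

end Mor

/-! ### Return to diagrams and vertices with prescribed labels -/

/-- Equal classes of diagrams define the same vertex of `K(P, w)`. -/
theorem vertex_eq_of_mor_eq {w u v : List A} {d : Derivation P w u} {e : Derivation P w v}
    (h : Mor.mk True ⟨w, u, d.steps, d.valid⟩ = Mor.mk True ⟨w, v, e.steps, e.valid⟩) :
    (⟨u, Quot.mk _ d⟩ : Vertex P w) = ⟨v, Quot.mk _ e⟩ := by
  classical
  let F : Arr P → Option (Vertex P w) := fun a =>
    -- The value `none` makes the map total on diagrams with arbitrary labels, so that it descends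
    -- to the quotient and recovers the vertex from the class.
    if h : a.src = w then some ⟨a.tgt, Quot.mk _ ⟨a.steps, h ▸ a.valid⟩⟩ else none
  have hF : ∀ a b, Arr.Rel True a b → F a = F b := by
    rintro ⟨u, v, l, hl⟩ ⟨u', v', l', hl'⟩ ⟨h₁, h₂, h₃⟩
    obtain rfl : u = u' := h₁
    obtain rfl : v = v' := h₂
    by_cases hu : u = w
    · subst hu
      simp only [F, dif_pos]
      refine congrArg some (congrArg (Sigma.mk v) (Quot.sound ?_))
      exact h₃.imp (fun h => h) fun h => h.2
    · simp [F, hu]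
  have := congrArg (Quot.lift F hF) h
  simp only [Mor.mk, F, dif_pos] at this
  exact Option.some.inj this

/-- Isotopic sequences of attachments define the same diagram. -/
theorem diagram_eq_of_mor_eq {u v : List A} {d e : Derivation P u v}
    (h : Mor.mk False ⟨u, v, d.steps, d.valid⟩ = Mor.mk False ⟨u, v, e.steps, e.valid⟩) :
    (Quot.mk _ d : Diagram P u v) = Quot.mk _ e := by
  classical
  let F : Arr P → Option (Diagram P u v) := fun a =>
    if h : a.src = u ∧ a.tgt = v then
      some (Quot.mk _ ⟨a.steps, h.1 ▸ h.2 ▸ a.valid⟩) else none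
  have hF : ∀ a b, Arr.Rel False a b → F a = F b := by
    rintro ⟨u', v', l, hl⟩ ⟨u'', v'', l', hl'⟩ ⟨h₁, h₂, h₃⟩
    obtain rfl : u' = u'' := h₁
    obtain rfl : v' = v'' := h₂
    by_cases hu : u' = u ∧ v' = v
    · simp only [F, dif_pos hu]
      refine congrArg some (Quot.sound ?_)
      exact h₃.elim (fun h => h) fun h => h.1.elim
    · simp [F, hu]
  have := congrArg (Quot.lift F hF) h
  simp only [Mor.mk, F, dif_pos, and_self] at this
  exact Option.some.inj this

namespace Thin

/-- The diagram `Φ_J`. -/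
def arr {k : ℕ} (Φ : Thin P k) (J : Fin k → Bool) : Arr P :=
  ⟨Φ.top, Φ.word J, Φ.steps [] J, Φ.steps_valid [] J⟩

theorem steps_widen {k : ℕ} (Φ : Thin P k) (p q : List A) (J : Fin k → Bool) :
    Φ.steps (p ++ q) J = (Φ.steps q J).map (Atomic.widen p []) := by
  induction Φ generalizing q with
  | nil => rfl
  | edge a Φ ih => simpa [steps] using ih (q ++ [a]) J
  | cell u v h Φ ih =>
    have := ih (q ++ if J 0 then v else u) fun i => J i.succ
    simp only [steps, List.map_append, ← this, List.append_assoc]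
    split_ifs <;> simp [Atomic.widen]

theorem arr_edge {k : ℕ} (a : A) (Φ : Thin P k) (J : Fin k → Bool) :
    (edge a Φ).arr J = Arr.id [a] * Φ.arr J := by
  refine Arr.ext rfl rfl ?_
  have := Φ.steps_widen [a] [] J
  simpa [arr, steps, Arr.mul_steps, Arr.id] using this

theorem arr_cell {k : ℕ} (u v : List A) (h : (u, v) ∈ P.rel) (Φ : Thin P k)
    (J : Fin (k + 1) → Bool) :
    (cell u v h Φ).arr J =
      (if J 0 then Arr.cell u v h else Arr.id u) * Φ.arr fun i => J i.succ := by
  cases hJ : J 0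
  · refine Arr.ext rfl (by simp [arr, word, hJ]; rfl) ?_
    have := Φ.steps_widen u [] fun i => J i.succ
    simpa [arr, steps, Arr.mul_steps, Arr.id, hJ] using this
  · refine Arr.ext rfl (by simp [arr, word, hJ]; rfl) ?_
    have := Φ.steps_widen v [] fun i => J i.succ
    simp [arr, steps, Arr.mul_steps, Arr.cell, hJ, Atomic.widen]
    simpa [Atomic.widen] using this

end Thin

/-! ### Prefixes of thin diagrams -/

/-- A part of a thin diagram: a plain edge, or a cell together with the information whether it has
been attached. -/
inductive Item (P : Presentation A) : Type
  | edge (a : A) : Item P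
  | cell (u v : List A) (h : (u, v) ∈ P.rel) (b : Bool) : Item P

/-- The part of the bottom path. -/
def Item.word : Item P → List A
  | edge a => [a]
  | cell u v _ b => if b then v else u

/-- The label of the bottom path. -/
def itemsWord (S : List (Item P)) : List A := S.flatMap Item.word

theorem itemsWord_append (S T : List (Item P)) :
    itemsWord (S ++ T) = itemsWord S ++ itemsWord T := List.flatMap_append

theorem itemsWord_cons (i : Item P) (S : List (Item P)) :
    itemsWord (i :: S) = i.word ++ itemsWord S := rfl

/-- The attachments `l` attach cells of the thin diagram `S`, with result `S'`. -/
def ItemsRun : List (Item P) → List (Atomic P) → List (Item P) → Prop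
  | S, [], S' => S = S'
  | S, a :: l, S' => ∃ S₁ S₂, S = S₁ ++ Item.cell a.src a.tgt a.mem false :: S₂ ∧
      itemsWord S₁ = a.left ∧ itemsWord S₂ = a.right ∧
      ItemsRun (S₁ ++ Item.cell a.src a.tgt a.mem true :: S₂) l S'

theorem itemsRun_append_iff {l m : List (Atomic P)} {S S'' : List (Item P)} :
    ItemsRun S (l ++ m) S'' ↔ ∃ S', ItemsRun S l S' ∧ ItemsRun S' m S'' := by
  induction l generalizing S with
  | nil => simp [ItemsRun]
  | cons a l ih =>
    simp only [List.cons_append, ItemsRun, ih]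
    constructor
    · rintro ⟨S₁, S₂, h₁, h₂, h₃, S', h₄, h₅⟩
      exact ⟨S', ⟨S₁, S₂, h₁, h₂, h₃, h₄⟩, h₅⟩
    · rintro ⟨S', ⟨S₁, S₂, h₁, h₂, h₃, h₄⟩, h₅⟩
      exact ⟨S₁, S₂, h₁, h₂, h₃, S', h₄, h₅⟩

theorem append_cons_eq_append_cons {α : Type*} {S₁ S₂ T₁ T₂ : List α} {x y : α}
    (h : S₁ ++ x :: S₂ = T₁ ++ y :: T₂) :
    (∃ M, T₁ = S₁ ++ x :: M ∧ S₂ = M ++ y :: T₂) ∨ (S₁ = T₁ ∧ x = y ∧ S₂ = T₂) ∨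
      ∃ M, S₁ = T₁ ++ y :: M ∧ T₂ = M ++ x :: S₂ := by
  rcases List.append_eq_append_iff.1 h with ⟨M, h₁, h₂⟩ | ⟨M, h₁, h₂⟩ <;> cases M with
  | nil => simp_all
  | cons z M => simp_all

theorem rel_ne_nil {u v : List A} (h : (u, v) ∈ P.rel) : u ≠ [] := P.nonempty u v h

/-- A run records only which cells of the thin diagram are attached, and two cells along disjoint
arcs can be recorded in either order. Their left-to-right order is forced, since relators are
nonempty and words to the left have prescribed lengths. -/
theorem itemsRun_swap {p u v q u' v' r : List A} (h : (u, v) ∈ P.rel) (h' : (u', v') ∈ P.rel)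
    (l : List (Atomic P)) (S S' : List (Item P)) :
    ItemsRun S (⟨p, u, v, q ++ u' ++ r, h⟩ :: ⟨p ++ v ++ q, u', v', r, h'⟩ :: l) S' ↔
      ItemsRun S (⟨p ++ u ++ q, u', v', r, h'⟩ :: ⟨p, u, v, q ++ v' ++ r, h⟩ :: l) S' := by
  constructor
  · rintro ⟨S₁, S₂, rfl, h₁, h₂, T₁, T₂, h₃, h₄, h₅, h₆⟩
    dsimp only at h₁ h₂ h₃ h₄ h₅ h₆
    rcases append_cons_eq_append_cons h₃ with ⟨M, rfl, rfl⟩ | ⟨-, h₇, -⟩ | ⟨M, rfl, rfl⟩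
    · have h₈ : itemsWord M = q := by
        simpa [itemsWord_append, itemsWord_cons, Item.word, h₁] using h₄
      refine ⟨S₁ ++ Item.cell u v h false :: M, T₂, by simp, ?_, h₅,
        S₁, M ++ Item.cell u' v' h' true :: T₂, by simp, h₁, ?_, by simpa using h₆⟩
      · simp [itemsWord_append, itemsWord_cons, Item.word, h₁, h₈]
      · simp [itemsWord_append, itemsWord_cons, Item.word, h₈, h₅]
    · simp at h₇
    · have h₈ := congrArg List.length h₁
      have h₉ := congrArg List.length h₄
      have := List.length_pos_of_ne_nil (rel_ne_nil h')
      simp [itemsWord_append, itemsWord_cons, Item.word] at h₈ h₉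
      omega
  · rintro ⟨S₁, S₂, rfl, h₁, h₂, T₁, T₂, h₃, h₄, h₅, h₆⟩
    dsimp only at h₁ h₂ h₃ h₄ h₅ h₆
    rcases append_cons_eq_append_cons h₃ with ⟨M, rfl, rfl⟩ | ⟨-, h₇, -⟩ | ⟨M, rfl, rfl⟩
    · have h₈ := congrArg List.length h₁
      have h₉ := congrArg List.length h₄
      have := List.length_pos_of_ne_nil (rel_ne_nil (P.symm _ _ h'))
      simp [itemsWord_append, itemsWord_cons, Item.word] at h₈ h₉
      omega
    · simp at h₇
    · have h₈ : itemsWord M = q := by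
        simpa [itemsWord_append, itemsWord_cons, Item.word, h₄] using h₁
      refine ⟨T₁, M ++ Item.cell u' v' h' false :: S₂, by simp, h₄, ?_,
        T₁ ++ Item.cell u v h true :: M, S₂, by simp, ?_, h₂, by simpa using h₆⟩
      · simp [itemsWord_append, itemsWord_cons, Item.word, h₂, h₈]
      · simp [itemsWord_append, itemsWord_cons, Item.word, h₈, h₄]

theorem Exchange.itemsRun_iff {l m : List (Atomic P)} (h : Exchange l m) (S S' : List (Item P)) :
    ItemsRun S l S' ↔ ItemsRun S m S' := by
  cases h with
  | swap l₁ l₂ p u v q u' v' r h h' =>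
    simp only [itemsRun_append_iff (l := l₁), itemsRun_swap]

theorem itemsRun_iff_of_mk_eq {u v : List A} {d e : Derivation P u v}
    (h : (Quot.mk _ d : Diagram P u v) = Quot.mk _ e) (S S' : List (Item P)) :
    ItemsRun S d.steps S' ↔ ItemsRun S e.steps S' := by
  have := congrArg (Quot.lift (fun d : Derivation P u v => ItemsRun S d.steps S')
    fun _ _ h => propext (h.itemsRun_iff S S')) h
  exact iff_of_eq this

/-- The inverse cell would have to be attached exactly where the first cell has just been attached,
but that item is already marked as used. Any other item begins at a different place, since the words
involved are nonempty. -/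
theorem not_itemsRun_dipole (a : Atomic P) (l : List (Atomic P)) (S S' : List (Item P)) :
    ¬ ItemsRun S (a :: a.inv :: l) S' := by
  rintro ⟨S₁, S₂, rfl, h₁, h₂, T₁, T₂, h₃, h₄, h₅, -⟩
  have h₆ := congrArg List.length (h₁.trans h₄.symm)
  rcases append_cons_eq_append_cons h₃ with ⟨M, rfl, rfl⟩ | ⟨-, h₇, -⟩ | ⟨M, rfl, rfl⟩
  · have := List.length_pos_of_ne_nil (rel_ne_nil (P.symm _ _ a.mem))
    simp [itemsWord_append, itemsWord_cons, Item.word] at h₆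
    simp [h₆] at this
  · simp at h₇
  · have := List.length_pos_of_ne_nil (rel_ne_nil a.inv.mem)
    simp [itemsWord_append, itemsWord_cons, Item.word] at h₆
    simp [h₆] at this

namespace Thin

/-- The parts of the thin diagram `Φ`, the cells of `J` being attached. -/
def items : {k : ℕ} → Thin P k → (Fin k → Bool) → List (Item P)
  | _, nil, _ => []
  | _, edge a Φ, J => Item.edge a :: Φ.items J
  | _, cell u v h Φ, J => Item.cell u v h (J 0) :: Φ.items fun i => J i.succ

theorem itemsWord_items {k : ℕ} (Φ : Thin P k) (J : Fin k → Bool) :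
    itemsWord (Φ.items J) = Φ.word J := by
  induction Φ with
  | nil => rfl
  | edge a Φ ih => simp [items, word, itemsWord_cons, ih, Item.word]
  | cell u v h Φ ih => simp [items, word, itemsWord_cons, ih, Item.word]

theorem itemsRun_steps {k : ℕ} (Φ : Thin P k) (S : List (Item P)) (J : Fin k → Bool) :
    ItemsRun (S ++ Φ.items fun _ => false) (Φ.steps (itemsWord S) J) (S ++ Φ.items J) := by
  induction Φ generalizing S with
  | nil => rfl
  | edge a Φ ih =>
    have := ih (S ++ [Item.edge a])  J
    rw [itemsWord_append] at this
    simpa [items, steps, Item.word, itemsWord] using this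
  | cell u v h Φ ih =>
    have := ih (S ++ [Item.cell u v h (J 0)]) fun i => J i.succ
    rw [itemsWord_append] at this
    cases hJ : J 0
    · simpa [items, steps, itemsWord_append, itemsWord_cons, Item.word, itemsWord, hJ] using this
    · simp only [steps, hJ, if_true, List.singleton_append, items]
      refine ⟨S, Φ.items fun _ => false, rfl, rfl, Φ.itemsWord_items _, ?_⟩
      simpa [items, steps, itemsWord_append, itemsWord_cons, Item.word, itemsWord, hJ] using this

/-- Attaching one more cell to a part of a thin diagram. -/
theorem exists_arr_comp_cell {k : ℕ} (Φ : Thin P k) (c : Prop) (J : Fin k → Bool)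
    {S₁ S₂ : List (Item P)} {u v : List A} {h : (u, v) ∈ P.rel}
    (e : Φ.items J = S₁ ++ Item.cell u v h false :: S₂) :
    ∃ J' : Fin k → Bool, Φ.items J' = S₁ ++ Item.cell u v h true :: S₂ ∧
      (Mor.mk c (Φ.arr J)).comp (Mor.mk c (Arr.id (itemsWord S₁)) * (Mor.mk c (Arr.cell u v h) *
        Mor.mk c (Arr.id (itemsWord S₂)))) = Mor.mk c (Φ.arr J') := by
  -- Attaching a cell further to the right does not affect the leftmost part `b`, by the interchange
  -- law; this is the common inductive step.
  have key : ∀ {k : ℕ} (Φ : Thin P k) (J : Fin k → Bool) (i : Item P) (b : Arr P)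
      (S₁ : List (Item P)), b.tgt = i.word →
      Φ.items J = S₁ ++ Item.cell u v h false :: S₂ →
      (Mor.mk c (b * Φ.arr J)).comp (Mor.mk c (Arr.id (itemsWord (i :: S₁))) *
        (Mor.mk c (Arr.cell u v h) * Mor.mk c (Arr.id (itemsWord S₂)))) =
      Mor.mk c b * (Mor.mk c (Φ.arr J)).comp (Mor.mk c (Arr.id (itemsWord S₁)) *
        (Mor.mk c (Arr.cell u v h) * Mor.mk c (Arr.id (itemsWord S₂)))) := by
    intro k Φ J i b S₁ hb e
    rw [itemsWord_cons, ← Mor.id_mul_id, mul_assoc, Mor.mk_mul, Mor.mul_comp_mul,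
      Mor.comp_id (by exact hb)]
    · exact hb
    · have := congrArg itemsWord e
      rw [itemsWord_items, itemsWord_append, itemsWord_cons] at this
      exact this
  induction Φ generalizing S₁ with
  | nil => simp [items] at e
  | edge a Φ ih =>
    cases S₁ with
    | nil => simp [items] at e
    | cons i S₁ =>
      simp only [items, List.cons_append, List.cons.injEq] at e
      obtain ⟨rfl, e⟩ := e
      obtain ⟨J', h₁, h₂⟩ := ih J e
      refine ⟨J', by simp [items, h₁], ?_⟩
      rw [arr_edge, arr_edge, key _ _ _ _ _ (by rfl) e, h₂, Mor.mk_mul]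
  | cell u' v' h' Φ ih =>
    cases S₁ with
    | nil =>
      simp only [items, List.nil_append, List.cons.injEq, Item.cell.injEq] at e
      obtain ⟨⟨rfl, rfl, hJ⟩, rfl⟩ := e
      refine ⟨Fin.cons true fun i => J i.succ, by simp [items], ?_⟩
      rw [arr_cell, arr_cell, Mor.mk_mul, Mor.mk_mul]
      simp only [hJ, Fin.cons_zero, Fin.cons_succ, if_true, Bool.false_eq_true, if_false]
      change (_ : Mor P c).comp (1 * _) = _
      rw [one_mul, Mor.mul_comp_mul (by rfl), Mor.id_comp (by rfl),
        Mor.comp_id (by exact (itemsWord_items _ _).symm)]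
      exact (itemsWord_items _ _).symm
    | cons i S₁ =>
      simp only [items, List.cons_append, List.cons.injEq] at e
      obtain ⟨rfl, e⟩ := e
      obtain ⟨J', h₁, h₂⟩ := ih (fun i => J i.succ) e
      refine ⟨Fin.cons (J 0) J', by simp [items, h₁], ?_⟩
      rw [arr_cell, arr_cell, key _ _ _ _ _ (by cases J 0 <;> rfl) e, h₂, Mor.mk_mul]
      simp

/-- A run attaches only cells of `Φ`, possibly out of order. Adding them one at a time keeps the
diagram equal to some `Φ_J` with its cells in standard order. -/
theorem exists_arr_eq_of_itemsRun {k : ℕ} (Φ : Thin P k) (c : Prop) (J : Fin k → Bool)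
    (l : List (Atomic P)) (S' : List (Item P)) (z : List A) (hl : IsDerivation l (Φ.word J) z)
    (h : ItemsRun (Φ.items J) l S') :
    ∃ J', (Mor.mk c (Φ.arr J)).comp (Mor.mk c ⟨_, z, l, hl⟩) = Mor.mk c (Φ.arr J') := by
  induction l generalizing J with
  | nil =>
    obtain rfl := hl
    exact ⟨J, Mor.comp_id rfl⟩
  | cons a l ih =>
    obtain ⟨S₁, S₂, h₁, h₂, h₃, h₄⟩ := h
    obtain ⟨J₁, h₅, h₆⟩ := Φ.exists_arr_comp_cell c J h₁
    rw [← h₅] at h₄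
    have h₇ : a.bot = Φ.word J₁ := by
      rw [← itemsWord_items, h₅, itemsWord_append, itemsWord_cons, h₂, h₃]
      simp [Atomic.bot, Item.word]
    have e₁ : itemsWord S₁ ++ (a.src ++ itemsWord S₂) = Φ.word J := by
      rw [h₂, h₃, ← hl.1]
      exact (List.append_assoc _ _ _).symm
    have e₂ : itemsWord S₁ ++ (a.tgt ++ itemsWord S₂) = Φ.word J₁ := by
      rw [h₂, h₃, ← h₇]
      exact (List.append_assoc _ _ _).symm
    have hl' : IsDerivation l (Φ.word J₁) z := h₇ ▸ hl.2
    obtain ⟨J', h₈⟩ := ih J₁ hl' h₄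
    refine ⟨J', ?_⟩
    rw [← h₈, ← h₆, Mor.comp_assoc (by exact e₁.symm) (by exact e₂)]
    refine congrArg _ ?_
    rw [← Mor.mk_mul, ← Mor.mk_mul, ← Mor.mk_comp, Arr.comp_eq (by exact e₂)]
    refine congrArg _ (Arr.ext e₁.symm rfl ?_)
    simp [Arr.mul_steps, Arr.id, Arr.cell, Atomic.widen, h₂, h₃]

/-- The prefixes of a thin diagram are its parts. -/
theorem exists_part_of_prefix {k : ℕ} (Φ : Thin P k) (c : Prop) {u z x : List A} (hu : Φ.top = u)
    (d : Derivation P u z) (f : Derivation P z x) (K : Fin k → Bool)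
    (hK : IsDerivation (Φ.steps [] K) u x)
    (h : (Quot.mk _ (d.comp f) : Diagram P u x) = Quot.mk _ ⟨Φ.steps [] K, hK⟩) :
    ∃ J, Mor.mk c ⟨u, z, d.steps, d.valid⟩ = Mor.mk c (Φ.arr J) := by
  subst hu
  have h₁ : ItemsRun (Φ.items fun _ => false) (Φ.steps [] K) (Φ.items K) := Φ.itemsRun_steps [] K
  rw [← itemsRun_iff_of_mk_eq h] at h₁
  -- The run of all of `Φ_K` can be performed along `d` followed by `f`; its initial stretch is a
  -- run along `d` alone.
  obtain ⟨S', h₂, -⟩ := itemsRun_append_iff.1 h₁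
  obtain ⟨J, hJ⟩ := Φ.exists_arr_eq_of_itemsRun c (fun _ => false) d.steps S' z d.valid h₂
  refine ⟨J, ?_⟩
  rw [← hJ]
  have h₃ : Φ.arr (fun _ => false) = Arr.id Φ.top := by
    refine Arr.ext rfl rfl ?_
    change Φ.steps [] (fun _ => false) = []
    generalize ([] : List A) = p
    clear * -
    induction Φ generalizing p with
    | nil => rfl
    | edge a Φ ih => exact ih _
    | cell u v h Φ ih => simpa [steps] using ih _
  rw [h₃]
  exact (Mor.id_comp (by rfl)).symm

/-- Thin diagrams are reduced. -/
theorem reduced_of_steps {k : ℕ} (Φ : Thin P k) {u x : List A} (K : Fin k → Bool)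
    (hK : IsDerivation (Φ.steps [] K) u x) :
    Diagram.Reduced (Quot.mk _ ⟨Φ.steps [] K, hK⟩ : Diagram P u x) := by
  rintro d hd ⟨l₁, l₂, a, e⟩
  have h₁ : ItemsRun (Φ.items fun _ => false) (Φ.steps [] K) (Φ.items K) := Φ.itemsRun_steps [] K
  rw [← itemsRun_iff_of_mk_eq hd, e, itemsRun_append_iff] at h₁
  obtain ⟨S', -, h₂⟩ := h₁
  exact not_itemsRun_dipole _ _ _ _ h₂

/-- Attaching the cells that are missing in a part of a thin diagram. -/
theorem exists_arr_comp_eq {k : ℕ} (Φ : Thin P k) (c : Prop) {J K : Fin k → Bool}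
    (h : ∀ i, J i = true → K i = true) :
    ∃ f : Arr P, f.src = Φ.word J ∧ f.tgt = Φ.word K ∧
      (Mor.mk c (Φ.arr J)).comp (Mor.mk c f) = Mor.mk c (Φ.arr K) := by
  induction Φ with
  | nil => exact ⟨1, rfl, rfl, Mor.id_comp rfl⟩
  | edge a Φ ih =>
    obtain ⟨f, h₁, h₂, h₃⟩ := ih h
    refine ⟨Arr.id [a] * f, congrArg (a :: ·) h₁, congrArg (a :: ·) h₂, ?_⟩
    rw [arr_edge, arr_edge, Mor.mk_mul, Mor.mk_mul, Mor.mk_mul, Mor.mul_comp_mul (by rfl), h₃,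
      Mor.comp_id (by rfl)]
    exact h₁.symm
  | cell u v h' Φ ih =>
    obtain ⟨f, h₁, h₂, h₃⟩ := ih fun i => h i.succ
    rw [arr_cell, arr_cell]
    have h₀ := h 0
    cases hJ : J 0 <;> cases hK : K 0
    · refine ⟨Arr.id u * f, ?_, ?_, ?_⟩
      · simp only [word, hJ, ← h₁]; rfl
      · simp only [word, hK, ← h₂]; rfl
      · rw [Mor.mk_mul, Mor.mk_mul, Mor.mk_mul, Mor.mul_comp_mul (by rfl) (by exact h₁.symm), h₃,
          Mor.comp_id (by rfl)]
    · refine ⟨Arr.cell u v h' * f, ?_, ?_, ?_⟩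
      · simp only [word, hJ, ← h₁]; rfl
      · simp only [word, hK, ← h₂]; rfl
      · rw [Mor.mk_mul, Mor.mk_mul, Mor.mk_mul, Mor.mul_comp_mul (by rfl) (by exact h₁.symm), h₃]
        exact congrArg (· * _) (Mor.id_comp rfl)
    · simp [hJ, hK] at h₀
    · refine ⟨Arr.id v * f, ?_, ?_, ?_⟩
      · simp only [word, hJ, ← h₁]; rfl
      · simp only [word, hK, ← h₂]; rfl
      · rw [Mor.mk_mul, Mor.mk_mul, Mor.mk_mul, Mor.mul_comp_mul (by rfl) (by exact h₁.symm), h₃,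
          Mor.comp_id (by rfl)]

end Thin

/-! ### Weights of points of cubes -/

/-- The weight of the vertex `J` of a cube at the point with coordinates `t`. -/
def bitWeight {k : ℕ} (t : Fin k → ℝ) (J : Fin k → Bool) : ℝ :=
  ∏ i, if J i then t i else 1 - t i

theorem sum_prod_bits {k : ℕ} (h : Fin k → Bool → ℝ) :
    ∑ J : Fin k → Bool, ∏ i, h i (J i) = ∏ i, (h i true + h i false) := by
  have := Finset.prod_univ_sum (fun _ : Fin k => (Finset.univ : Finset Bool)) h
  rw [Fintype.piFinset_univ] at this
  rw [← this]
  simp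

theorem sum_bitWeight {k : ℕ} (t : Fin k → ℝ) : ∑ J, bitWeight t J = 1 := by
  have := sum_prod_bits fun i b => if b then t i else 1 - t i
  simpa [bitWeight] using this

/-- Marginals of the weights. -/
theorem sum_bitWeight_mul {k : ℕ} (t : Fin k → ℝ) (i : Fin k) (f : Bool → ℝ) :
    ∑ J, bitWeight t J * f (J i) = t i * f true + (1 - t i) * f false := by
  have := sum_prod_bits fun j b => (if b then t j else 1 - t j) * if j = i then f b else 1
  simp only [Finset.prod_mul_distrib, Finset.prod_ite_eq', Finset.mem_univ, if_true] at this
  change ∑ J, bitWeight t J * _ = _ at this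
  rw [this, Finset.prod_eq_single i]
  · simp
  · intro j _ hj
    simp [hj]
  · simp

/-- Each coordinate of `σ` is either constant, or a coordinate, or the negation of a coordinate, and
different coordinates of `σ` depend on different coordinates. -/
def IsBitAffine {k d : ℕ} (σ : (Fin k → Bool) → Fin d → Bool) (κ : Fin d → Option (Fin k))
    (c : Fin d → Bool) : Prop :=
  (∀ i j k, κ i = some k → κ j = some k → i = j) ∧
    ∀ J i, σ J i = (κ i).elim (c i) fun k => xor (c i) (J k)

/-- The affine extension of a coordinate. -/
def bitExtend (c : Bool) (x : ℝ) : ℝ := if c then 1 - x else x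

/-- The weights are the law of independent random bits with means `t`. A constant bit, a copied bit
and a negated bit have the means stated here. -/
theorem sum_bitWeight_of_isBitAffine {k d : ℕ} {σ : (Fin k → Bool) → Fin d → Bool}
    {κ : Fin d → Option (Fin k)} {c : Fin d → Bool} (h : IsBitAffine σ κ c) (t : Fin k → ℝ)
    (i : Fin d) : ∑ J, bitWeight t J * (if σ J i then 1 else 0) =
      (κ i).elim (if c i then 1 else 0) fun k => bitExtend (c i) (t k) := by
  cases hi : κ i with
  | none =>
    have e : ∀ J, σ J i = c i := fun J => by rw [h.2, hi, Option.elim_none]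
    simp only [e, Option.elim_none]
    rw [← Finset.sum_mul, sum_bitWeight, one_mul]
  | some k =>
    have e : ∀ J, σ J i = xor (c i) (J k) := fun J => by rw [h.2, hi, Option.elim_some]
    simp only [e, Option.elim_some]
    rw [sum_bitWeight_mul t k fun b => if xor (c i) b then 1 else 0]
    cases c i <;> simp [bitExtend]

/-- The image of the weights under a map `σ` of this kind. -/
theorem sum_bitWeight_fiber {k d : ℕ} {σ : (Fin k → Bool) → Fin d → Bool}
    {κ : Fin d → Option (Fin k)} {c : Fin d → Bool} (h : IsBitAffine σ κ c) (t : Fin k → ℝ)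
    (K : Fin d → Bool) : ∑ J, bitWeight t J * (if σ J = K then 1 else 0) =
      bitWeight (fun i => (κ i).elim (if c i then 1 else 0) fun k => bitExtend (c i) (t k)) K := by
  classical
  -- In probabilistic terms, the coordinates of `σ` are independent because they use different bits.
  -- The indicator of `σ J = K` factors over the coordinates `i`, which are grouped by the bit `κ i`
  -- they depend on.
  have e : ∀ J, (if σ J = K then (1 : ℝ) else 0) = ∏ i, if σ J i = K i then (1 : ℝ) else 0 := by
    intro J
    rw [Finset.prod_ite_zero]
    simp [funext_iff]
  have fiber : ∀ f : Fin d → ℝ, ∏ i, f i =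
      (∏ i with κ i = none, f i) * ∏ k, ∏ i with κ i = some k, f i := fun f => by
    rw [← Finset.prod_fiberwise _ κ, Fintype.prod_option]
  simp only [e, fiber, bitWeight]
  have h₁ : ∀ J, (∏ i with κ i = none, if σ J i = K i then (1 : ℝ) else 0) =
      ∏ i with κ i = none, if c i = K i then (1 : ℝ) else 0 := fun J => by
    refine Finset.prod_congr rfl fun i hi => ?_
    rw [h.2, (Finset.mem_filter.1 hi).2]
    rfl
  have h₂ : ∀ J, (∏ k, ∏ i with κ i = some k, if σ J i = K i then (1 : ℝ) else 0) =
      ∏ k, ∏ i with κ i = some k, if xor (c i) (J k) = K i then (1 : ℝ) else 0 := fun J => by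
    refine Finset.prod_congr rfl fun k _ => Finset.prod_congr rfl fun i hi => ?_
    rw [h.2, (Finset.mem_filter.1 hi).2]
    rfl
  simp only [h₁, h₂]
  have h₃ : ∀ J : Fin k → Bool, (∏ i, if J i then t i else 1 - t i) *
      ((∏ i with κ i = none, if c i = K i then (1 : ℝ) else 0) *
        ∏ k, ∏ i with κ i = some k, if xor (c i) (J k) = K i then (1 : ℝ) else 0) =
      (∏ i with κ i = none, if c i = K i then (1 : ℝ) else 0) *
        ∏ k, ((if J k then t k else 1 - t k) *
          ∏ i with κ i = some k, if xor (c i) (J k) = K i then (1 : ℝ) else 0) := fun J => by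
    rw [Finset.prod_mul_distrib]
    ring
  simp only [h₃]
  rw [← Finset.mul_sum, sum_prod_bits fun k b => (if b then t k else 1 - t k) *
    ∏ i with κ i = some k, if xor (c i) b = K i then (1 : ℝ) else 0]
  congr 1
  · refine Finset.prod_congr rfl fun i hi => ?_
    rw [(Finset.mem_filter.1 hi).2, Option.elim_none]
    cases c i <;> cases K i <;> simp
  · refine Finset.prod_congr rfl fun k _ => ?_
    by_cases hk : ∃ i, κ i = some k
    · obtain ⟨i, hi⟩ := hk
      have : (Finset.univ.filter fun j => κ j = some k) = {i} := by
        ext j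
        simp only [Finset.mem_filter, Finset.mem_univ, true_and, Finset.mem_singleton]
        exact ⟨fun hj => h.1 j i k hj hi, fun hj => hj ▸ hi⟩
      simp only [this, Finset.prod_singleton, hi, Option.elim_some, bitExtend]
      cases c i <;> cases K i <;> simp
    · have : (Finset.univ.filter fun j => κ j = some k) = ∅ := by
        ext j
        simpa using fun hj => hk ⟨j, hj⟩
      simp [this]

variable {w : List A}

theorem cubeWeight_eq {k : ℕ} (Φ : Thin P k) (U : DiagClass P w Φ.top)
    (t : Fin k → Set.Icc (0 : ℝ) 1) : cubeWeight Φ U t =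
      ∑ J, Finsupp.single (cubeVertex Φ U J) (bitWeight (fun i => (t i : ℝ)) J) := rfl

theorem bitWeight_nonneg {k : ℕ} (t : Fin k → Set.Icc (0 : ℝ) 1) (J : Fin k → Bool) :
    0 ≤ bitWeight (fun i => (t i : ℝ)) J := by
  refine Finset.prod_nonneg fun i _ => ?_
  have := (t i).2
  split_ifs
  · exact this.1
  · exact sub_nonneg.2 this.2

theorem cubeWeight_cubeVertex_ne_zero {k : ℕ} (Φ : Thin P k) (U : DiagClass P w Φ.top)
    (t : Fin k → Set.Icc (0 : ℝ) 1) {J : Fin k → Bool}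
    (hJ : bitWeight (fun i => (t i : ℝ)) J ≠ 0) : cubeWeight Φ U t (cubeVertex Φ U J) ≠ 0 := by
  classical
  rw [cubeWeight_eq, Finsupp.finsetSum_apply]
  refine ne_of_gt (Finset.sum_pos' (fun K _ => ?_) ⟨J, Finset.mem_univ _, ?_⟩)
  · rw [Finsupp.single_apply]
    split_ifs
    · exact bitWeight_nonneg t K
    · rfl
  · rw [Finsupp.single_eq_same]
    exact lt_of_le_of_ne (bitWeight_nonneg t J) hJ.symm

theorem exists_cubeVertex_of_cubeWeight_ne_zero {k : ℕ} (Φ : Thin P k) (U : DiagClass P w Φ.top)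
    (t : Fin k → Set.Icc (0 : ℝ) 1) {X : Vertex P w} (hX : cubeWeight Φ U t X ≠ 0) :
    ∃ J, X = cubeVertex Φ U J := by
  classical
  rw [cubeWeight_eq, Finsupp.finsetSum_apply] at hX
  obtain ⟨J, -, hJ⟩ := Finset.exists_ne_zero_of_sum_ne_zero hX
  rw [Finsupp.single_apply] at hJ
  by_contra! h
  exact hJ (if_neg (h J).symm)

/-! ### Walls -/

/-- A family of walls: each cube crosses each wall in at most one direction, and different walls in
different directions. -/
def IsWallFamily {d : ℕ} (b : Vertex P w → Fin d → Bool) : Prop :=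
  ∀ (k : ℕ) (Φ : Thin P k) (U : DiagClass P w Φ.top),
    ∃ κ c, IsBitAffine (fun J => b (cubeVertex Φ U J)) κ c

/-- The coordinates defined by a family of walls. -/
noncomputable def wallCoord {d : ℕ} (b : Vertex P w → Fin d → Bool) (p : Realization P w)
    (i : Fin d) : ℝ :=
  Finsupp.linearCombination ℝ (fun X => if b X i then (1 : ℝ) else 0) p.1

theorem wallCoord_cubePoint {d k : ℕ} (b : Vertex P w → Fin d → Bool) (Φ : Thin P k)
    (U : DiagClass P w Φ.top) (t : Fin k → Set.Icc (0 : ℝ) 1) (i : Fin d) :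
    wallCoord b (cubePoint Φ U t) i = ∑ J, bitWeight (fun i => (t i : ℝ)) J *
      if b (cubeVertex Φ U J) i then 1 else 0 := by
  change Finsupp.linearCombination ℝ _ (∑ J, Finsupp.single (cubeVertex Φ U J)
    (bitWeight (fun i => (t i : ℝ)) J)) = _
  rw [map_sum]
  simp only [Finsupp.linearCombination_single, smul_eq_mul]

/-- On a cube, the wall coordinates are constants and, up to a flip, distinct coordinates of the
cube, so the map to `ℝ^d` forgets some directions and preserves the others. -/
theorem sum_wallCoord_sub_sq_le {d k : ℕ} {b : Vertex P w → Fin d → Bool} (hb : IsWallFamily b)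
    (Φ : Thin P k) (U : DiagClass P w Φ.top) (s t : Fin k → Set.Icc (0 : ℝ) 1) :
    ∑ i, (wallCoord b (cubePoint Φ U s) i - wallCoord b (cubePoint Φ U t) i) ^ 2 ≤
      ∑ i, ((s i : ℝ) - (t i : ℝ)) ^ 2 := by
  classical
  obtain ⟨κ, c, h⟩ := hb k Φ U
  let g : Option (Fin k) → ℝ := fun o => o.elim 0 fun k => ((s k : ℝ) - (t k : ℝ)) ^ 2
  have h₁ : ∀ i, (wallCoord b (cubePoint Φ U s) i - wallCoord b (cubePoint Φ U t) i) ^ 2 =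
      g (κ i) := fun i => by
    rw [wallCoord_cubePoint, wallCoord_cubePoint, sum_bitWeight_of_isBitAffine h,
      sum_bitWeight_of_isBitAffine h]
    cases κ i with
    | none => simp [g]
    | some k =>
      cases c i <;> simp only [g, bitExtend, Option.elim_some] <;> simp
      ring
  have h₂ : ∑ i, g (κ i) = ∑ i with κ i ≠ none, g (κ i) := by
    refine (Finset.sum_filter_of_ne (p := fun i => κ i ≠ none) fun i _ hi h0 => hi ?_).symm
    rw [h0]
    rfl
  -- Different walls are crossed in different directions, so no term of the right-hand sum is used
  -- twice.
  have h₃ : Set.InjOn κ (Finset.univ.filter fun i => κ i ≠ none : Finset (Fin d)) := by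
    intro i hi j _ hij
    obtain ⟨k, hk⟩ := Option.ne_none_iff_exists'.1 (Finset.mem_filter.1 hi).2
    exact h.1 i j k hk (hij ▸ hk)
  simp only [h₁]
  rw [h₂, ← Finset.sum_image (f := g) h₃]
  refine (Finset.sum_le_univ_sum_of_nonneg fun o => ?_).trans (le_of_eq ?_)
  · cases o
    · rfl
    · exact sq_nonneg _
  · rw [Fintype.sum_option]
    exact zero_add _

theorem norm_wallCoord_sub_le {d : ℕ} {b : Vertex P w → Fin d → Bool} (hb : IsWallFamily b)
    {p q : Realization P w} {ℓ : ℝ} (h : StringLength p q ℓ) :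
    ‖WithLp.toLp 2 (wallCoord b p) - WithLp.toLp 2 (wallCoord b q)‖ ≤ ℓ := by
  induction h with
  | nil p => simp
  | cons Φ U s t q ℓ h ih =>
    refine (norm_sub_le_norm_sub_add_norm_sub _ (WithLp.toLp 2 (wallCoord b (cubePoint Φ U t)))
      _).trans (add_le_add ?_ ih)
    rw [EuclideanSpace.norm_eq]
    refine Real.sqrt_le_sqrt ?_
    simpa using sum_wallCoord_sub_sq_le hb Φ U s t

theorem ofReal_sqrt_le_pathDist {d : ℕ} {b : Vertex P w → Fin d → Bool} (hb : IsWallFamily b)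
    (p q : Realization P w) :
    ENNReal.ofReal (Real.sqrt (∑ i, (wallCoord b p i - wallCoord b q i) ^ 2)) ≤ pathDist p q := by
  refine le_iInf₂ fun ℓ h => ENNReal.ofReal_le_ofReal ?_
  have := norm_wallCoord_sub_le hb h
  rw [EuclideanSpace.norm_eq] at this
  simpa using this

/-! ### Cubes whose directions are separated by walls -/

section Cube

variable {d : ℕ} {W : Thin P d} {U₀ : DiagClass P w W.top} {b : Vertex P w → Fin d → Bool}

theorem wallCoord_of_cube (hW : ∀ J, b (cubeVertex W U₀ J) = J) (s : Fin d → Set.Icc (0 : ℝ) 1)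
    (i : Fin d) : wallCoord b (cubePoint W U₀ s) i = s i := by
  rw [wallCoord_cubePoint]
  simp only [hW]
  rw [sum_bitWeight_mul (fun i => (s i : ℝ)) i fun b => if b then 1 else 0]
  simp

/-- A cube whose sides are separated by walls is isometrically embedded. -/
theorem pathDist_cubePoint (hb : IsWallFamily b) (hW : ∀ J, b (cubeVertex W U₀ J) = J)
    (s t : Fin d → Set.Icc (0 : ℝ) 1) :
    pathDist (cubePoint W U₀ s) (cubePoint W U₀ t) = ENNReal.ofReal (cubeDist s t) := by
  -- The upper bound is the straight segment inside the cube, the lower bound is the contraction to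
  -- wall coordinates.
  refine le_antisymm ?_ ?_
  · have := StringLength.cons W U₀ s t _ _ (StringLength.nil (cubePoint W U₀ t))
    rw [add_zero] at this
    exact iInf₂_le _ this
  · have := ofReal_sqrt_le_pathDist hb (cubePoint W U₀ s) (cubePoint W U₀ t)
    simp only [wallCoord_of_cube hW] at this
    exact this

/-- A vertex of `C(U₀, W)` is determined by its sides with respect to the walls. The weights of the
point are thus pushed forward along `b`, and the result is again a product weight by
`sum_bitWeight_fiber`. -/
theorem exists_cubePoint_eq (hb : IsWallFamily b) (hW : ∀ J, b (cubeVertex W U₀ J) = J) {k : ℕ}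
    (Φ : Thin P k) (U : DiagClass P w Φ.top) (t : Fin k → Set.Icc (0 : ℝ) 1)
    (h : ∀ J, bitWeight (fun i => (t i : ℝ)) J ≠ 0 → ∃ K, cubeVertex Φ U J = cubeVertex W U₀ K) :
    ∃ s, cubePoint Φ U t = cubePoint W U₀ s := by
  obtain ⟨κ, c, hκ⟩ := hb k Φ U
  let s : Fin d → Set.Icc (0 : ℝ) 1 := fun i =>
    ⟨(κ i).elim (if c i then 1 else 0) fun k => bitExtend (c i) (t k), by
      cases κ i with
      | none => cases c i <;> simp
      | some k =>
        have := (t k).2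
        cases c i <;> simp only [bitExtend, Option.elim_some] <;> simp [this.1, this.2]⟩
  refine ⟨s, Subtype.ext (?_ : cubeWeight Φ U t = cubeWeight W U₀ s)⟩
  -- Only the vertices of positive weight are known to lie in the target cube; for the others both
  -- sides vanish.
  have h₁ : ∀ J, Finsupp.single (cubeVertex Φ U J) (bitWeight (fun i => (t i : ℝ)) J) =
      ∑ K, Finsupp.single (cubeVertex W U₀ K) (bitWeight (fun i => (t i : ℝ)) J *
        if b (cubeVertex Φ U J) = K then 1 else 0) := fun J => by
    by_cases hJ : bitWeight (fun i => (t i : ℝ)) J = 0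
    · simp [hJ]
    · obtain ⟨K, hK⟩ := h J hJ
      rw [hK, hW, Finset.sum_eq_single K]
      · simp
      · intro L _ hL
        simp [hL.symm]
      · simp
  rw [cubeWeight_eq, cubeWeight_eq, Finset.sum_congr rfl fun J _ => h₁ J, Finset.sum_comm]
  refine Finset.sum_congr rfl fun K _ => ?_
  rw [← Finsupp.single_finsetSum, sum_bitWeight_fiber hκ]

theorem pathDist_eq_of_cubePoint_eq (hb : IsWallFamily b) (hW : ∀ J, b (cubeVertex W U₀ J) = J)
    {p q : Realization P w} (hp : ∃ s, p = cubePoint W U₀ s) (hq : ∃ s, q = cubePoint W U₀ s) :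
    pathDist p q =
      ENNReal.ofReal (Real.sqrt (∑ i, (wallCoord b p i - wallCoord b q i) ^ 2)) := by
  obtain ⟨s, rfl⟩ := hp
  obtain ⟨t, rfl⟩ := hq
  simp only [pathDist_cubePoint hb hW, wallCoord_of_cube hW]
  rfl

theorem cubeVertex_mk {k : ℕ} {Φ : Thin P k} {d : Derivation P w Φ.top} (J : Fin k → Bool) :
    cubeVertex Φ (Quot.mk _ d) J =
      ⟨Φ.word J, Quot.mk _ (d.comp ⟨Φ.steps [] J, Φ.steps_valid [] J⟩)⟩ := rfl

theorem exists_cubeVertex_of_prefix {k : ℕ} (Φ : Thin P k) (U : DiagClass P w Φ.top) {z : List A}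
    {H : Diagram P Φ.top z} (h : H.IsPrefix Φ.full) :
    ∃ J, (⟨z, U.comp H.toClass⟩ : Vertex P w) = cubeVertex Φ U J := by
  obtain ⟨F, hF⟩ := h
  induction H using Quot.ind with | _ e
  induction F using Quot.ind with | _ f
  induction U using Quot.ind with | _ d
  obtain ⟨J, hJ⟩ := Φ.exists_part_of_prefix True rfl e f _ (Φ.steps_valid [] _) hF
  refine ⟨J, ?_⟩
  rw [cubeVertex_mk]
  refine vertex_eq_of_mor_eq (d := d.comp e) (e := d.comp ⟨Φ.steps [] J, Φ.steps_valid [] J⟩) ?_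
  have := congrArg (Mor.mk True ⟨w, _, d.steps, d.valid⟩).comp hJ
  rw [← Mor.mk_comp, ← Mor.mk_comp, Arr.comp_eq (by rfl), Arr.comp_eq (by rfl)] at this
  exact this

theorem part_isPrefix {k : ℕ} (Φ : Thin P k) {u x z : List A} (hu : Φ.top = u)
    {J K : Fin k → Bool} (h : ∀ i, J i = true → K i = true) (d : Derivation P u z)
    (e : Derivation P u x) (hd : Mor.mk False ⟨u, z, d.steps, d.valid⟩ = Mor.mk False (Φ.arr J))
    (he : Mor.mk False ⟨u, x, e.steps, e.valid⟩ = Mor.mk False (Φ.arr K)) :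
    Diagram.IsPrefix (Quot.mk _ d : Diagram P u z) (Quot.mk _ e : Diagram P u x) := by
  subst hu
  obtain ⟨f, h₁, h₂, h₃⟩ := Φ.exists_arr_comp_eq False h
  have hz : z = Φ.word J := congrArg Mor.tgt hd
  have hx : x = Φ.word K := congrArg Mor.tgt he
  subst hz hx
  obtain ⟨u', v', l, hl⟩ := f
  change u' = _ at h₁
  change v' = _ at h₂
  subst h₁ h₂
  refine ⟨Quot.mk _ ⟨l, hl⟩, diagram_eq_of_mor_eq (d := d.comp ⟨l, hl⟩) (e := e) ?_⟩
  rw [he, ← h₃, ← hd, ← Mor.mk_comp, Arr.comp_eq (by rfl)]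
  rfl

/-- The full subcomplex spanned by the prefixes of a thin diagram is a cube. -/
theorem range_cubePoint (hb : IsWallFamily b) (hW : ∀ J, b (cubeVertex W U₀ J) = J) :
    Set.range (cubePoint W U₀) = prefixComplex U₀ W.full := by
  ext p
  constructor
  · rintro ⟨s, rfl⟩ X hX
    obtain ⟨J, rfl⟩ := exists_cubeVertex_of_cubeWeight_ne_zero W U₀ s hX
    exact ⟨_, W.part J, part_isPrefix W rfl (J := J) (K := fun _ => true) (fun _ _ => rfl)
      ⟨_, W.steps_valid [] J⟩ ⟨_, W.steps_valid [] _⟩ rfl rfl, rfl⟩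
  · intro hp
    obtain ⟨p, k, Φ, U, t, rfl⟩ := p
    obtain ⟨s, hs⟩ := exists_cubePoint_eq hb hW Φ U t fun J hJ => by
      obtain ⟨z, H, hH, e⟩ := hp _ (cubeWeight_cubeVertex_ne_zero Φ U t hJ)
      obtain ⟨K, hK⟩ := exists_cubeVertex_of_prefix W U₀ hH
      exact ⟨K, e.trans hK⟩
    exact ⟨s, hs.symm⟩

end Cube

/-! ### The walls of a cube of `K(⟨x | x = xx⟩, w)` -/

open Classical in
/-- The sides of a vertex with respect to the walls crossed by the cube `C(U₀, W)`. -/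
noncomputable def cubeWalls {w : List Unit} {d : ℕ} (W : Thin thompson d)
    (U₀ : DiagClass thompson w W.top) (X : Vertex thompson w) (i : Fin d) : Bool :=
  decide (Xor ((fun s => U₀.perm (W.node 0 i s)) ∈ X.nodes)
    ((fun s => U₀.perm (W.node 0 i s)) ∈ nodeSet U₀.perm))

theorem perm_comp_node_injective {w : List Unit} {d : ℕ} (W : Thin thompson d)
    (U₀ : DiagClass thompson w W.top) {i j : Fin d}
    (h : (fun s => U₀.perm (W.node 0 i s)) = fun s => U₀.perm (W.node 0 j s)) : i = j :=
  W.node_injective 0 (funext fun s => U₀.perm.injective (congrFun h s))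

theorem cubeWalls_cubeVertex {w : List Unit} {d : ℕ} (W : Thin thompson d)
    (U₀ : DiagClass thompson w W.top) (J : Fin d → Bool) :
    cubeWalls W U₀ (cubeVertex W U₀ J) = J := by
  funext i
  have : (∃ j, J j = true ∧ (fun s => U₀.perm (W.node 0 i s)) =
      fun s => U₀.perm (W.node 0 j s)) ↔ J i = true :=
    ⟨fun ⟨j, hj, h⟩ => perm_comp_node_injective W U₀ h ▸ hj, fun h => ⟨i, h, rfl⟩⟩
  unfold cubeWalls
  rw [mem_nodes_cubeVertex, this]
  by_cases h : (fun s => U₀.perm (W.node 0 i s)) ∈ nodeSet U₀.perm <;> cases J i <;> simp [h]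

/-- A cube crosses the wall of a node exactly when one of its cells has that node, in which case the
cell is unique. The constant `c` records whether `U` and `U₀` lie on different sides. -/
theorem isWallFamily_cubeWalls {w : List Unit} {d : ℕ} (W : Thin thompson d)
    (U₀ : DiagClass thompson w W.top) : IsWallFamily (cubeWalls W U₀) := by
  classical
  intro k Φ U
  let τ : Fin d → ℕ → ℕ × ℕ := fun i s => U₀.perm (W.node 0 i s)
  have hτ : ∀ i, ∃ o : Option (Fin k), ∀ j, o = some j ↔ τ i = fun s => U.perm (Φ.node 0 j s) := by
    intro i
    by_cases h : ∃ j, τ i = fun s => U.perm (Φ.node 0 j s)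
    · obtain ⟨j, hj⟩ := h
      refine ⟨some j, fun l => ⟨?_, fun hl => ?_⟩⟩
      · rintro ⟨⟩
        exact hj
      · rw [perm_comp_node_injective Φ U (hj.symm.trans hl)]
    · push Not at h
      exact ⟨none, fun j => by simpa using h j⟩
  choose κ hκ using hτ
  refine ⟨κ, fun i => decide (Xor (τ i ∈ nodeSet U.perm) (τ i ∈ nodeSet U₀.perm)), ?_, ?_⟩
  · intro i j l hi hj
    exact perm_comp_node_injective W U₀ (((hκ i l).1 hi).trans ((hκ j l).1 hj).symm)
  · intro J i
    change decide (Xor (τ i ∈ (cubeVertex Φ U J).nodes) (τ i ∈ _)) = _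
    simp only [mem_nodes_cubeVertex]
    change decide (Xor (Xor (τ i ∈ _) (∃ j, J j = true ∧ τ i = _)) (τ i ∈ _)) = _
    simp only [← hκ]
    cases κ i with
    | none => by_cases h₁ : τ i ∈ nodeSet U.perm <;> simp [h₁]
    | some l =>
      by_cases h₁ : τ i ∈ nodeSet U.perm <;> by_cases h₂ : τ i ∈ nodeSet U₀.perm <;>
        cases h₃ : J l <;> simp [h₁, h₂, h₃]

/-! ### Columns -/

/-- The interchange law in the form used for the example: diagrams cut into matching columns are
composed column by column. -/
theorem Mor.prod_comp_prod {c : Prop} {L M : List (Mor P c)}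
    (h : List.Forall₂ (fun a b => a.tgt = b.src) L M) :
    L.prod.tgt = M.prod.src ∧ L.prod.comp M.prod = (List.zipWith Mor.comp L M).prod := by
  induction h with
  | nil => exact ⟨rfl, id_comp rfl⟩
  | cons h _ ih =>
    simp only [List.prod_cons, List.zipWith_cons_cons, tgt_mul, src_mul, h, ih.1, true_and]
    rw [mul_comp_mul h ih.1, ih.2]

/-- The juxtaposition of `f 0, …, f (n - 1)`. -/
def Mor.block {c : Prop} (n : ℕ) (f : ℕ → Mor P c) : Mor P c :=
  ((List.range n).map f).prod

section Block

variable {c : Prop}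

theorem Mor.block_zero (f : ℕ → Mor P c) : block 0 f = 1 := rfl

theorem Mor.block_succ (n : ℕ) (f : ℕ → Mor P c) : block (n + 1) f = block n f * f n := by
  simp [block, List.range_succ]

theorem Mor.block_succ' (n : ℕ) (f : ℕ → Mor P c) :
    block (n + 1) f = f 0 * block n fun i => f (i + 1) := by
  simp [block, List.range_succ_eq_map, Function.comp_def]

theorem Mor.block_congr {n : ℕ} {f g : ℕ → Mor P c} (h : ∀ i < n, f i = g i) :
    block n f = block n g := by
  rw [block, block, List.map_congr_left]
  simpa using h

theorem Mor.block_comp_block {n : ℕ} {f g : ℕ → Mor P c} (h : ∀ i < n, (f i).tgt = (g i).src) :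
    (block n f).tgt = (block n g).src ∧
      (block n f).comp (block n g) = block n fun i => (f i).comp (g i) := by
  induction n with
  | zero => exact ⟨rfl, id_comp rfl⟩
  | succ n ih =>
    obtain ⟨h₁, h₂⟩ := ih fun i hi => h i (by omega)
    rw [block_succ, block_succ, block_succ, tgt_mul, src_mul, h₁, h n (by omega),
      mul_comp_mul h₁ (h n (by omega)), h₂]
    exact ⟨rfl, rfl⟩

theorem Mor.inv_block (n : ℕ) (f : ℕ → Mor P c) : (block n f).inv = block n fun i => (f i).inv := by
  induction n with
  | zero => rfl
  | succ n ih => rw [block_succ, inv_mul, ih, block_succ]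

end Block

namespace Mor

/-! ### Diagrams over `⟨x | x = xx⟩` -/

/-- A plain edge. -/
def edge (c : Prop) : Mor thompson c := mk c (Arr.id (xs 1))

/-- The cell `C(x, xx)`. -/
def split (c : Prop) : Mor thompson c := mk c (Arr.cell (xs 1) (xs 2) (Or.inl rfl))

/-- The cell `C(xx, x)`. -/
def merge (c : Prop) : Mor thompson c := mk c (Arr.cell (xs 2) (xs 1) (Or.inr rfl))

/-- A cell `C(x, xx)` or its top edge. -/
def splitIf (c : Prop) (b : Bool) : Mor thompson c := if b then split c else edge c

/-- A cell `C(xx, x)` or its top edges. -/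
def mergeIf (c : Prop) (b : Bool) : Mor thompson c := if b then merge c else edge c * edge c

variable {c : Prop}

theorem edge_mul_edge : edge c * edge c = mk c (Arr.id (xs 2)) := rfl

theorem edge_comp {a : Mor thompson c} (h : a.src = xs 1) : (edge c).comp a = a := id_comp h

theorem comp_edge {a : Mor thompson c} (h : a.tgt = xs 1) : a.comp (edge c) = a := comp_id h

theorem edges_comp {a : Mor thompson c} (h : a.src = xs 2) : (edge c * edge c).comp a = a :=
  id_comp h

theorem comp_edges {a : Mor thompson c} (h : a.tgt = xs 2) : a.comp (edge c * edge c) = a :=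
  comp_id h

theorem mk_cell_comp_inv {u v : List Unit} (h : (u, v) ∈ thompson.rel) (hc : c) :
    (mk c (Arr.cell u v h)).comp (mk c (Arr.cell v u (thompson.symm _ _ h))) =
      mk c (Arr.id u) := by
  rw [← mk_comp, Arr.comp_eq (by rfl)]
  exact Quot.sound ⟨rfl, rfl, Or.inr ⟨hc, Cancel.dipole [] [] ⟨[], u, v, [], h⟩⟩⟩

theorem split_comp_merge (hc : c) : (split c).comp (merge c) = edge c :=
  mk_cell_comp_inv (Or.inl rfl) hc

theorem merge_comp_split (hc : c) : (merge c).comp (split c) = edge c * edge c :=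
  mk_cell_comp_inv (Or.inr rfl) hc

theorem src_splitIf (b : Bool) : (splitIf c b).src = xs 1 := by cases b <;> rfl

theorem src_mergeIf (b : Bool) : (mergeIf c b).src = xs 2 := by cases b <;> rfl

theorem split_comp_mergeIf (hc : c) (b : Bool) : (split c).comp (mergeIf c !b) = splitIf c b := by
  cases b
  · exact split_comp_merge hc
  · exact comp_edges rfl

theorem merge_comp_splitIf (hc : c) (b : Bool) : (merge c).comp (splitIf c !b) = mergeIf c b := by
  cases b
  · exact merge_comp_split hc
  · exact comp_edge rfl

/-! ### Trees -/

theorem src_edge : (edge c).src = xs 1 := rfl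
theorem tgt_edge : (edge c).tgt = xs 1 := rfl
theorem src_split : (split c).src = xs 1 := rfl
theorem tgt_split : (split c).tgt = xs 2 := rfl
theorem src_merge : (merge c).src = xs 2 := rfl

theorem xs_add (a b : ℕ) : xs a ++ xs b = xs (a + b) := by simp [xs]

theorem block_edge (n : ℕ) : block n (fun _ => edge c) = mk c (Arr.id (xs n)) := by
  induction n with
  | zero => rfl
  | succ n ih => rw [block_succ, ih, edge, id_mul_id, xs_add]

theorem block_edges (n : ℕ) : block n (fun _ => edge c * edge c) = mk c (Arr.id (xs (2 * n))) := by
  induction n with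
  | zero => rfl
  | succ n ih => rw [block_succ, ih, edge_mul_edge, id_mul_id, xs_add, Nat.mul_succ]

/-- The left comb with `n + 2` leaves. -/
noncomputable def leftComb (c : Prop) : ℕ → Mor thompson c
  | 0 => split c
  | n + 1 => (split c).comp (leftComb c n * edge c)

theorem src_leftComb (n : ℕ) : (leftComb c n).src = xs 1 := by
  cases n with
  | zero => rfl
  | succ n => exact src_comp _ _

theorem tgt_leftComb (n : ℕ) : (leftComb c n).tgt = xs (n + 2) := by
  induction n with
  | zero => rfl
  | succ n ih =>
    rw [leftComb, tgt_comp, tgt_mul, ih, tgt_edge, xs_add]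
    rw [src_mul, src_leftComb]
    rfl

/-- A comb lengthened at its lowest, first leaf is the same as a comb lengthened at the root, since
the first leaf lies in the left subtree throughout. -/
theorem leftComb_comp_split (n : ℕ) :
    (leftComb c n).comp (split c * mk c (Arr.id (xs (n + 1)))) =
      (split c).comp (leftComb c n * edge c) := by
  induction n with
  | zero => rfl
  | succ n ih =>
    have e : split c * mk c (Arr.id (xs (n + 1 + 1))) =
        split c * mk c (Arr.id (xs (n + 1))) * edge c := by
      rw [mul_assoc, edge, id_mul_id, xs_add]
    have h : (leftComb c n).tgt = (split c * mk c (Arr.id (xs (n + 1)))).src := by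
      rw [tgt_leftComb, src_mul, src_split, src_mk]
      exact (congrArg xs (by omega)).trans (xs_add 1 (n + 1)).symm
    conv_lhs => rw [leftComb]
    rw [e, comp_assoc, mul_comp_mul h rfl, ih, comp_edge rfl]
    · rfl
    · rw [src_mul, src_leftComb]
      rfl
    · rw [tgt_mul, src_mul, h]
      rfl

/-- The last leaf hangs directly from the root, so the additional split there stays to the right of
the lengthened comb. The right-hand side is the left part of `g U`. -/
theorem leftComb_comp_split_split (n : ℕ) :
    (leftComb c n).comp (split c * mk c (Arr.id (xs n)) * split c) =
      (split c).comp (leftComb c n * split c) := by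
  have h₁ : (leftComb c n).tgt = (split c * mk c (Arr.id (xs (n + 1)))).src := by
    rw [tgt_leftComb, src_mul, src_split, src_mk]
    exact (congrArg xs (by omega)).trans (xs_add 1 (n + 1)).symm
  have e₁ : split c * mk c (Arr.id (xs n)) * split c =
      (split c * mk c (Arr.id (xs (n + 1)))).comp (mk c (Arr.id (xs (n + 2))) * split c) := by
    have e : split c * mk c (Arr.id (xs (n + 1))) = split c * mk c (Arr.id (xs n)) * edge c := by
      rw [mul_assoc, edge, id_mul_id, xs_add]
    have h : (split c * mk c (Arr.id (xs n))).tgt = xs (n + 2) := by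
      rw [tgt_mul, tgt_split, tgt_mk]
      exact (xs_add 2 n).trans (congrArg xs (by omega))
    rw [e, mul_comp_mul (by exact h) rfl, comp_id h, edge_comp rfl]
  rw [e₁, ← comp_assoc h₁, leftComb_comp_split, comp_assoc, mul_comp_mul, comp_id, edge_comp rfl]
  · exact tgt_leftComb n
  · exact tgt_leftComb n
  · rfl
  · rw [src_mul, src_leftComb]
    rfl
  · rw [tgt_mul, src_mul, tgt_leftComb]
    rfl
  · rw [tgt_mul, src_mul, tgt_split, tgt_mk, src_mk, src_split]
    change xs 2 ++ xs (n + 1) = xs (n + 2) ++ xs 1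
    rw [xs_add, xs_add]
    exact congrArg xs (by omega)

/-- The tree obtained by splitting an edge, and splitting again both halves, the right half
recursively. -/
noncomputable def rightTree (c : Prop) : ℕ → Mor thompson c
  | 0 => split c
  | n + 1 => (split c).comp (split c * rightTree c n)

theorem src_rightTree (n : ℕ) : (rightTree c n).src = xs 1 := by
  cases n with
  | zero => rfl
  | succ n => exact src_comp _ _

theorem tgt_rightTree (n : ℕ) : (rightTree c n).tgt = xs (2 * n + 2) := by
  induction n with
  | zero => rfl
  | succ n ih =>
    rw [rightTree, tgt_comp, tgt_mul, ih, tgt_split, xs_add]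
    · exact congrArg xs (by omega)
    · rw [src_mul, src_rightTree]
      rfl

/-- The last four leaves come from two sibling splits at the deepest level of the recursion; merging
the two pairs removes that level. -/
theorem rightTree_comp_merge (hc : c) (n : ℕ) :
    (rightTree c (n + 1)).comp (mk c (Arr.id (xs (2 * n))) * (merge c * merge c)) =
      rightTree c n := by
  induction n with
  | zero =>
    change ((split c).comp (split c * split c)).comp (1 * (merge c * merge c)) = _
    rw [one_mul, comp_assoc rfl rfl, mul_comp_mul rfl rfl, split_comp_merge hc]
    exact comp_edges rfl
  | succ n ih =>
    have e : mk c (Arr.id (xs (2 * (n + 1)))) * (merge c * merge c) =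
        edge c * edge c * (mk c (Arr.id (xs (2 * n))) * (merge c * merge c)) := by
      rw [edge_mul_edge, ← mul_assoc (mk c (Arr.id (xs 2))), id_mul_id, xs_add, Nat.mul_succ,
        Nat.add_comm]
    have h : (rightTree c (n + 1)).tgt =
        (mk c (Arr.id (xs (2 * n))) * (merge c * merge c)).src := by
      rw [tgt_rightTree, src_mul, src_mul, src_merge, xs_add, src_mk]
      change _ = xs (2 * n) ++ xs _
      rw [xs_add]
      exact congrArg xs (by omega)
    conv_lhs => rw [rightTree]
    rw [e, comp_assoc, mul_comp_mul rfl h, ih, comp_edges rfl]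
    · rfl
    · rw [src_mul, src_rightTree]
      rfl
    · rw [tgt_mul, src_mul, h]
      rfl

/-- The two merges in `g` cancel the root split of the right tree and then the split of its left
half, which exposes the smaller tree. -/
theorem merge_merge_comp_rightTree (hc : c) (n : ℕ) :
    ((merge c * edge c).comp (merge c)).comp (rightTree c (n + 1)) =
      edge c * edge c * rightTree c n := by
  have h : (split c).tgt = (split c * rightTree c n).src := by
    rw [src_mul, src_rightTree]
    rfl
  rw [rightTree, comp_assoc rfl (by rw [src_comp]; rfl), ← comp_assoc (a := merge c) rfl h,
    merge_comp_split hc, edges_comp (by rw [← h]; rfl), mul_comp_mul rfl (by exact (src_rightTree n).symm),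
    merge_comp_split hc, edge_comp (src_rightTree n)]

/-- The diagram `g`. -/
def gMor (c : Prop) : Mor thompson c := mk c ⟨_, _, gDerivation.steps, gDerivation.valid⟩

/-- The splits act over the first edge only and the merges over the last three of the five edges, so
`g` is a tree with three leaves above an inverted one. -/
theorem gMor_eq : gMor c = ((split c).comp (edge c * split c) * (edge c * edge c)).comp
    (edge c * edge c * (merge c * edge c).comp (merge c)) := by
  have e : ((split c).comp (edge c * split c) * (edge c * edge c)) =
      (split c * (edge c * edge c)).comp (edge c * split c * (edge c * edge c)) := by
    rw [mul_comp_mul rfl rfl, comp_edges rfl]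
  have e' : edge c * edge c * (merge c * edge c).comp (merge c) =
      (edge c * edge c * (merge c * edge c)).comp (edge c * edge c * merge c) := by
    rw [mul_comp_mul rfl rfl, comp_edges rfl]
  rw [e, e']
  unfold edge split merge
  simp only [← mk_mul, ← mk_comp]
  have key : ∀ a b d f x : Arr thompson, a.tgt = b.src → b.tgt = d.src → d.tgt = f.src →
      x.src = a.src → x.tgt = f.tgt → x.steps = a.steps ++ b.steps ++ (d.steps ++ f.steps) →
      x = (a.comp b).comp (d.comp f) := by
    intro a b d f x h₁ h₂ h₃ h₄ h₅ h₆
    rw [Arr.comp_eq h₁, Arr.comp_eq h₃, Arr.comp_eq (by exact h₂)]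
    exact Arr.ext h₄ h₅ h₆
  exact congrArg (mk c) (key _ _ _ _ _ rfl rfl rfl rfl rfl rfl)

/-- The diagram `U` with top label `xxx`. -/
noncomputable def tree (c : Prop) (n : ℕ) : Mor thompson c :=
  leftComb c n * (edge c * rightTree c (n + 1))

theorem src_tree (n : ℕ) : (tree c n).src = xs 3 := by
  rw [tree, src_mul, src_mul, src_leftComb, src_rightTree]
  rfl

theorem gMor_comp_tree (hc : c) (n : ℕ) : (gMor c).comp (tree c n) =
    (split c).comp (leftComb c n * split c) * (edge c * rightTree c n) := by
  have h₁ : (edge c * split c).tgt = (leftComb c n * (edge c * edge c)).src := by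
    rw [src_mul, src_leftComb]; rfl
  have h₂ : (rightTree c n).src = xs 1 := src_rightTree n
  have h₃ : (leftComb c n).src = xs 1 := src_leftComb n
  rw [gMor_eq, tree, ← mul_assoc (leftComb c n), comp_assoc,
    mul_comp_mul (a := edge c * edge c), merge_merge_comp_rightTree hc, edges_comp]
  · have e : leftComb c n * edge c * (edge c * edge c * rightTree c n) =
        leftComb c n * (edge c * edge c) * (edge c * rightTree c n) := by
      simp only [mul_assoc]
    rw [e, mul_comp_mul, comp_assoc rfl h₁, mul_comp_mul (by exact h₃.symm) rfl, edge_comp h₃,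
      comp_edges rfl, mul_comp_mul rfl (by exact h₂.symm), edge_comp rfl,
      edge_comp h₂]
    · rw [tgt_comp rfl]
      exact h₁
    · rw [src_mul, h₂]
      rfl
  · rw [src_mul, h₃]; rfl
  · rw [src_mul, h₃]; rfl
  · rw [src_rightTree, tgt_comp rfl]; rfl
  · rw [tgt_mul, src_mul, tgt_comp rfl, src_comp]; rfl
  · rw [src_mul, src_mul, h₃, src_rightTree, tgt_mul, tgt_comp rfl]
    rfl

/-- This is `U ∘ (U⁻¹ g U) = g U`: the comb side needs two splits and the right tree two merges, all
attached directly to the bottom path of `U`. -/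
theorem tree_comp (hc : c) (n : ℕ) : (tree c n).comp
    (split c * mk c (Arr.id (xs n)) * split c *
      (edge c * (mk c (Arr.id (xs (2 * n))) * (merge c * merge c)))) =
    (gMor c).comp (tree c n) := by
  rw [gMor_comp_tree hc, tree, mul_comp_mul, mul_comp_mul rfl, rightTree_comp_merge hc,
    edge_comp rfl, leftComb_comp_split_split]
  · rw [tgt_rightTree, src_mul, src_mul, src_merge, xs_add, src_mk]
    change _ = xs (2 * n) ++ xs _
    rw [xs_add]
    exact congrArg xs (by omega)
  · rw [tgt_leftComb, src_mul, src_mul, src_split, src_mk]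
    change _ = xs 1 ++ xs n ++ xs 1
    rw [xs_add, xs_add]
    exact congrArg xs (by omega)
  · rw [tgt_mul, src_mul, tgt_rightTree, src_mul, src_mul, src_merge, xs_add, src_mk]
    change _ = xs 1 ++ (xs (2 * n) ++ xs _)
    rw [xs_add]
    exact congrArg (xs 1 ++ ·) (congrArg xs (by omega))

end Mor

/-! ### Parts of thin diagrams over `⟨x | x = xx⟩` as products of columns -/

namespace Thin

/-- Add `n` cells `C(x, xx)` on the left. -/
def splits {k : ℕ} (n : ℕ) (Φ : Thin thompson k) : Thin thompson (k + n) :=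
  match n with
  | 0 => Φ
  | n + 1 => cell (xs 1) (xs 2) (Or.inl rfl) (splits n Φ)

/-- Add `n` cells `C(xx, x)` on the left. -/
def merges {k : ℕ} (n : ℕ) (Φ : Thin thompson k) : Thin thompson (k + n) :=
  match n with
  | 0 => Φ
  | n + 1 => cell (xs 2) (xs 1) (Or.inr rfl) (merges n Φ)

/-- Add `n` plain edges on the left. -/
def edges {k : ℕ} (n : ℕ) (Φ : Thin thompson k) : Thin thompson k :=
  match n with
  | 0 => Φ
  | n + 1 => edge () (edges n Φ)

/-- The part of a thin diagram given by a sequence of bits. -/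
def mor {k : ℕ} (c : Prop) (Φ : Thin thompson k) (f : ℕ → Bool) : Mor thompson c :=
  Mor.mk c (Φ.arr fun i => f i)

theorem mor_nil (c : Prop) (f : ℕ → Bool) : (nil : Thin thompson 0).mor c f = 1 := rfl

theorem mor_edge {k : ℕ} (c : Prop) (a : Unit) (Φ : Thin thompson k) (f : ℕ → Bool) :
    (edge a Φ).mor c f = Mor.edge c * Φ.mor c f := by
  rw [mor, arr_edge]
  rfl

theorem mor_split {k : ℕ} (c : Prop) (h) (Φ : Thin thompson k) (f : ℕ → Bool) :
    (cell (xs 1) (xs 2) h Φ).mor c f = Mor.splitIf c (f 0) * Φ.mor c fun i => f (i + 1) := by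
  rw [mor, arr_cell, Mor.mk_mul, Fin.val_zero]
  cases f 0 <;> rfl

theorem mor_merge {k : ℕ} (c : Prop) (h) (Φ : Thin thompson k) (f : ℕ → Bool) :
    (cell (xs 2) (xs 1) h Φ).mor c f = Mor.mergeIf c (f 0) * Φ.mor c fun i => f (i + 1) := by
  rw [mor, arr_cell, Mor.mk_mul, Fin.val_zero]
  cases f 0 <;> rfl

theorem mor_splits {k : ℕ} (c : Prop) (n : ℕ) (Φ : Thin thompson k) (f : ℕ → Bool) :
    (splits n Φ).mor c f =
      Mor.block n (fun i => Mor.splitIf c (f i)) * Φ.mor c fun i => f (i + n) := by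
  induction n generalizing f with
  | zero => exact (one_mul _).symm
  | succ n ih =>
    refine (mor_split c _ _ f).trans ?_
    rw [ih, Mor.block_succ', mul_assoc]
    rfl

theorem mor_merges {k : ℕ} (c : Prop) (n : ℕ) (Φ : Thin thompson k) (f : ℕ → Bool) :
    (merges n Φ).mor c f =
      Mor.block n (fun i => Mor.mergeIf c (f i)) * Φ.mor c fun i => f (i + n) := by
  induction n generalizing f with
  | zero => exact (one_mul _).symm
  | succ n ih =>
    refine (mor_merge c _ _ f).trans ?_
    rw [ih, Mor.block_succ', mul_assoc]
    rfl

theorem mor_edges {k : ℕ} (c : Prop) (n : ℕ) (Φ : Thin thompson k) (f : ℕ → Bool) :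
    (edges n Φ).mor c f = Mor.block n (fun _ => Mor.edge c) * Φ.mor c f := by
  induction n with
  | zero => exact (one_mul _).symm
  | succ n ih => rw [edges, mor_edge, ih, Mor.block_succ', mul_assoc]

/-! ### Positions of cells and greatest lower bounds -/

/-- The positions in the top path of the cells of a thin diagram, if the top path starts at `o`. -/
def offset : {k : ℕ} → Thin thompson k → ℕ → ℕ → ℕ
  | _, nil, _ => fun _ => 0
  | _, edge _ Φ, o => Φ.offset (o + 1)
  | _, cell u _ _ Φ, o => fun i => if i = 0 then o else Φ.offset (o + u.length) (i - 1)

theorem offset_splits {k : ℕ} (n : ℕ) (Φ : Thin thompson k) (o i : ℕ) :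
    (splits n Φ).offset o i = if i < n then o + i else Φ.offset (o + n) (i - n) := by
  induction n generalizing o i with
  | zero => rfl
  | succ n ih =>
    cases i with
    | zero => simp [splits, offset]
    | succ i =>
      simp [splits, offset, ih, xs]
      congr 1 <;> ring_nf

theorem offset_merges {k : ℕ} (n : ℕ) (Φ : Thin thompson k) (o i : ℕ) :
    (merges n Φ).offset o i = if i < n then o + 2 * i else Φ.offset (o + 2 * n) (i - n) := by
  induction n generalizing o i with
  | zero => rfl
  | succ n ih =>
    cases i with
    | zero => simp [merges, offset]
    | succ i =>
      simp [merges, offset, ih, xs]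
      congr 1 <;> ring_nf

theorem offset_edges {k : ℕ} (n : ℕ) (Φ : Thin thompson k) (o i : ℕ) :
    (edges n Φ).offset o i = Φ.offset (o + n) i := by
  induction n generalizing o with
  | zero => rfl
  | succ n ih => rw [edges, offset, ih, Nat.add_right_comm, Nat.add_assoc]

theorem node_zero_fst {k : ℕ} (Φ : Thin thompson k) (o : ℕ) (i : Fin k) :
    (Φ.node o i 0).1 = Φ.offset o i := by
  induction Φ generalizing o with
  | nil => exact i.elim0
  | edge a Φ ih => exact ih (o + 1) i
  | cell u v h Φ ih =>
    refine Fin.cases ?_ (fun i => ?_) i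
    · exact cellNode_zero_fst u o
    · exact (ih (o + u.length) i).trans (by simp [offset])

theorem stepsPerm_eq_of_mk_eq {c : Prop} {a b : Arr thompson} (h : Mor.mk c a = Mor.mk c b) :
    stepsPerm a.steps = stepsPerm b.steps :=
  congrArg (Quot.lift (fun a : Arr thompson => stepsPerm a.steps) fun _ _ h =>
    h.2.2.elim Exchange.stepsPerm_eq fun h => h.2.stepsPerm_eq) h

theorem right_of_xor_iff {p a b : Prop} (h : Xor p a ↔ Xor p b) (hb : b) : a := by
  unfold Xor at h
  tauto

/-- A criterion for a part of a thin diagram `Φ` to be the greatest lower bound of `Φ` and of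
another thin diagram. -/
theorem isGlb_part {k l : ℕ} (Φ : Thin thompson k) (Ξ : Thin thompson l) (hu : Ξ.top = Φ.top)
    {x : List Unit} (h : IsDerivation (Ξ.steps [] fun _ => true) Φ.top x) (T : Fin k → Bool)
    (F : Mor thompson False) (hF : Φ.word T = F.src)
    (hTF : (Mor.mk False (Φ.arr T)).comp F = Mor.mk False (Ξ.arr fun _ => true))
    (hoff : ∀ (i : Fin k) (j : Fin l), Φ.offset 0 i = Ξ.offset 0 j → T i = true) :
    (Φ.part T).IsGlb (Quot.mk _ ⟨_, h⟩) Φ.full := by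
  have hx : x = Ξ.word fun _ => true := by
    have := Ξ.steps_valid [] fun _ => true
    exact h.target_unique (by rw [← hu]; exact this)
  subst hx
  have hΞ : Ξ.arr (fun _ => true) = ⟨Φ.top, _, _, h⟩ := Arr.ext hu rfl rfl
  refine ⟨?_, ?_, ?_⟩
  · induction F using Quot.ind with | _ f
    obtain ⟨u, v, m, hm⟩ := f
    change Φ.word T = u at hF
    subst hF
    change (Mor.mk False (Φ.arr T)).comp (Mor.mk False _) = _ at hTF
    have hv : v = Ξ.word fun _ => true := by
      have := congrArg Mor.tgt hTF
      rwa [Mor.tgt_comp (by rfl)] at this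
    subst hv
    refine ⟨Quot.mk _ ⟨m, hm⟩, diagram_eq_of_mor_eq (d := Derivation.comp
      ⟨_, Φ.steps_valid [] T⟩ ⟨m, hm⟩) (e := ⟨_, h⟩) ?_⟩
    rw [← Mor.mk_comp, Arr.comp_eq (by rfl)] at hTF
    exact hTF.trans (congrArg _ hΞ)
  · exact part_isPrefix Φ rfl (J := T) (K := fun _ => true) (fun _ _ => rfl)
      ⟨_, Φ.steps_valid [] T⟩ ⟨_, Φ.steps_valid [] _⟩ rfl rfl
  · rintro z H ⟨F₁, h₁⟩ ⟨F₂, h₂⟩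
    induction H using Quot.ind with | _ e
    induction F₁ using Quot.ind with | _ f₁
    induction F₂ using Quot.ind with | _ f₂
    obtain ⟨J₁, hJ₁⟩ := Ξ.exists_part_of_prefix False hu e f₁ _ h h₁
    obtain ⟨J₂, hJ₂⟩ := Φ.exists_part_of_prefix False rfl e f₂ _ (Φ.steps_valid [] _) h₂
    refine part_isPrefix Φ rfl (J := J₂) (K := T) (fun i hi => ?_) e ⟨_, Φ.steps_valid [] T⟩ hJ₂ rfl
    -- The common prefix is both a part of `Φ` and a part of `Ξ`, with one permutation and hence one
    -- node set. Each cell it uses in `Φ` therefore shares its node, and so its position, with a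
    -- cell of `Ξ`.
    have h₃ : stepsPerm (Φ.steps [] J₂) = stepsPerm (Ξ.steps [] J₁) :=
      stepsPerm_eq_of_mk_eq (hJ₂.symm.trans hJ₁)
    have h₄ := mem_nodeSet_steps Φ 1 [] J₂ (Φ.node 0 i)
    rw [h₃, mem_nodeSet_steps] at h₄
    have h₅ : ∃ j, J₂ j = true ∧ Φ.node 0 i = fun s =>
        (1 : Equiv.Perm (ℕ × ℕ)) (Φ.node ([] : List Unit).length j s) := ⟨i, hi, rfl⟩
    have h₆ : ∃ j, J₁ j = true ∧ Φ.node 0 i = fun s =>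
        (1 : Equiv.Perm (ℕ × ℕ)) (Ξ.node ([] : List Unit).length j s) := right_of_xor_iff h₄ h₅
    obtain ⟨j, -, hj⟩ := h₆
    refine hoff i j ?_
    rw [← node_zero_fst, ← node_zero_fst, hj]
    rfl

end Thin

/-! ### The diagrams of the example -/

section Example

variable (N : ℕ)

/-- The thin diagram `Φ`. -/
def exPhi : Thin thompson (0 + (N + 1) + (N + 1)) :=
  .edge () (.edge () (.splits (N + 1) (.edge () (.edge () (.edge ()
    (.merges (N + 1) (.edge () (.edge () .nil))))))))

/-- The thin diagram `U⁻¹ g U`. -/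
def exTheta : Thin thompson 4 :=
  .splits 1 (.edges (N + 1) (.splits 1 (.edge () (.edges (2 * (N + 1)) (.merges 2 .nil)))))

/-- The inverse of the diagram `W₁`. -/
def exXi : Thin thompson (0 + 2 + N + 1 + N + 1) :=
  .merges 1 (.edge () (.splits N (.merges 1 (.edge () (.edge () (.edge ()
    (.merges N (.splits 2 .nil))))))))

/-- The thin diagram `W`. -/
def exW : Thin thompson (0 + 2 + N + 1 + 1 + N + 2) :=
  .splits 2 (.merges N (.splits 1 (.edge () (.merges 1 (.splits N (.merges 2 .nil))))))

/-- The complement of `T`. -/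
def bitsT' (i : ℕ) : Bool := !(decide (i = N) || decide (i = N + (N + 1)))

/-- The complement of `L`. -/
def bitsL' (i : ℕ) : Bool := decide (i = 0) || decide (i = N + 1)

/-- The vertex `U Φ_J` is the vertex `U₀ W_K` for this `K`. -/
def bitsA (f : ℕ → Bool) (i : ℕ) : Bool :=
  if i < 2 then false else if i < N + 2 then !f (i - 2) else if i = N + 2 then f N
  else if i = N + 3 then false else if i < N + (N + 4) then !f (i - 3)
  else if i = N + (N + 4) then f (N + (N + 1)) else false

/-- The vertex `g U Φ_J` is the vertex `U₀ W_K` for this `K`. -/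
def bitsB (f : ℕ → Bool) (i : ℕ) : Bool :=
  if i = 0 then true else if i = 1 then f 0 else if i < N + 2 then !f (i - 1)
  else if i = N + 2 then true else if i = N + 3 then f (N + 1)
  else if i < N + (N + 4) then !f (i - 2) else true

variable (c : Prop) (f : ℕ → Bool)

open Mor

theorem mor_exPhi : (exPhi N).mor c f =
    [edge c, edge c, block N fun i => splitIf c (f i), splitIf c (f N), edge c, edge c * edge c,
      block N fun i => mergeIf c (f (i + (N + 1))), mergeIf c (f (N + (N + 1))),
      edge c * edge c].prod := by
  simp [exPhi, Thin.mor_edge, Thin.mor_splits, Thin.mor_merges, Thin.mor_nil, block_succ, mul_assoc]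

/-- The same diagram cut along different columns: here the first cell of each half is separated
instead of the last, as needed below `exTheta`, whose effect is to shift the cells by one place. -/
theorem mor_exPhi' : (exPhi N).mor c f =
    [edge c * edge c, splitIf c (f 0), block N fun i => splitIf c (f (i + 1)), edge c * edge c,
      edge c, mergeIf c (f (N + 1)), block N fun i => mergeIf c (f (i + 1 + (N + 1))),
      edge c, edge c].prod := by
  simp [exPhi, Thin.mor_edge, Thin.mor_splits, Thin.mor_merges, Thin.mor_nil, block_succ',
    mul_assoc]

theorem block_two_mul_edge : block (2 * N) (fun _ => edge c) = block N fun _ => edge c * edge c := by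
  rw [block_edge, block_edges]

theorem mor_exTheta : (exTheta N).mor c (fun _ => true) =
    [split c, edge c, block N fun _ => edge c, split c, edge c, edge c * edge c,
      block N fun _ => edge c * edge c, merge c, merge c].prod := by
  simp [exTheta, Thin.mor_edge, Thin.mor_splits, Thin.mor_edges, Thin.mor_merges, Thin.mor_nil,
    block_two_mul_edge, block_succ', block_zero, mul_assoc, splitIf, mergeIf]

theorem mor_exXi : (exXi N).mor c (fun _ => true) =
    [merge c, edge c, block N fun _ => split c, merge c, edge c, edge c * edge c,
      block N fun _ => merge c, split c, split c].prod := by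
  simp [exXi, Thin.mor_edge, Thin.mor_splits, Thin.mor_merges, Thin.mor_nil,
    block_succ', block_zero, mul_assoc, splitIf, mergeIf]

theorem mor_exW : (exW N).mor c f =
    [splitIf c (f 0), splitIf c (f 1), block N fun i => mergeIf c (f (i + 2)), splitIf c (f (N + 2)),
      edge c, mergeIf c (f (N + 3)), block N fun i => splitIf c (f (i + (N + 4))),
      mergeIf c (f (N + (N + 4))), mergeIf c (f (N + (N + 5)))].prod := by
  simp [exW, Thin.mor_edge, Thin.mor_splits, Thin.mor_merges, Thin.mor_nil,
    block_succ', block_zero, mul_assoc]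
  simp only [Nat.add_left_comm, Nat.add_comm, Nat.add_assoc, Nat.reduceAdd]

variable {c}

theorem edge_comp_edge : (edge c).comp (edge c) = edge c := edge_comp rfl

theorem edge_comp_split : (edge c).comp (split c) = split c := edge_comp rfl

theorem edge_comp_splitIf (b : Bool) : (edge c).comp (splitIf c b) = splitIf c b :=
  edge_comp (src_splitIf _)

theorem merge_comp_edge : (merge c).comp (edge c) = merge c := comp_edge rfl

theorem edges_comp_edges : (edge c * edge c).comp (edge c * edge c) = edge c * edge c :=
  edges_comp rfl

theorem edges_comp_merge : (edge c * edge c).comp (merge c) = merge c := edges_comp rfl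

theorem edges_comp_mergeIf (b : Bool) : (edge c * edge c).comp (mergeIf c b) = mergeIf c b :=
  edges_comp (src_mergeIf _)

theorem split_comp_edges : (split c).comp (edge c * edge c) = split c := comp_edges rfl

theorem bitsT'_of_lt {i : ℕ} (h : i < N) : bitsT' N i = true := by
  simp [bitsT']; omega

theorem bitsT'_left : bitsT' N N = false := by simp [bitsT']

theorem bitsT'_add {i : ℕ} (h : i < N) : bitsT' N (i + (N + 1)) = true := by
  simp [bitsT']; omega

theorem bitsT'_right : bitsT' N (N + (N + 1)) = false := by simp [bitsT']

theorem mor_exPhi_bitsT' : (exPhi N).mor c (bitsT' N) =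
    [edge c, edge c, block N fun _ => split c, edge c, edge c, edge c * edge c,
      block N fun _ => merge c, edge c * edge c, edge c * edge c].prod := by
  rw [mor_exPhi, bitsT'_left, bitsT'_right,
    block_congr (f := fun i => splitIf c (bitsT' N i)) (g := fun _ => split c),
    block_congr (f := fun i => mergeIf c (bitsT' N (i + (N + 1)))) (g := fun _ => merge c)]
  · rfl
  · intro i hi
    simp only [bitsT'_add N hi]
    rfl
  · intro i hi
    simp only [bitsT'_of_lt N hi]
    rfl

theorem tgt_splitIf_mergeIf (b : Bool) : (split c).tgt = (mergeIf c b).src := by cases b <;> rfl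

theorem tgt_merge_splitIf (b : Bool) : (merge c).tgt = (splitIf c b).src := by cases b <;> rfl

theorem tgt_edge_splitIf (b : Bool) : (edge c).tgt = (splitIf c b).src := by cases b <;> rfl

theorem tgt_edges_mergeIf (b : Bool) : (edge c * edge c).tgt = (mergeIf c b).src := by
  cases b <;> rfl

/-- Column by column, a cell already attached in `Φ_{T'}` is undone by the opposite cell of `W`
unless it is wanted; this accounts for the negated bits. The cells of `T` are attached directly. -/
theorem exPhi_comp_exW (hc : c) :
    ((exPhi N).mor c (bitsT' N)).tgt = ((exW N).mor c (bitsA N f)).src ∧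
    ((exPhi N).mor c (bitsT' N)).comp ((exW N).mor c (bitsA N f)) = (exPhi N).mor c f := by
  have e₁ : block N (fun i => mergeIf c (bitsA N f (i + 2))) =
      block N fun i => mergeIf c !f i := block_congr fun i hi => by
    simp [bitsA, hi]
  have e₂ : block N (fun i => splitIf c (bitsA N f (i + (N + 4)))) =
      block N fun i => splitIf c !f (i + (N + 1)) := block_congr fun i hi => by
    have h₁ : ¬ i + (N + 4) < 2 := by omega
    have h₂ : ¬ i + (N + 4) < N + 2 := by omega
    have h₃ : i + (N + 4) ≠ N + 2 := by omega
    have h₄ : i + (N + 4) ≠ N + 3 := by omega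
    have h₅ : i + (N + 4) < N + (N + 4) := by omega
    have h₆ : i + (N + 4) - 3 = i + (N + 1) := by omega
    simp only [bitsA, h₁, h₂, h₃, h₄, h₅, h₆, if_true, if_false]
  have e₃ : bitsA N f (N + 2) = f N := by simp [bitsA]
  have e₄ : bitsA N f (N + 3) = false := by simp [bitsA]
  have e₅ : bitsA N f (N + (N + 4)) = f (N + (N + 1)) := by
    simp [bitsA]; omega
  have e₆ : bitsA N f (N + (N + 5)) = false := by
    simp [bitsA]
  have e₇ : bitsA N f 0 = false := by simp [bitsA]
  have e₈ : bitsA N f 1 = false := by simp [bitsA]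
  obtain ⟨h₁, h₂⟩ := block_comp_block (n := N) (f := fun _ => split c)
    (g := fun i => mergeIf c !f i) fun i _ => tgt_splitIf_mergeIf _
  obtain ⟨h₃, h₄⟩ := block_comp_block (n := N) (f := fun _ => merge c)
    (g := fun i => splitIf c !f (i + (N + 1))) fun i _ => tgt_merge_splitIf _
  rw [mor_exPhi_bitsT', mor_exW, e₁, e₂, e₃, e₄, e₅, e₆, e₇, e₈, mor_exPhi]
  refine (prod_comp_prod ?_).imp_right fun h => h.trans ?_
  · simp only [List.forall₂_cons, List.forall₂_nil_left_iff, and_true]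
    exact ⟨rfl, rfl, h₁, tgt_edge_splitIf _, rfl, rfl, h₃, tgt_edges_mergeIf _, rfl⟩
  · simp only [List.zipWith_cons_cons, List.zipWith_nil_left, h₂, h₄, split_comp_mergeIf hc,
      merge_comp_splitIf hc, edge_comp_splitIf, edges_comp_mergeIf, edge_comp_edge]
    rfl

/-- The first split of `exTheta` displaces the cells of `Φ` by one place, so the bit `i + 1` now
appears in the column that held the bit `i`. The four cells of `exTheta` fill the columns that are
constantly attached. -/
theorem exTheta_comp_exPhi (hc : c) :
    ((exTheta N).mor c (fun _ => true)).tgt = ((exPhi N).mor c f).src ∧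
    ((exPhi N).mor c (bitsT' N)).tgt = ((exW N).mor c (bitsB N f)).src ∧
    ((exTheta N).mor c (fun _ => true)).comp ((exPhi N).mor c f) =
      ((exPhi N).mor c (bitsT' N)).comp ((exW N).mor c (bitsB N f)) := by
  have e₁ : block N (fun i => mergeIf c (bitsB N f (i + 2))) =
      block N fun i => mergeIf c !f (i + 1) := block_congr fun i hi => by
    simp [bitsB, hi]
  have e₂ : block N (fun i => splitIf c (bitsB N f (i + (N + 4)))) =
      block N fun i => splitIf c !f (i + 1 + (N + 1)) := block_congr fun i hi => by
    have h₁ : i + (N + 4) ≠ 0 := by omega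
    have h₂ : i + (N + 4) ≠ 1 := by omega
    have h₂' : ¬ i + (N + 4) < N + 2 := by omega
    have h₃ : i + (N + 4) ≠ N + 2 := by omega
    have h₄ : i + (N + 4) ≠ N + 3 := by omega
    have h₅ : i + (N + 4) < N + (N + 4) := by omega
    have h₆ : i + (N + 4) - 2 = i + 1 + (N + 1) := by omega
    simp only [bitsB, h₁, h₂, h₂', h₃, h₄, h₅, h₆, if_true, if_false]
  have e₃ : bitsB N f (N + 2) = true := by simp [bitsB]
  have e₄ : bitsB N f (N + 3) = f (N + 1) := by simp [bitsB]
  have e₅ : bitsB N f (N + (N + 4)) = true := by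
    simp [bitsB]; omega
  have e₆ : bitsB N f (N + (N + 5)) = true := by
    simp [bitsB]; omega
  have e₇ : bitsB N f 0 = true := by simp [bitsB]
  have e₈ : bitsB N f 1 = f 0 := by simp [bitsB]
  obtain ⟨h₁, h₂⟩ := block_comp_block (n := N) (f := fun _ => split c)
    (g := fun i => mergeIf c !f (i + 1)) fun i _ => tgt_splitIf_mergeIf _
  obtain ⟨h₃, h₄⟩ := block_comp_block (n := N) (f := fun _ => merge c)
    (g := fun i => splitIf c !f (i + 1 + (N + 1))) fun i _ => tgt_merge_splitIf _
  obtain ⟨h₅, h₆⟩ := block_comp_block (n := N) (f := fun _ => edge c)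
    (g := fun i => splitIf c (f (i + 1))) fun i _ => tgt_edge_splitIf _
  obtain ⟨h₇, h₈⟩ := block_comp_block (n := N) (f := fun _ => edge c * edge c)
    (g := fun i => mergeIf c (f (i + 1 + (N + 1)))) fun i _ => tgt_edges_mergeIf _
  rw [mor_exPhi_bitsT', mor_exW, e₁, e₂, e₃, e₄, e₅, e₆, e₇, e₈, mor_exPhi', mor_exTheta]
  obtain ⟨h₉, h₁₀⟩ := prod_comp_prod (L := [split c, edge c, block N fun _ => edge c, split c,
    edge c, edge c * edge c, block N fun _ => edge c * edge c, merge c, merge c])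
    (M := [edge c * edge c, splitIf c (f 0), block N fun i => splitIf c (f (i + 1)),
      edge c * edge c, edge c, mergeIf c (f (N + 1)),
      block N fun i => mergeIf c (f (i + 1 + (N + 1))), edge c, edge c]) (by
    simp only [List.forall₂_cons, List.forall₂_nil_left_iff, and_true]
    exact ⟨rfl, tgt_edge_splitIf _, h₅, rfl, rfl, tgt_edges_mergeIf _, h₇, rfl, rfl⟩)
  refine ⟨h₉, ?_⟩
  rw [h₁₀]
  refine (prod_comp_prod ?_).imp_right fun h => Eq.trans ?_ h.symm
  · simp only [List.forall₂_cons, List.forall₂_nil_left_iff, and_true]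
    exact ⟨rfl, tgt_edge_splitIf _, h₁, rfl, rfl, tgt_edges_mergeIf _, h₃, rfl, rfl⟩
  · simp only [List.zipWith_cons_cons, List.zipWith_nil_left, h₂, h₄, h₆, h₈,
      split_comp_mergeIf hc, merge_comp_splitIf hc, edge_comp_splitIf, edges_comp_mergeIf,
      split_comp_edges, merge_comp_edge]
    simp only [splitIf, mergeIf, if_true]

/-- `Φ_T` consists of the second split and the first merge of `exTheta`; the witness attaches the
other two cells. No cancellation is allowed, since this is a statement about prefixes. -/
theorem exists_exPhi_comp_eq_exTheta : ∃ F : Mor thompson False,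
    ((exPhi N).mor False fun i => !bitsT' N i).tgt = F.src ∧
    ((exPhi N).mor False fun i => !bitsT' N i).comp F = (exTheta N).mor False fun _ => true := by
  refine ⟨[split False, edge False, block N fun _ => edge False, edge False * edge False,
    edge False, edge False * edge False, block N fun _ => edge False * edge False, edge False,
    merge False].prod, ?_⟩
  have e : (exPhi N).mor False (fun i => !bitsT' N i) =
      [edge False, edge False, block N fun _ => edge False, split False, edge False,
        edge False * edge False, block N fun _ => edge False * edge False, merge False,
        edge False * edge False].prod := by
    rw [mor_exPhi, bitsT'_left, bitsT'_right,
      block_congr (f := fun i => splitIf False !bitsT' N i) (g := fun _ => edge False),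
      block_congr (f := fun i => mergeIf False !bitsT' N (i + (N + 1)))
        (g := fun _ => edge False * edge False)]
    · rfl
    · intro i hi
      simp only [bitsT'_add N hi]
      rfl
    · intro i hi
      simp only [bitsT'_of_lt N hi]
      rfl
  obtain ⟨h₁, h₂⟩ := block_comp_block (n := N) (f := fun _ => edge False)
    (g := fun _ => edge False) fun i _ => rfl
  obtain ⟨h₃, h₄⟩ := block_comp_block (n := N) (f := fun _ => edge False * edge False)
    (g := fun _ => edge False * edge False) fun i _ => rfl
  rw [e, mor_exTheta]
  refine (prod_comp_prod ?_).imp_right fun h => h.trans ?_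
  · simp only [List.forall₂_cons, List.forall₂_nil_left_iff, and_true]
    exact ⟨rfl, rfl, h₁, rfl, rfl, rfl, h₃, rfl, rfl⟩
  · simp only [List.zipWith_cons_cons, List.zipWith_nil_left, h₂, h₄, edge_comp_edge, edge_comp_split, split_comp_edges, edges_comp_edges,
      merge_comp_edge, edges_comp_merge]

/-- The cells of `Φ` other than the first in each half occur in `exXi`; the witness attaches the
remaining two merges on the left and two splits on the right. -/
theorem exists_exPhi_comp_eq_exXi : ∃ F : Mor thompson False,
    ((exPhi N).mor False fun i => !bitsL' N i).tgt = F.src ∧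
    ((exPhi N).mor False fun i => !bitsL' N i).comp F = (exXi N).mor False fun _ => true := by
  refine ⟨[merge False, edge False, block N fun _ => edge False * edge False, merge False,
    edge False, edge False * edge False, block N fun _ => edge False, split False,
    split False].prod, ?_⟩
  have e : (exPhi N).mor False (fun i => !bitsL' N i) =
      [edge False * edge False, edge False, block N fun _ => split False, edge False * edge False,
        edge False, edge False * edge False, block N fun _ => merge False, edge False,
        edge False].prod := by
    rw [mor_exPhi',
      block_congr (f := fun i => splitIf False !bitsL' N (i + 1)) (g := fun _ => split False),
      block_congr (f := fun i => mergeIf False !bitsL' N (i + 1 + (N + 1)))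
        (g := fun _ => merge False)]
    · simp [bitsL', splitIf, mergeIf]
    · intro i hi
      simp [bitsL', mergeIf]
    · intro i hi
      simp [bitsL', splitIf, hi.ne]
  obtain ⟨h₁, h₂⟩ := block_comp_block (n := N) (f := fun _ => split False)
    (g := fun _ => edge False * edge False) fun i _ => rfl
  obtain ⟨h₃, h₄⟩ := block_comp_block (n := N) (f := fun _ => merge False)
    (g := fun _ => edge False) fun i _ => rfl
  rw [e, mor_exXi]
  refine (prod_comp_prod ?_).imp_right fun h => h.trans ?_
  · simp only [List.forall₂_cons, List.forall₂_nil_left_iff, and_true]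
    exact ⟨rfl, rfl, h₁, rfl, rfl, rfl, h₃, rfl, rfl⟩
  · simp only [List.zipWith_cons_cons, List.zipWith_nil_left, h₂, h₄, edge_comp_edge, edge_comp_split, split_comp_edges, edges_comp_edges,
      merge_comp_edge, edges_comp_merge]

/-- In every column one of the two factors has no cell, so `W₁⁻¹ = W₀⁻¹ ∘ Φ_{T'}` is already thin
and no cancellation is needed. -/
theorem inv_exTheta_comp_exPhi :
    (((exTheta N).mor c fun _ => true).inv).comp ((exPhi N).mor c (bitsT' N)) =
      (exXi N).mor c fun _ => true := by
  have e : ((exTheta N).mor c fun _ => true).inv =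
      [merge c, edge c, block N fun _ => edge c, merge c, edge c, edge c * edge c,
        block N fun _ => edge c * edge c, split c, split c].prod := by
    rw [mor_exTheta]
    simp only [List.prod_cons, List.prod_nil, inv_mul, inv_one, inv_block]
    rfl
  obtain ⟨h₁, h₂⟩ := block_comp_block (n := N) (f := fun _ => edge c)
    (g := fun _ => split c) fun i _ => rfl
  obtain ⟨h₃, h₄⟩ := block_comp_block (n := N) (f := fun _ => edge c * edge c)
    (g := fun _ => merge c) fun i _ => rfl
  rw [e, mor_exPhi_bitsT', (prod_comp_prod ?_).2, mor_exXi]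
  · simp only [List.zipWith_cons_cons, List.zipWith_nil_left, h₂, h₄, edge_comp_edge, edge_comp_split, split_comp_edges, edges_comp_edges,
      merge_comp_edge, edges_comp_merge]
  · simp only [List.forall₂_cons, List.forall₂_nil_left_iff, and_true]
    exact ⟨rfl, rfl, h₁, rfl, rfl, rfl, h₃, rfl, rfl⟩

theorem tree_comp_exTheta (hc : c) : (tree c (N + 1)).tgt = (exPhi N).top ∧
    (tree c (N + 1)).tgt = (exTheta N).top ∧
    (tree c (N + 1)).comp ((exTheta N).mor c fun _ => true) = (gMor c).comp (tree c (N + 1)) := by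
  have e : (exTheta N).mor c (fun _ => true) =
      split c * mk c (Arr.id (xs (N + 1))) * split c *
        (edge c * (mk c (Arr.id (xs (2 * (N + 1)))) * (merge c * merge c))) := by
    rw [mor_exTheta, ← block_edge, ← block_edges, block_succ', block_succ']
    simp [mul_assoc]
  have h₁ : (tree c (N + 1)).tgt = ((exTheta N).mor c fun _ => true).src := by
    rw [e, tree]
    simp only [tgt_mul, src_mul, tgt_leftComb, tgt_rightTree, src_split, src_merge, src_mk,
      tgt_edge, src_edge]
    refine List.ext_get (by simp [xs, Arr.id]; omega) fun _ _ _ => rfl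
  have h₂ : (exTheta N).top = (exPhi N).top := by
    obtain ⟨F, h₁, h₂⟩ := exists_exPhi_comp_eq_exTheta N
    exact (congrArg src h₂).symm.trans (src_comp _ _)
  exact ⟨h₁.trans h₂, h₁, by rw [e, tree_comp hc]⟩

theorem offset_exPhi (i : ℕ) : (exPhi N).offset 0 i =
    if i < N + 1 then 2 + i else if i - (N + 1) < N + 1 then N + 6 + 2 * (i - (N + 1)) else 0 := by
  simp only [exPhi, Thin.offset, Thin.offset_splits, Thin.offset_merges]
  grind

theorem offset_exTheta (i : ℕ) (hi : i < 4) : (exTheta N).offset 0 i =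
    if i = 0 then 0 else if i = 1 then N + 2 else if i = 2 then 3 * N + 6 else 3 * N + 8 := by
  simp only [exTheta, Thin.offset, Thin.offset_splits, Thin.offset_merges, Thin.offset_edges]
  grind

theorem offset_exXi (i : ℕ) (hi : i < 2 * N + 4) : (exXi N).offset 0 i =
    if i = 0 then 0 else if i < N + 1 then 2 + i else if i = N + 1 then N + 3
      else if i < 2 * N + 2 then N + 8 + 2 * (i - (N + 2)) else N + 6 + i := by
  simp only [exXi, Thin.offset, Thin.offset_splits, Thin.offset_merges]
  grind

end Example

/-! ### Vertices as classes of diagrams -/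

section Vertex

variable {u v z : List A}

/-- The class of a diagram, forgetting its labels. -/
def DiagClass.mor : DiagClass P u v → Mor P True :=
  Quot.lift (fun d => Mor.mk True ⟨u, v, d.steps, d.valid⟩) fun _ _ h =>
    Quot.sound ⟨rfl, rfl, h.imp (fun h => h) fun h => ⟨trivial, h⟩⟩

theorem DiagClass.mor_comp (U : DiagClass P u v) (V : DiagClass P v z) :
    (U.comp V).mor = U.mor.comp V.mor := by
  induction U using Quot.ind with | _ d
  induction V using Quot.ind with | _ e
  exact congrArg (Mor.mk True) (Arr.comp_eq (a := ⟨u, v, d.steps, d.valid⟩)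
    (b := ⟨v, z, e.steps, e.valid⟩) rfl).symm

/-- This supplies `U` and `U₀` with the required bottom labels, which agree with those of the
computed diagrams only propositionally. -/
theorem DiagClass.exists_mor_eq (m : Mor P True) (hu : m.src = u) (hv : m.tgt = v) :
    ∃ U : DiagClass P u v, U.mor = m := by
  induction m using Quot.ind with | _ a
  obtain ⟨u', v', l, hl⟩ := a
  change u' = u at hu
  change v' = v at hv
  subst hu hv
  exact ⟨Quot.mk _ ⟨l, hl⟩, rfl⟩

theorem Vertex.ext_mor {X Y : Vertex P w} (h : X.2.mor = Y.2.mor) : X = Y := by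
  obtain ⟨u, U⟩ := X
  obtain ⟨v, V⟩ := Y
  induction U using Quot.ind
  induction V using Quot.ind
  exact vertex_eq_of_mor_eq h

theorem mor_cubeVertex {k : ℕ} (Φ : Thin P k) (U : DiagClass P w Φ.top) (J : Fin k → Bool) :
    (cubeVertex Φ U J).2.mor = U.mor.comp (Mor.mk True (Φ.arr J)) := U.mor_comp _

theorem act_cubePoint {k : ℕ} (g : DiagClass P w w) (Φ : Thin P k) (U : DiagClass P w Φ.top)
    (t : Fin k → Set.Icc (0 : ℝ) 1) : act g (cubePoint Φ U t) = cubePoint Φ (g.comp U) t :=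
  Subtype.ext (mapDomain_cubeWeight g Φ U t)

end Vertex

/-- Extend a finite sequence of bits by zeros. -/
def extendBits {k : ℕ} (J : Fin k → Bool) (i : ℕ) : Bool := if h : i < k then J ⟨i, h⟩ else false

theorem extendBits_val {k : ℕ} (J : Fin k → Bool) : (fun i : Fin k => extendBits J i) = J := by
  funext i
  simp [extendBits]

theorem sum_bitWeight_extendBits {k : ℕ} (t : Fin k → ℝ) (Y : ℕ → ℝ) (hY : ∀ i : Fin k, t i = Y i)
    {m : ℕ} (hm : m < k) :
    ∑ J, bitWeight t J * (if extendBits J m = true then 1 else 0) = Y m := by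
  have := sum_bitWeight_mul t ⟨m, hm⟩ fun b => if b = true then 1 else 0
  simpa [extendBits, hm, hY] using this

theorem sum_bitWeight_not_extendBits {k : ℕ} (t : Fin k → ℝ) (Y : ℕ → ℝ)
    (hY : ∀ i : Fin k, t i = Y i) {m : ℕ} (hm : m < k) :
    ∑ J, bitWeight t J * (if (!extendBits J m) = true then 1 else 0) = 1 - Y m := by
  have := sum_bitWeight_mul t ⟨m, hm⟩ fun b => if (!b) = true then 1 else 0
  simpa [extendBits, hm, hY] using this

/-! ### The distance from `y` to `g y` -/

section Example

open Mor

variable (N : ℕ)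

/-- The coordinates of the point `y`. -/
noncomputable def exCoord (n i : ℕ) : ℝ :=
  (if i < n then (i : ℝ) + 1 else (i : ℝ) - (n : ℝ) + 1) / ((n : ℝ) + 1)

theorem exCoord_mem {n i : ℕ} (hi : i < n + n) : exCoord n i ∈ Set.Icc (0 : ℝ) 1 := by
  have hn : (0 : ℝ) < n + 1 := by positivity
  unfold exCoord
  rw [Set.mem_Icc, le_div_iff₀ hn, div_le_iff₀ hn, zero_mul, one_mul]
  have h₂ : (i : ℝ) < n + n := by exact_mod_cast hi
  split_ifs with h
  · have : (i : ℝ) < n := by exact_mod_cast h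
    exact ⟨by positivity, by linarith⟩
  · have : (n : ℝ) ≤ i := by exact_mod_cast not_lt.1 h
    exact ⟨by linarith, by linarith⟩

theorem sq_sub_sum_bits (t : Fin (0 + (N + 1) + (N + 1)) → ℝ) (ht : ∀ i, t i = exCoord (N + 1) i)
    {i : ℕ} (hi : i < N + (N + 6)) :
    (∑ J, bitWeight t J * (if bitsA N (extendBits J) i = true then 1 else 0) -
      ∑ J, bitWeight t J * (if bitsB N (extendBits J) i = true then 1 else 0)) ^ 2 =
      if i = 0 ∨ i = N + (N + 5) then (1 : ℝ) else 1 / ((N : ℝ) + 2) ^ 2 := by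
  have hp : (N : ℝ) + 2 ≠ 0 := by positivity
  have hp' : (N : ℝ) + 1 + 1 ≠ 0 := by positivity
  have h₀ : ∑ J, bitWeight t J * (if false = true then 1 else 0) = 0 := by simp
  have h₁ : ∑ J, bitWeight t J * (if true = true then 1 else 0) = 1 := by simp [sum_bitWeight]
  have h₂ : ∀ m, m < 0 + (N + 1) + (N + 1) → _ := fun _ => sum_bitWeight_extendBits t _ ht
  have h₃ : ∀ m, m < 0 + (N + 1) + (N + 1) → _ := fun _ => sum_bitWeight_not_extendBits t _ ht
  -- In each direction of `W` the bits of `Q` and `g Q` are a constant, a bit of `J` or its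
  -- negation. It suffices to name these two bits and subtract their means.
  have key : ∀ σ τ : (ℕ → Bool) → Bool, (∀ f, bitsA N f i = σ f) → (∀ f, bitsB N f i = τ f) →
      ∀ x y : ℝ, ∑ J, bitWeight t J * (if σ (extendBits J) = true then 1 else 0) = x →
      ∑ J, bitWeight t J * (if τ (extendBits J) = true then 1 else 0) = y →
      (x - y) ^ 2 = (if i = 0 ∨ i = N + (N + 5) then (1 : ℝ) else 1 / ((N : ℝ) + 2) ^ 2) →
      (∑ J, bitWeight t J * (if bitsA N (extendBits J) i = true then 1 else 0) -
      ∑ J, bitWeight t J * (if bitsB N (extendBits J) i = true then 1 else 0)) ^ 2 =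
      if i = 0 ∨ i = N + (N + 5) then (1 : ℝ) else 1 / ((N : ℝ) + 2) ^ 2 := by
    intro σ τ hσ hτ x y hx hy h
    simp only [hσ, hτ, hx, hy, h]
  rcases (by omega : i = 0 ∨ i = 1 ∨ (2 ≤ i ∧ i < N + 2) ∨ i = N + 2 ∨ i = N + 3 ∨
    (N + 4 ≤ i ∧ i < N + (N + 4)) ∨ i = N + (N + 4) ∨ i = N + (N + 5)) with
    h | h | h | h | h | h | h | h
  · refine key (fun _ => false) (fun _ => true) ?_ ?_ _ _ h₀ h₁ ?_
    · intro f; grind [bitsA]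
    · intro f; grind [bitsB]
    · simp [h]
  · refine key (fun _ => false) (fun f => f 0) ?_ ?_ _ _ h₀ (h₂ 0 (by omega)) ?_
    · intro f; grind [bitsA]
    · intro f; grind [bitsB]
    · rw [if_neg (by omega)]
      simp [exCoord]
      field_simp
      ring
  · obtain ⟨j, rfl⟩ := Nat.exists_eq_add_of_le' h.1
    refine key (fun f => !f j) (fun f => !f (j + 1)) ?_ ?_ _ _ (h₃ j (by omega))
      (h₃ (j + 1) (by omega)) ?_
    · intro f; grind [bitsA]
    · intro f; grind [bitsB]
    · rw [if_neg (by omega), exCoord, exCoord, if_pos (by omega), if_pos (by omega)]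
      push_cast
      field_simp
      ring
  · refine key (fun f => f N) (fun f => true) ?_ ?_ _ _ (h₂ N (by omega)) h₁ ?_
    · intro f; grind [bitsA]
    · intro f; grind [bitsB]
    · rw [if_neg (by omega), exCoord, if_pos (by omega)]
      push_cast
      field_simp
      ring
  · refine key (fun f => false) (fun f => f (N + 1)) ?_ ?_ _ _ h₀ (h₂ (N + 1) (by omega)) ?_
    · intro f; grind [bitsA]
    · intro f; grind [bitsB]
    · rw [if_neg (by omega), exCoord, if_neg (by omega)]
      push_cast
      field_simp
      ring
  · obtain ⟨j, rfl⟩ := Nat.exists_eq_add_of_le' h.1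
    refine key (fun f => !f (j + (N + 1))) (fun f => !f (j + (N + 2))) ?_ ?_ _ _
      (h₃ (j + (N + 1)) (by omega)) (h₃ (j + (N + 2)) (by omega)) ?_
    · intro f; grind [bitsA]
    · intro f; grind [bitsB]
    · rw [if_neg (by omega), exCoord, exCoord, if_neg (by omega), if_neg (by omega)]
      push_cast
      field_simp
      ring
  · refine key (fun f => f (N + (N + 1))) (fun f => true) ?_ ?_ _ _ (h₂ (N + (N + 1)) (by omega)) h₁ ?_
    · intro f; grind [bitsA]
    · intro f; grind [bitsB]
    · rw [if_neg (by omega), exCoord, if_neg (by omega)]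
      push_cast
      field_simp
      ring
  · refine key (fun _ => false) (fun _ => true) ?_ ?_ _ _ h₀ h₁ ?_
    · intro f; grind [bitsA]
    · intro f; grind [bitsB]
    · simp [h]

/-- The two extreme directions contribute `1` each and the other `2 (N + 2)` contribute `1 / (N +
2)²` each. -/
theorem sum_sq_eq {d : ℕ} (hd : d = N + (N + 6)) :
    ∑ i : Fin d, (if (i : ℕ) = 0 ∨ (i : ℕ) = N + (N + 5) then (1 : ℝ) else 1 / ((N : ℝ) + 2) ^ 2) =
      2 + 2 / ((N : ℝ) + 2) := by
  subst hd
  rw [Fin.sum_univ_eq_sum_range (fun i => if i = 0 ∨ i = N + (N + 5) then (1 : ℝ)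
    else 1 / ((N : ℝ) + 2) ^ 2), show N + (N + 6) = N + N + 4 + 1 + 1 by omega,
    Finset.sum_range_succ, Finset.sum_range_succ', Finset.sum_congr rfl fun i hi =>
      if_neg (by have := Finset.mem_range.1 hi; omega), if_pos (Or.inl rfl),
    if_pos (Or.inr (by omega))]
  have hp : (N : ℝ) + 2 ≠ 0 := by positivity
  simp
  field_simp
  ring

/-- The dimensions are variables tied by equations, because the explicit thin diagrams have counts
such as `0 + (N + 1) + (N + 1)` in their types. -/
theorem exists_cube (n N k d : ℕ) (hn : n = N + 1) (hk : 0 + (N + 1) + (N + 1) = k)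
    (hd : 0 + 2 + N + 1 + 1 + N + 2 = d) :
      ∃ (Φ : Thin thompson k) (U : DiagClass thompson (xs 3) Φ.top)
        (W₀ : Diagram thompson Φ.top Φ.top)
        (T L : Fin k → Bool)
        (W : Thin thompson d) (U₀ : DiagClass thompson (xs 3) W.top)
        (y : Fin k → Set.Icc (0 : ℝ) 1),
        W₀.Reduced ∧ U.comp W₀.toClass = gElt.comp U ∧
        (Φ.part T).IsGlb W₀ Φ.full ∧
        (Φ.part L).IsGlb ((Φ.part fun i => !T i).inv.comp W₀).inv Φ.full ∧
        (⟨W.top, U₀⟩ : Vertex thompson (xs 3)) = cubeVertex Φ U (fun i => !T i) ∧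
        W.full.Reduced ∧
        cubeVertex W U₀ (fun _ => true) =
          cubeVertex Φ (gElt.comp U) (fun i => !L i) ∧
        Set.range (cubePoint W U₀) = prefixComplex U₀ W.full ∧
        (∀ s t : Fin d → Set.Icc (0 : ℝ) 1,
          pathDist (cubePoint W U₀ s) (cubePoint W U₀ t) = ENNReal.ofReal (cubeDist s t)) ∧
        (∀ i : Fin k, (y i : ℝ) =
          (if (i : ℕ) < n then (i : ℝ) + 1 else (i : ℝ) - (n : ℝ) + 1) / ((n : ℝ) + 1)) ∧
        pathDist (cubePoint Φ U y) (act gElt (cubePoint Φ U y)) =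
          ENNReal.ofReal (Real.sqrt (2 + 2 / ((n : ℝ) + 1))) := by
  subst hn hk hd
  have tr := @tree_comp_exTheta N True trivial
  have tp := fun f => @exTheta_comp_exPhi N True f trivial
  have pw := fun f => @exPhi_comp_exW N True f trivial
  obtain ⟨U, hU⟩ := DiagClass.exists_mor_eq (tree True (N + 1)) (src_tree _) tr.1
  have hΘ₀ : (exTheta N).top = (exPhi N).top := tr.2.1.symm.trans tr.1
  have hΘ₁ : ((exTheta N).word fun _ => true) = (exPhi N).top := (tp fun _ => false).1
  have hW : (exPhi N).word (fun i => bitsT' N i) = (exW N).top := (pw fun _ => false).1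
  have hΘ : IsDerivation ((exTheta N).steps [] fun _ => true) (exPhi N).top (exPhi N).top := by
    have := (exTheta N).steps_valid [] fun _ => true
    rw [List.nil_append, List.nil_append, hΘ₁, hΘ₀] at this
    exact this
  have hΘ' : (⟨_, _, _, hΘ⟩ : Arr thompson) = (exTheta N).arr fun _ => true :=
    Arr.ext hΘ₀.symm hΘ₁.symm rfl
  -- `U₀` is `U Φ_{T'}`, regarded as a class whose bottom label is the top label of `W`.
  obtain ⟨U₀, hU₀⟩ := DiagClass.exists_mor_eq (u := xs 3) (v := (exW N).top)
    ((tree True (N + 1)).comp ((exPhi N).mor True (bitsT' N)))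
    ((Mor.src_comp _ _).trans (src_tree _)) ((Mor.tgt_comp tr.1).trans hW)
  have hA : ∀ J, cubeVertex (exPhi N) U J =
      cubeVertex (exW N) U₀ fun i => bitsA N (extendBits J) i := fun J => by
    refine Vertex.ext_mor ?_
    rw [mor_cubeVertex, mor_cubeVertex, hU, hU₀]
    refine Eq.trans ?_ (Mor.comp_assoc tr.1 (pw _).1).symm
    refine congrArg _ (Eq.trans ?_ (pw (extendBits J)).2.symm)
    rw [Thin.mor, extendBits_val]
  have hB : ∀ J, cubeVertex (exPhi N) (gElt.comp U) J =
      cubeVertex (exW N) U₀ fun i => bitsB N (extendBits J) i := fun J => by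
    refine Vertex.ext_mor ?_
    rw [mor_cubeVertex, mor_cubeVertex, DiagClass.mor_comp, hU, hU₀]
    refine Eq.trans ?_ (Mor.comp_assoc tr.1 (tp _).2.1).symm
    refine Eq.trans ?_ (congrArg _ (tp (extendBits J)).2.2)
    refine Eq.trans ?_ (Mor.comp_assoc tr.2.1 (tp _).1)
    rw [tr.2.2, Thin.mor, extendBits_val]
    rfl
  have hb := isWallFamily_cubeWalls (exW N) U₀
  have hw := cubeWalls_cubeVertex (exW N) U₀
  let y : Fin (0 + (N + 1) + (N + 1)) → Set.Icc (0 : ℝ) 1 := fun i =>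
    ⟨exCoord (N + 1) i, exCoord_mem (by omega)⟩
  refine ⟨exPhi N, U, Quot.mk _ ⟨_, hΘ⟩, fun i => !bitsT' N i, fun i => !bitsL' N i, exW N, U₀, y,
    Thin.reduced_of_steps _ _ hΘ, ?_, ?_, ?_, ?_, Thin.reduced_of_steps _ _ _, ?_,
    range_cubePoint hb hw, pathDist_cubePoint hb hw, fun _ => rfl, ?_⟩
  · refine eq_of_heq (Sigma.mk.inj (Vertex.ext_mor (X := ⟨_, U.comp _⟩) (Y := ⟨_, gElt.comp U⟩)
      ?_)).2
    rw [DiagClass.mor_comp, DiagClass.mor_comp, hU]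
    refine Eq.trans (congrArg _ (congrArg (Mor.mk True) hΘ')) tr.2.2
  · obtain ⟨F, hF, hTF⟩ := exists_exPhi_comp_eq_exTheta N
    refine Thin.isGlb_part (exPhi N) (exTheta N) hΘ₀ hΘ _ F hF hTF fun i j h => ?_
    rw [offset_exPhi, offset_exTheta N _ j.2] at h
    have hi := i.2
    have hj := j.2
    simp only [bitsT', Bool.not_not, Bool.or_eq_true, decide_eq_true_eq]
    split_ifs at h <;> omega
  · suffices ∀ J : Fin (0 + (N + 1) + (N + 1)) → Bool, J = (fun i : Fin _ => bitsT' N i) →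
        ((exPhi N).part fun i => !bitsL' N i).IsGlb
          (((exPhi N).part J).inv.comp (Quot.mk _ ⟨_, hΘ⟩)).inv (exPhi N).full from
      this _ (funext fun _ => Bool.not_not _)
    rintro _ rfl
    have e := inv_exTheta_comp_exPhi N (c := False)
    have hi : ((exTheta N).mor False fun _ => true).inv.tgt =
        ((exPhi N).mor False (bitsT' N)).src := (Mor.tgt_inv _).trans hΘ₀
    have hΞ₀ : (exXi N).top = (exPhi N).top :=
      (congrArg Mor.src e).symm.trans (((Mor.src_comp _ _).trans (Mor.src_inv _)).trans hΘ₁)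
    have hΞ₁ : ((exXi N).word fun _ => true) = (exPhi N).word fun i => bitsT' N i :=
      (congrArg Mor.tgt e).symm.trans (Mor.tgt_comp hi)
    have hΞ : IsDerivation ((exXi N).steps [] fun _ => true) (exPhi N).top
        ((exPhi N).word fun i => bitsT' N i) := by
      have := (exXi N).steps_valid [] fun _ => true
      rw [List.nil_append, List.nil_append, hΞ₁, hΞ₀] at this
      exact this
    have hD : (((exPhi N).part fun i => bitsT' N i).inv.comp (Quot.mk _ ⟨_, hΘ⟩)).inv =
        Quot.mk _ ⟨_, hΞ⟩ := by
      refine diagram_eq_of_mor_eq (d := ((Derivation.inv ⟨_, (exPhi N).steps_valid [] _⟩).comp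
        ⟨_, hΘ⟩).inv) (e := ⟨_, hΞ⟩) ?_
      have e₁ : (⟨_, _, _, hΞ⟩ : Arr thompson) = (exXi N).arr fun _ => true :=
        Arr.ext hΞ₀.symm hΞ₁.symm rfl
      refine Eq.trans ?_ (e.trans (congrArg (Mor.mk False) e₁).symm)
      change _ = Mor.mk False (Arr.comp (Arr.inv _) _)
      rw [← hΘ', Arr.comp_eq (by rfl)]
      refine congrArg _ (Arr.ext rfl rfl ?_)
      simp [Derivation.inv, Derivation.comp, Arr.inv, Thin.arr, Function.comp_def, Atomic.inv_inv]
    refine (congrArg (Diagram.IsGlb _ · _) hD).mpr ?_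
    obtain ⟨F, hF, hTF⟩ := exists_exPhi_comp_eq_exXi N
    refine Thin.isGlb_part (exPhi N) (exXi N) hΞ₀ hΞ _ F hF hTF fun i j h => ?_
    have hi := i.2
    have hj := j.2
    rw [offset_exPhi, offset_exXi N _ (by omega)] at h
    simp only [bitsL', Bool.not_eq_true', Bool.or_eq_false_iff, decide_eq_false_iff_not]
    split_ifs at h <;> omega
  · refine Vertex.ext_mor ?_
    rw [mor_cubeVertex, hU]
    simp only [Bool.not_not]
    exact hU₀
  · rw [hB]
    refine congrArg _ (funext fun i => ?_)
    have := i.2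
    simp only [Bool.not_not]
    symm
    grind [bitsB, bitsL', extendBits]
  · rw [act_cubePoint, pathDist_eq_of_cubePoint_eq hb hw
      (exists_cubePoint_eq hb hw _ _ _ fun J _ => ⟨_, hA J⟩)
      (exists_cubePoint_eq hb hw _ _ _ fun J _ => ⟨_, hB J⟩)]
    -- The wall coordinates of `y` and `g y` become the means of the bits `bitsA` and `bitsB` under
    -- the weights of `y`.
    simp only [wallCoord_cubePoint, hA, hB, hw]
    rw [Finset.sum_congr rfl fun i _ => sq_sub_sum_bits N _ (fun _ => rfl) (by omega),
      sum_sq_eq N (by omega)]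
    push_cast
    ring_nf

end Example

end DiagramGroup

/-! ### The proposition and the limit `n → ∞` -/

theorem mainTheorem4 :
    (∀ n : ℕ, 1 ≤ n →
      ∃ (Φ : Thin thompson (2 * n)) (U : DiagClass thompson (xs 3) Φ.top)
        (W₀ : Diagram thompson Φ.top Φ.top)
        (T L : Fin (2 * n) → Bool)
        (W : Thin thompson (2 * n + 4)) (U₀ : DiagClass thompson (xs 3) W.top)
        (y : Fin (2 * n) → Set.Icc (0 : ℝ) 1),
        -- `W₀` is the reduced diagram `U⁻¹ g U`
        W₀.Reduced ∧ U.comp W₀.toClass = gElt.comp U ∧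
        -- `Φ_T` is the greatest lower bound of `W₀` and `Φ`
        (Φ.part T).IsGlb W₀ Φ.full ∧
        -- `Φ_L` is the greatest lower bound of `W₁⁻¹` and `Φ`, where `W₁ = Φ_{T'}⁻¹ ∘ W₀`
        (Φ.part L).IsGlb ((Φ.part fun i => !T i).inv.comp W₀).inv Φ.full ∧
        -- `U₀ = U Φ_{T'}`, and `U₀ W = V₀`, where `V₀ = g U Φ_{L'}` and `W` is reduced and thin
        (⟨W.top, U₀⟩ : Vertex thompson (xs 3)) = cubeVertex Φ U (fun i => !T i) ∧
        W.full.Reduced ∧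
        cubeVertex W U₀ (fun _ => true) =
          cubeVertex Φ (gElt.comp U) (fun i => !L i) ∧
        -- the subcomplex `K_{U₀,V₀}` is a full cube, isometric to the Euclidean cube
        Set.range (cubePoint W U₀) = prefixComplex U₀ W.full ∧
        (∀ s t : Fin (2 * n + 4) → Set.Icc (0 : ℝ) 1,
          pathDist (cubePoint W U₀ s) (cubePoint W U₀ t) = ENNReal.ofReal (cubeDist s t)) ∧
        -- the point `y` of `Q = C(U, Φ)`
        (∀ i : Fin (2 * n), (y i : ℝ) =
          (if (i : ℕ) < n then (i : ℝ) + 1 else (i : ℝ) - (n : ℝ) + 1) / ((n : ℝ) + 1)) ∧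
        pathDist (cubePoint Φ U y) (act gElt (cubePoint Φ U y)) =
          ENNReal.ofReal (Real.sqrt (2 + 2 / ((n : ℝ) + 1)))) ∧
    (∀ ε : ℝ, 0 < ε → ∃ p : Realization thompson (xs 3),
      pathDist p (act gElt p) ≠ ⊤ ∧
      |(pathDist p (act gElt p)).toReal - Real.sqrt 2| < ε) ∧
    (⨅ p : Realization thompson (xs 3), pathDist p (act gElt p)) ≤
      ENNReal.ofReal (Real.sqrt 2) := by
  -- The construction is indexed by `N = n - 1`, so that each half of `Φ` has the `N + 1` cells
  -- required.
  have main := fun n (hn : 1 ≤ n) => exists_cube n (n - 1) (2 * n) (2 * n + 4) (by omega) (by omega)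
    (by omega)
  have hdist : ∀ n : ℕ, 1 ≤ n → ∃ p : Realization thompson (xs 3), pathDist p (act gElt p) =
      ENNReal.ofReal (Real.sqrt (2 + 2 / ((n : ℝ) + 1))) := fun n hn => by
    obtain ⟨Φ, U, W₀, T, L, W, U₀, y, -, -, -, -, -, -, -, -, -, -, h⟩ := main n hn
    exact ⟨_, h⟩
  have hlim : Filter.Tendsto (fun n : ℕ => Real.sqrt (2 + 2 / ((n : ℝ) + 1))) Filter.atTop
      (nhds (Real.sqrt 2)) := by
    have h₁ : Filter.Tendsto (fun n : ℕ => 2 + 2 * (1 / ((n : ℝ) + 1))) Filter.atTop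
        (nhds (2 + 2 * 0)) := (tendsto_one_div_add_atTop_nhds_zero_nat.const_mul 2).const_add 2
    simp only [mul_one_div, mul_zero, add_zero] at h₁
    exact (Real.continuous_sqrt.tendsto 2).comp h₁
  refine ⟨main, fun ε hε => ?_, ?_⟩
  · obtain ⟨n, hn, hn'⟩ := ((Metric.tendsto_nhds.1 hlim ε hε).and
      (Filter.eventually_ge_atTop 1)).exists
    obtain ⟨p, hp⟩ := hdist n hn'
    refine ⟨p, by rw [hp]; exact ENNReal.ofReal_ne_top, ?_⟩
    rwa [hp, ENNReal.toReal_ofReal (Real.sqrt_nonneg _), ← Real.dist_eq]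
  -- The infimum is at most each of the distances attained, hence at most their limit.
  · refine ge_of_tendsto ((ENNReal.continuous_ofReal.tendsto _).comp hlim) ?_
    filter_upwards [Filter.eventually_ge_atTop 1] with n hn
    obtain ⟨p, hp⟩ := hdist n hn
    exact (iInf_le _ p).trans hp.le
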